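/- **Setting.** Let $M$ be a smooth manifold of dimension $n=6$ and let $\mathbf p$ be a projective structure on $M$, i.e. a class of torsion-free affine connections of the form $\{\hat\nabla:\hat\nabla_aU^b=\nabla_aU^b+\Upsilon_aU^b+\Upsilon_cU^c\delta_a{}^b,\ \Upsilon \text{ a 1-form}\}$. Let $\mathcal E(1)$ be the positive $(2n+2)$-nd root of the line bundle $(\Lambda^nTM)^{2}$, let $\mathcal T$ be the standard tractor bundle (of rank $n+1=7$), the dual of the bundle $J^1\mathcal E(1)$ of 1-jets of sections of $\mathcal E(1)$, and let $\nabla^{\mathcal T}$ be its normal tractor connection: in the splitting given by a (local) connection $\nabla\in\mathbf p$ that preserves a volume density, $$\nabla^{\mathcal T}_a(\nu^b,\rho)=(\nabla_a\nu^b+\rho\,\delta_a{}^b,\ \nabla_a\rho-P_{ab}\nu^b),\qquad P_{ab}=\tfrac1{n-1}R_{ca}{}^{c}{}_{b},\qquad R_{ab}{}^c{}_dU^d=[\nabla_a,\nabla_b]U^c .$$ **Algebra.** Let $\mathbb V$ be a real 7-dimensional vector space. * A 3-form $\Phi\in\Lambda^3\mathbb V^*$ is *generic* (stable) if its $GL(\mathbb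 V)$-orbit is open. With $\widetilde H(x,y)=\frac16(x\lrcorner\Phi)\wedge(y\lrcorner\Phi)\wedge\Phi\in\Lambda^7\mathbb V^*$, a generic $\Phi$ determines a volume form $\epsilon_\Phi\neq0$ by $\epsilon_\Phi^{\otimes 9}=\det\widetilde H$ and a nondegenerate symmetric bilinear form $H$ by $\widetilde H=H\otimes\epsilon_\Phi$. It is *definite* if $H$ has signature $(7,0)$ and *split* if $H$ has signature $(3,4)$. * A *cross product* on $\mathbb V$ is a skew-symmetric bilinear map $\times:\mathbb V\times\mathbb V\to\mathbb V$ for which there is a nondegenerate symmetric bilinear form $\cdot$ with $(x\times y)\cdot x=0$ and $(x\times y)\cdot(x\times y)=(x\cdot x)(y\cdot y)-(x\cdot y)^2$ for all $x,y$; this form is then $x\cdot y=-\frac16\operatorname{tr}(x\times(y\times\,\cdot\,))$. It is *definite* (resp. *split*) if it is isomorphic to the product $x\times y=\frac12(xy-yx)$ on the imaginary octonions (resp. imaginary split octonions). A tractor 3-form (a smooth section of $\Lambda^3\mathcal T^*$) is *generic* if it is so in each fibre; a *tractor cross product* is a smooth bilinear bundle map $\mathcal T\times\mathcal T\to\mathcal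 T$ that is a cross product in each fibre. *Parallel* means parallel for the connection induced by $\nabla^{\mathcal T}$. **Proposition.** 1. Let $\Phi$ be a parallel generic tractor 3-form, with fibrewise bilinear form $H$. There is a unique bilinear product $\times$ on the fibres of $\mathcal T$ with $H(w,u\times v)=\Phi(w,u,v)$, i.e. $\times^A{}_{BC}=H^{AK}\Phi_{KBC}$, and $\times$ is a parallel tractor cross product. 2. Let $\times$ be a parallel tractor cross product. There is a unique tractor 3-form $\Phi$ with $\Phi(w,u,v)=w\cdot(u\times v)$, and $\Phi$ is a parallel generic tractor 3-form. 3. The two constructions are mutually inverse: for a parallel generic tractor 3-form $\Phi$ and a parallel tractor cross product $\times$, the product $\times$ arises from $\Phi$ as in 1 if and only if $\Phi$ arises from $\times$ as in 2. 4. If $\Phi$ and $\times$ correspond in this way, then at each point $\Phi$ is definite if and only if $\times$ is definite, and $\Phi$ is split if and only if $\times$ is split. -/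

import Mathlib

open scoped Manifold ContDiff Topology
namespace ProjTractor

/-- Coordinate space `ℝⁿ`. -/
abbrev Coord (n : ℕ) : Type := EuclideanSpace ℝ (Fin n)

section Transition
variable {n : ℕ} {M : Type*} [TopologicalSpace M] [ChartedSpace (Coord n) M]

/-- The change of coordinates `φ_j ∘ φ_i⁻¹` between two charts of the atlas. -/
noncomputable def transition (i j : atlas (Coord n) M) : Coord n → Coord n :=
  fun u => j.1 (i.1.symm u)

/-- `|det D(φ_j ∘ φ_i⁻¹)|^{-1/(n+1)}`: the factor by which the local expression of a density of
projective weight `-1` (a section of the dual of `E(1)`, where `E(1)` is the positive root of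
order `2n + 2` of the square of the top exterior power of the tangent bundle) changes from the
chart `i` to the chart `j`. -/
noncomputable def densityFactor (i j : atlas (Coord n) M) (u : Coord n) : ℝ :=
  |(fderiv ℝ (transition i j) u).det| ^ (-(1 / ((n : ℝ) + 1)))

/-- Change of coordinates of tractors from the chart `i` to the chart `j`. In a chart, a tractor is
a pair `(ν, ρ)` of a vector and a number, split by means of the coordinate scale, and acts on the
1-jet of a local expression `f` of a section of `E(1)` by `Df(ν) + ρ f`; so the tractor bundle is
the dual of the bundle of 1-jets of `E(1)` (see `tractorTransition_pairing`). -/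
noncomputable def tractorTransition (i j : atlas (Coord n) M) (u : Coord n) :
    (Coord n × ℝ) →L[ℝ] (Coord n × ℝ) :=
  ((densityFactor i j u • fderiv ℝ (transition i j) u).comp
      (ContinuousLinearMap.fst ℝ (Coord n) ℝ)).prod
    ((fderiv ℝ (densityFactor i j) u).comp (ContinuousLinearMap.fst ℝ (Coord n) ℝ) +
      densityFactor i j u • ContinuousLinearMap.snd ℝ (Coord n) ℝ)

theorem tractorTransition_apply (i j : atlas (Coord n) M) (u : Coord n) (v : Coord n × ℝ) :
    tractorTransition i j u v =
      (densityFactor i j u • fderiv ℝ (transition i j) u v.1,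
        fderiv ℝ (densityFactor i j) u v.1 + densityFactor i j u * v.2) := by
  simp [tractorTransition]

/-- The domain, in the chart `i`, of the change of coordinates from `i` to `j`. -/
def overlap (i j : atlas (Coord n) M) : Set (Coord n) := (i.1.symm.trans j.1).source

theorem mem_overlap {i j : atlas (Coord n) M} {x : M} (hi : x ∈ i.1.source)
    (hj : x ∈ j.1.source) : i.1 x ∈ overlap i j := by
  simp [overlap, hi, hj]

theorem isOpen_overlap (i j : atlas (Coord n) M) : IsOpen (overlap i j) :=
  (i.1.symm.trans j.1).open_source

theorem transition_apply {i j : atlas (Coord n) M} {x : M} (hi : x ∈ i.1.source) :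
    transition i j (i.1 x) = j.1 x := by
  simp [transition, hi]

theorem contDiff_det : ContDiff ℝ ∞ (fun A : Coord n →L[ℝ] Coord n => A.det) := by
  have h : (fun A : Coord n →L[ℝ] Coord n => A.det) = fun A => Matrix.det
      (Matrix.of fun a b => (A (EuclideanSpace.single b 1)) a) := by
    funext A
    rw [ContinuousLinearMap.det, ← LinearMap.det_toMatrix
      (EuclideanSpace.basisFun (Fin n) ℝ).toBasis]
    congr 1
  rw [h]
  simp only [Matrix.det_apply, Matrix.of_apply]
  refine ContDiff.sum fun σ _ => ContDiff.const_smul _ (contDiff_prod fun a _ => ?_)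
  have : ContDiff ℝ ∞ (fun A : Coord n →L[ℝ] Coord n => A (EuclideanSpace.single a 1)) := by
    fun_prop
  exact (contDiff_euclidean.1 this) _

theorem transition_comp {i j : atlas (Coord n) M} (k : atlas (Coord n) M) {u : Coord n}
    (hu : u ∈ overlap i j) : transition j k (transition i j u) = transition i k u := by
  have h : i.1.symm u ∈ j.1.source := by simpa [overlap] using hu.2
  simp [transition, h]

theorem fderiv_transition_self {i : atlas (Coord n) M} {u : Coord n} (hu : u ∈ i.1.target) :
    fderiv ℝ (transition i i) u = ContinuousLinearMap.id ℝ (Coord n) := by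
  have h : transition i i =ᶠ[𝓝 u] id := by
    filter_upwards [i.1.open_target.mem_nhds hu] with v hv
    simp [transition, hv]
  rw [h.fderiv_eq, fderiv_id]

theorem transition_mem {i j k : atlas (Coord n) M} {u : Coord n} (hij : u ∈ overlap i j)
    (hik : u ∈ overlap i k) : transition i j u ∈ overlap j k := by
  have hj : i.1.symm u ∈ j.1.source := by simpa [overlap] using hij.2
  have hk : i.1.symm u ∈ k.1.source := by simpa [overlap] using hik.2
  exact mem_overlap hj hk

theorem mem_overlap_self {i j : atlas (Coord n) M} {u : Coord n} (hij : u ∈ overlap i j) :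
    u ∈ overlap i i := by
  have h1 : u ∈ i.1.target := by simpa [overlap] using hij.1
  have := mem_overlap (i.1.map_target h1) (i.1.map_target h1)
  rwa [i.1.right_inv h1] at this

theorem densityFactor_self {i : atlas (Coord n) M} {u : Coord n} (hu : u ∈ i.1.target) :
    densityFactor i i u = 1 := by
  simp [densityFactor, fderiv_transition_self hu, ContinuousLinearMap.det]

theorem fderiv_densityFactor_self {i : atlas (Coord n) M} {u : Coord n} (hu : u ∈ i.1.target) :
    fderiv ℝ (densityFactor i i) u = 0 := by
  have h : densityFactor i i =ᶠ[𝓝 u] fun _ => 1 := by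
    filter_upwards [i.1.open_target.mem_nhds hu] with v hv
    exact densityFactor_self hv
  rw [h.fderiv_eq]
  simp

variable [IsManifold (𝓡 n) ∞ M]

theorem contDiffOn_transition (i j : atlas (Coord n) M) :
    ContDiffOn ℝ ∞ (transition i j) (overlap i j) :=
  contMDiffOn_iff_contDiffOn.1 (contMDiffOn_of_mem_contDiffGroupoid
    ((contDiffGroupoid ∞ (𝓡 n)).compatible i.2 j.2))

theorem contDiffAt_transition {i j : atlas (Coord n) M} {u : Coord n} (hu : u ∈ overlap i j) :
    ContDiffAt ℝ ∞ (transition i j) u :=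
  (contDiffOn_transition i j).contDiffAt ((isOpen_overlap i j).mem_nhds hu)

theorem differentiableAt_transition {i j : atlas (Coord n) M} {u : Coord n}
    (hu : u ∈ overlap i j) : DifferentiableAt ℝ (transition i j) u :=
  (contDiffAt_transition hu).differentiableAt (by simp)

theorem fderiv_transition_comp {i j k : atlas (Coord n) M} {u : Coord n}
    (hij : u ∈ overlap i j) (hjk : transition i j u ∈ overlap j k) :
    fderiv ℝ (transition i k) u =
      (fderiv ℝ (transition j k) (transition i j u)).comp (fderiv ℝ (transition i j) u) := by
  have h : transition i k =ᶠ[𝓝 u] transition j k ∘ transition i j := by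
    filter_upwards [(isOpen_overlap i j).mem_nhds hij] with v hv
    exact (transition_comp k hv).symm
  rw [h.fderiv_eq, fderiv_comp u (differentiableAt_transition hjk)
    (differentiableAt_transition hij)]

theorem det_transition_ne_zero {i j : atlas (Coord n) M} {u : Coord n}
    (hu : u ∈ overlap i j) : (fderiv ℝ (transition i j) u).det ≠ 0 := by
  have h1 : u ∈ i.1.target := by simpa [overlap] using hu.1
  have h := fderiv_transition_comp hu (transition_mem hu (mem_overlap_self hu))
  rw [fderiv_transition_self h1] at h
  have h2 := congrArg ContinuousLinearMap.det h
  have h3 : (ContinuousLinearMap.id ℝ (Coord n)).det = 1 := by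
    simp [ContinuousLinearMap.det]
  have h4 (A B : Coord n →L[ℝ] Coord n) : (A.comp B).det = A.det * B.det :=
    LinearMap.det_comp _ _
  rw [h3, h4] at h2
  exact right_ne_zero_of_mul (h2 ▸ one_ne_zero)

theorem contDiffOn_fderiv_transition (i j : atlas (Coord n) M) :
    ContDiffOn ℝ ∞ (fderiv ℝ (transition i j)) (overlap i j) :=
  (contDiffOn_transition i j).fderiv_of_isOpen (isOpen_overlap i j) (by simp)

theorem contDiffOn_densityFactor (i j : atlas (Coord n) M) :
    ContDiffOn ℝ ∞ (densityFactor i j) (overlap i j) := by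
  intro u hu
  have h0 := det_transition_ne_zero hu
  have h1 : ContDiffAt ℝ ∞ (fderiv ℝ (transition i j)) u :=
    (contDiffOn_fderiv_transition i j).contDiffAt ((isOpen_overlap i j).mem_nhds hu)
  have h2 : ContDiffAt ℝ ∞ (fun v => (fderiv ℝ (transition i j) v).det) u :=
    contDiff_det.contDiffAt.comp u h1
  exact ((h2.abs h0).rpow_const_of_ne (abs_ne_zero.2 h0)).contDiffWithinAt

theorem differentiableAt_densityFactor {i j : atlas (Coord n) M} {u : Coord n}
    (hu : u ∈ overlap i j) : DifferentiableAt ℝ (densityFactor i j) u :=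
  ((contDiffOn_densityFactor i j).contDiffAt ((isOpen_overlap i j).mem_nhds hu)).differentiableAt
    (by simp)

theorem densityFactor_comp {i j k : atlas (Coord n) M} {u : Coord n}
    (hij : u ∈ overlap i j) (hjk : transition i j u ∈ overlap j k) :
    densityFactor i k u = densityFactor j k (transition i j u) * densityFactor i j u := by
  have h4 (A B : Coord n →L[ℝ] Coord n) : (A.comp B).det = A.det * B.det :=
    LinearMap.det_comp _ _
  rw [densityFactor, densityFactor, densityFactor, fderiv_transition_comp hij hjk, h4, abs_mul,
    Real.mul_rpow (abs_nonneg _) (abs_nonneg _)]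

theorem fderiv_densityFactor_comp {i j k : atlas (Coord n) M} {u : Coord n}
    (hij : u ∈ overlap i j) (hik : u ∈ overlap i k) (v : Coord n) :
    fderiv ℝ (densityFactor i k) u v =
      densityFactor j k (transition i j u) * fderiv ℝ (densityFactor i j) u v +
      densityFactor i j u *
        fderiv ℝ (densityFactor j k) (transition i j u) (fderiv ℝ (transition i j) u v) := by
  have hjk := transition_mem hij hik
  have h : densityFactor i k =ᶠ[𝓝 u]
      fun w => densityFactor j k (transition i j w) * densityFactor i j w := by
    filter_upwards [(isOpen_overlap i j).mem_nhds hij, (isOpen_overlap i k).mem_nhds hik]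
      with w h1 h2
    exact densityFactor_comp h1 (transition_mem h1 h2)
  have hd := (differentiableAt_densityFactor hjk).hasFDerivAt.comp u
    (differentiableAt_transition hij).hasFDerivAt
  have := (hd.mul (differentiableAt_densityFactor hij).hasFDerivAt).fderiv
  rw [h.fderiv_eq]
  refine (DFunLike.congr_fun this v).trans ?_
  simp

theorem contDiffOn_tractorTransition (i j : atlas (Coord n) M) :
    ContDiffOn ℝ ∞ (tractorTransition i j) (overlap i j) := by
  have h1 := contDiffOn_densityFactor i j
  have h2 := contDiffOn_fderiv_transition i j
  have h3 : ContDiffOn ℝ ∞ (fderiv ℝ (densityFactor i j)) (overlap i j) :=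
    h1.fderiv_of_isOpen (isOpen_overlap i j) (by simp)
  have h : ∀ u, tractorTransition i j u =
      (ContinuousLinearMap.inl ℝ (Coord n) ℝ).comp
        ((densityFactor i j u • fderiv ℝ (transition i j) u).comp
          (ContinuousLinearMap.fst ℝ (Coord n) ℝ)) +
      (ContinuousLinearMap.inr ℝ (Coord n) ℝ).comp
        ((fderiv ℝ (densityFactor i j) u).comp (ContinuousLinearMap.fst ℝ (Coord n) ℝ) +
          densityFactor i j u • ContinuousLinearMap.snd ℝ (Coord n) ℝ) := by
    intro u
    refine ContinuousLinearMap.ext fun v => ?_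
    simp [tractorTransition]
  refine ContDiffOn.congr ?_ (fun u _ => h u)
  refine ContDiffOn.add (ContDiffOn.clm_comp contDiffOn_const
    (ContDiffOn.clm_comp (h1.smul h2) contDiffOn_const))
    (ContDiffOn.clm_comp contDiffOn_const (ContDiffOn.add (ContDiffOn.clm_comp h3 contDiffOn_const)
      (h1.smul contDiffOn_const)))

theorem contMDiffOn_tractorTransition (i j : atlas (Coord n) M) :
    ContMDiffOn (𝓡 n) 𝓘(ℝ, (Coord n × ℝ) →L[ℝ] (Coord n × ℝ)) ∞
      (fun x => tractorTransition i j (i.1 x)) (i.1.source ∩ j.1.source) := by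
  refine ContMDiffOn.comp (t := overlap i j) (I' := 𝓡 n)
    (contMDiffOn_iff_contDiffOn.2 (contDiffOn_tractorTransition i j)) ?_ ?_
  · exact (contMDiffOn_of_mem_maximalAtlas
      (IsManifold.subset_maximalAtlas i.2)).mono Set.inter_subset_left
  · exact fun x hx => mem_overlap hx.1 hx.2

variable (n M) in
/-- The standard tractor bundle, of rank `n + 1`, by its cocycle. -/
noncomputable def tractorCore :
    VectorBundleCore ℝ M (Coord n × ℝ) (atlas (Coord n) M) where
  baseSet i := i.1.source
  isOpen_baseSet i := i.1.open_source
  indexAt := achart (Coord n)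
  mem_baseSet_at := mem_chart_source (Coord n)
  coordChange i j x := tractorTransition i j (i.1 x)
  coordChange_self i x hx v := by
    have h : i.1 x ∈ i.1.target := i.1.map_source hx
    simp [tractorTransition_apply, densityFactor_self h, fderiv_densityFactor_self h,
      fderiv_transition_self h]
  continuousOn_coordChange i j := (contMDiffOn_tractorTransition i j).continuousOn
  coordChange_comp i j k x hx v := by
    have hij := mem_overlap hx.1.1 hx.1.2
    have hik := mem_overlap hx.1.1 hx.2
    have hjk := transition_mem hij hik
    rw [← transition_apply (j := j) hx.1.1, tractorTransition_apply, tractorTransition_apply,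
      tractorTransition_apply, fderiv_transition_comp hij hjk, fderiv_densityFactor_comp hij hik,
      densityFactor_comp hij hjk]
    ext <;> simp <;> ring

instance : (tractorCore n M).IsContMDiff (𝓡 n) ∞ :=
  ⟨fun i j => contMDiffOn_tractorTransition i j⟩

/-- The tractor bundle is dual to the bundle of 1-jets of sections of `E(1)`: if `f` is the local
expression of a section in the chart `i` and `f'` is its expression in the chart `j`, then the
pairing of a tractor with the 1-jet is the same number in both charts. -/
theorem tractorTransition_pairing {i j : atlas (Coord n) M} {u : Coord n}
    (hu : u ∈ overlap i j) {f : Coord n → ℝ} (hf : DifferentiableAt ℝ f u)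
    (v : Coord n × ℝ) :
    let f' : Coord n → ℝ := fun w => densityFactor j i w * f (transition j i w)
    let u' := transition i j u
    let v' := tractorTransition i j u v
    fderiv ℝ f' u' v'.1 + v'.2 * f' u' = fderiv ℝ f u v.1 + v.2 * f u := by
  intro f' u' v'
  have hii := mem_overlap_self hu
  have ht : u ∈ i.1.target := by simpa [overlap] using hu.1
  have hji : u' ∈ overlap j i := transition_mem hu hii
  have hback : transition j i u' = u := by
    rw [transition_comp i hu]; simp [transition, ht]
  have hd : HasFDerivAt f (fderiv ℝ f u) (transition j i u') := by
    rw [hback]; exact hf.hasFDerivAt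
  have hd' := ((differentiableAt_densityFactor hji).hasFDerivAt.mul
    (hd.comp u' (differentiableAt_transition hji).hasFDerivAt)).fderiv
  have e1 : fderiv ℝ f' u' v'.1 =
      densityFactor j i u' * fderiv ℝ f u (fderiv ℝ (transition j i) u' v'.1) +
        f u * fderiv ℝ (densityFactor j i) u' v'.1 := by
    refine (DFunLike.congr_fun hd' v'.1).trans ?_
    simp [hback]
  have e2 := densityFactor_comp hu hji
  have e3 := fderiv_densityFactor_comp hu hii v.1
  have e4 := DFunLike.congr_fun (fderiv_transition_comp hu hji) v.1
  rw [densityFactor_self ht] at e2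
  rw [fderiv_densityFactor_self ht] at e3
  rw [fderiv_transition_self ht] at e4
  have e5 : f' u' = densityFactor j i u' * f u := by simp only [f', hback]
  rw [e1, e5]
  simp only [v', tractorTransition_apply, map_smul, smul_eq_mul]
  simp only [ContinuousLinearMap.comp_apply, ContinuousLinearMap.id_apply,
    zero_apply] at e3 e4
  rw [← e4]
  change 1 = densityFactor j i u' * densityFactor i j u at e2
  change 0 = densityFactor j i u' * _ + densityFactor i j u *
    fderiv ℝ (densityFactor j i) u' _ at e3
  linear_combination (-(fderiv ℝ f u v.1) - v.2 * f u) * e2 - f u * e3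

end Transition

section Connection
open Bundle

theorem mvfderiv_congr {n : ℕ} {M : Type*} [TopologicalSpace M] [ChartedSpace (Coord n) M]
    {f g : M → Coord n × ℝ} {x : M} (h : f =ᶠ[𝓝 x] g) :
    mvfderiv (𝓡 n) f x = mvfderiv (𝓡 n) g x := by
  ext1 z
  exact DFunLike.congr_fun (h.mfderiv_eq (I := 𝓡 n) (I' := 𝓘(ℝ, Coord n × ℝ))) z

variable (n : ℕ) (M : Type*) [TopologicalSpace M] [ChartedSpace (Coord n) M]
  [IsManifold (𝓡 n) ∞ M]

/-- The fibres of the standard (projective) tractor bundle `𝒯 → M`. -/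
abbrev Tractor : M → Type := (tractorCore n M).Fiber

/-- Connections on the tangent bundle; `D U x z` is `∇_z U` at `x`. -/
abbrev AffineConnection : Type _ :=
  CovariantDerivative (𝓡 n) (Coord n) (TangentSpace (𝓡 n) : M → Type _)

variable {n M}

/-- The connection is smooth and torsion-free. -/
structure IsSmoothTorsionFree (D : AffineConnection n M) : Prop where
  smooth : D.ContMDiffCovariantDerivative ∞
  torsion_eq_zero : D.torsion = 0

/-- `∇'_z U = ∇_z U + Υ(z) U + Υ(U) z` for some smooth 1-form `Υ`. -/
def ProjectivelyEquivalent (D D' : AffineConnection n M) : Prop :=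
  ∃ Υ : Π x : M, TangentSpace (𝓡 n) x →L[ℝ] Trivial M ℝ x,
    ContMDiff (𝓡 n) ((𝓡 n).prod 𝓘(ℝ, Coord n →L[ℝ] ℝ)) ∞
      (fun x => TotalSpace.mk' (Coord n →L[ℝ] ℝ) x (Υ x)) ∧
    ∀ (U : Π x : M, TangentSpace (𝓡 n) x) (x : M),
      MDifferentiableAt (𝓡 n) ((𝓡 n).prod 𝓘(ℝ, Coord n))
        (fun y => TotalSpace.mk' (Coord n) y (U y)) x →
      ∀ z : TangentSpace (𝓡 n) x,
        D' U x z = D U x z + (Υ x z : ℝ) • U x + (Υ x (U x) : ℝ) • z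

variable (n M) in
/-- A projective structure: an equivalence class of projectively equivalent smooth torsion-free
affine connections. -/
structure ProjectiveStructure where
  carrier : Set (AffineConnection n M)
  exists_eq_class : ∃ D : AffineConnection n M, IsSmoothTorsionFree D ∧
    carrier = {D' | IsSmoothTorsionFree D' ∧ ProjectivelyEquivalent D D'}

/-- Some connection in the projective class. -/
noncomputable def ProjectiveStructure.rep (p : ProjectiveStructure n M) : AffineConnection n M :=
  p.exists_eq_class.choose

theorem ProjectivelyEquivalent.refl (D : AffineConnection n M) : ProjectivelyEquivalent D D := by
  refine ⟨fun x => 0, ?_, fun U x _ z => ?_⟩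
  · exact contMDiff_zeroSection ℝ (fun x : M => TangentSpace (𝓡 n) x →L[ℝ] Trivial M ℝ x)
  · change D U x z = D U x z + (0 : ℝ) • U x + (0 : ℝ) • z
    simp

theorem ProjectiveStructure.rep_mem (p : ProjectiveStructure n M) : p.rep ∈ p.carrier := by
  have h := p.exists_eq_class.choose_spec
  rw [h.2]
  exact ⟨h.1, .refl _⟩

/-- The vector field with constant components `w` in the chart at `x₀`. -/
noncomputable def coordField (x₀ : M) (w : Coord n) (y : M) : TangentSpace (𝓡 n) y :=
  (trivializationAt (Coord n) (TangentSpace (𝓡 n)) x₀).symm y w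

/-- Christoffel symbols `Γ^c_{ab}` in the chart at `x₀`, as functions of the coordinates `u`:
`∇_{∂_a} ∂_b = Γ^c_{ab} ∂_c`. -/
noncomputable def christoffel (D : AffineConnection n M) (x₀ : M) (u : Coord n)
    (c a b : Fin n) : ℝ :=
  let y := (chartAt (Coord n) x₀).symm u
  (trivializationAt (Coord n) (TangentSpace (𝓡 n)) x₀
    ⟨y, D (coordField x₀ (EuclideanSpace.single b 1)) y
      (coordField x₀ (EuclideanSpace.single a 1) y)⟩).2 c

/-- `Π^c_{ab} = Γ^c_{ab} - (δ^c_a Γ^d_{db} + δ^c_b Γ^d_{da}) / (n + 1)`. These are the Christoffel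
symbols of the unique connection, on the domain of the chart, that belongs to the projective class
and preserves the coordinate volume. They depend only on the projective class, see `thomas_eq`. -/
noncomputable def thomas (D : AffineConnection n M) (x₀ : M) (u : Coord n)
    (c a b : Fin n) : ℝ :=
  christoffel D x₀ u c a b -
    ((if c = a then ∑ d, christoffel D x₀ u d d b else 0) +
      (if c = b then ∑ d, christoffel D x₀ u d d a else 0)) / ((n : ℝ) + 1)

theorem christoffel_add {D D' : AffineConnection n M} {x₀ : M} {u : Coord n}
    (hu : u ∈ (chartAt (Coord n) x₀).target) (h : ProjectivelyEquivalent D D') :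
    ∃ Y : Fin n → ℝ, ∀ c a b, christoffel D' x₀ u c a b = christoffel D x₀ u c a b +
      ((if c = b then Y a else 0) + (if c = a then Y b else 0)) := by
  obtain ⟨Υ, -, hΥ⟩ := h
  set y := (chartAt (Coord n) x₀).symm u with hy
  let t := trivializationAt (Coord n) (TangentSpace (𝓡 n) : M → Type _) x₀
  have hys : y ∈ t.baseSet := (chartAt (Coord n) x₀).map_target hu
  have hdiff : ∀ w : Coord n, MDifferentiableAt (𝓡 n) ((𝓡 n).prod 𝓘(ℝ, Coord n))
      (fun y => TotalSpace.mk' (Coord n) y (coordField x₀ w y)) y := by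
    intro w
    refine (t.mdifferentiableAt_section_iff (𝓡 n) _ hys).2 ?_
    refine (mdifferentiableAt_const (c := w)).congr_of_eventuallyEq ?_
    filter_upwards [t.open_baseSet.mem_nhds hys] with y' hy'
    simp [coordField, t, t.apply_mk_symm hy']
  have hval : ∀ w : Coord n, (t ⟨y, coordField x₀ w y⟩).2 = w := by
    intro w
    simp [coordField, t, t.apply_mk_symm hys]
  refine ⟨fun a => Υ y (coordField x₀ (EuclideanSpace.single a 1) y), fun c a b => ?_⟩
  have hlin : ∀ v : TangentSpace (𝓡 n) y, (t ⟨y, v⟩).2 = t.linearMapAt ℝ y v := by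
    intro v
    rw [t.coe_linearMapAt_of_mem hys]
  simp only [christoffel]
  rw [hΥ _ y (hdiff _)]
  change (t ⟨y, _⟩).2 c = (t ⟨y, _⟩).2 c + _
  have h1 := hval (EuclideanSpace.single b 1)
  have h2 := hval (EuclideanSpace.single a 1)
  rw [hlin] at h1 h2
  rw [hlin, hlin, map_add, map_add, map_smul, map_smul, h1, h2]
  simp only [PiLp.add_apply, PiLp.smul_apply, PiLp.single_apply, smul_eq_mul, mul_ite,
    mul_one, mul_zero, add_assoc]
  rfl

theorem thomas_eq {p : ProjectiveStructure n M} {D D' : AffineConnection n M}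
    (hD : D ∈ p.carrier) (hD' : D' ∈ p.carrier) {x₀ : M} {u : Coord n}
    (hu : u ∈ (chartAt (Coord n) x₀).target) : thomas D x₀ u = thomas D' x₀ u := by
  have key : ∀ {A B : AffineConnection n M}, ProjectivelyEquivalent A B →
      thomas B x₀ u = thomas A x₀ u := by
    intro A B h
    obtain ⟨Y, hY⟩ := christoffel_add hu h
    have hn : (n : ℝ) + 1 ≠ 0 := by positivity
    have tr : ∀ b, ∑ d, christoffel B x₀ u d d b =
        ∑ d, christoffel A x₀ u d d b + ((n : ℝ) + 1) * Y b := by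
      intro b
      simp only [hY, Finset.sum_add_distrib]
      simp
      ring
    funext c a b
    simp only [thomas, tr]
    simp only [hY]
    split_ifs <;> field_simp <;> ring
  obtain ⟨C, -, hC⟩ := p.exists_eq_class
  rw [hC] at hD hD'
  rw [key hD.2, key hD'.2]

/-- Ricci tensor `R_{bd} = R_{ab}{}^a{}_d` of the connection with Christoffel symbols `Γ`, where
`R_{ab}{}^c{}_d U^d = (∇_a ∇_b - ∇_b ∇_a) U^c`. -/
noncomputable def ricci (Γ : Coord n → Fin n → Fin n → Fin n → ℝ) (u : Coord n)
    (b d : Fin n) : ℝ :=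
  ∑ a, (fderiv ℝ (fun w => Γ w a b d) u (EuclideanSpace.single a 1) -
      fderiv ℝ (fun w => Γ w a a d) u (EuclideanSpace.single b 1)) +
    ∑ a, ∑ e, (Γ u a a e * Γ u e b d - Γ u a b e * Γ u e a d)

/-- The projective Schouten tensor `P_{ab} = R_{ab} / (n - 1)` of a connection that preserves a
volume density. -/
noncomputable def schouten (Γ : Coord n → Fin n → Fin n → Fin n → ℝ) (u : Coord n)
    (a b : Fin n) : ℝ :=
  ricci Γ u a b / ((n : ℝ) - 1)

/-- The zeroth-order part of the tractor connection in a chart: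
`(ν, ρ) ↦ (Γ^c_{ab} z^a ν^b + ρ z^c, -P_{ab} z^a ν^b)` in the direction `z`. -/
noncomputable def connectionForm (Γ : Coord n → Fin n → Fin n → Fin n → ℝ) (u : Coord n) :
    (Coord n × ℝ) →L[ℝ] Coord n →L[ℝ] (Coord n × ℝ) :=
  LinearMap.toContinuousBilinearMap <| LinearMap.mk₂ ℝ
    (fun (v : Coord n × ℝ) (z : Coord n) =>
      ((WithLp.toLp 2 fun c => ∑ a, ∑ b, Γ u c a b * z a * v.1 b) + v.2 • z,
        -∑ a, ∑ b, schouten Γ u a b * z a * v.1 b))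
    (by
      intro v v' z
      ext <;> simp [mul_add, add_mul, Finset.sum_add_distrib] <;> ring)
    (by
      intro t v z
      ext <;> simp [Finset.mul_sum, mul_left_comm, mul_assoc])
    (by
      intro v z z'
      ext <;> simp [mul_add, add_mul, Finset.sum_add_distrib] <;> ring)
    (by
      intro t v z
      ext <;> simp [Finset.mul_sum, mul_left_comm, mul_assoc])

instance (x : M) : IsTopologicalAddGroup (Tractor n M x) :=
  inferInstanceAs (IsTopologicalAddGroup (Coord n × ℝ))

instance (x : M) : ContinuousSMul ℝ (Tractor n M x) :=
  inferInstanceAs (ContinuousSMul ℝ (Coord n × ℝ))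

/-- The value at `x` of the tractor connection, computed in the chart at `x`, in the scale of the
coordinate volume: `∇_a (ν^b, ρ) = (∇_a ν^b + ρ δ_a^b, ∇_a ρ - P_{ab} ν^b)`, where the connection
and its Schouten tensor are those with Christoffel symbols `Π`. -/
noncomputable def localConnection (p : ProjectiveStructure n M) (V : Π x : M, Tractor n M x)
    (x : M) : TangentSpace (𝓡 n) x →L[ℝ] Tractor n M x :=
  let θ : TangentSpace (𝓡 n) x →L[ℝ] Coord n × ℝ :=
    connectionForm (thomas p.rep x) (chartAt (Coord n) x x) (V x)
  mvfderiv (𝓡 n) (fun y => (trivializationAt (Coord n × ℝ) (Tractor n M) x ⟨y, V y⟩).2) x + θ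

theorem eventually_mem_baseSet (x : M) :
    ∀ᶠ y in 𝓝 x, y ∈ (trivializationAt (Coord n × ℝ) (Tractor n M) x).baseSet :=
  (trivializationAt (Coord n × ℝ) (Tractor n M) x).open_baseSet.mem_nhds
    (FiberBundle.mem_baseSet_trivializationAt' x)

theorem trivializationAt_self (x : M) (v : Tractor n M x) :
    (trivializationAt (Coord n × ℝ) (Tractor n M) x ⟨x, v⟩).2 = v :=
  (tractorCore n M).coordChange_self _ x ((tractorCore n M).mem_baseSet_at x) v

theorem localConnection_add (p : ProjectiveStructure n M) {σ σ' : Π x : M, Tractor n M x} {x : M}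
    (hσ : MDifferentiableAt (𝓡 n) ((𝓡 n).prod 𝓘(ℝ, Coord n × ℝ))
      (fun y => TotalSpace.mk' (Coord n × ℝ) y (σ y)) x)
    (hσ' : MDifferentiableAt (𝓡 n) ((𝓡 n).prod 𝓘(ℝ, Coord n × ℝ))
      (fun y => TotalSpace.mk' (Coord n × ℝ) y (σ' y)) x) :
    localConnection p (σ + σ') x = localConnection p σ x + localConnection p σ' x := by
  rw [mdifferentiableAt_section] at hσ hσ'
  have h : (fun y => (trivializationAt (Coord n × ℝ) (Tractor n M) x ⟨y, (σ + σ') y⟩).2)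
      =ᶠ[𝓝 x] (fun y => (trivializationAt (Coord n × ℝ) (Tractor n M) x ⟨y, σ y⟩).2) +
        (fun y => (trivializationAt (Coord n × ℝ) (Tractor n M) x ⟨y, σ' y⟩).2) := by
    filter_upwards [eventually_mem_baseSet (n := n) x] with y hy
    exact ((trivializationAt (Coord n × ℝ) (Tractor n M) x).linear ℝ hy).1 _ _
  have h' := (mvfderiv_congr h).trans (mvfderiv_add hσ hσ')
  ext1 z
  have e : connectionForm (thomas p.rep x) (chartAt (Coord n) x x) ((σ + σ') x) z =
      connectionForm (thomas p.rep x) (chartAt (Coord n) x x) (σ x) z +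
      connectionForm (thomas p.rep x) (chartAt (Coord n) x x) (σ' x) z := by
    have h0 (A : (Coord n × ℝ) →L[ℝ] Coord n →L[ℝ] (Coord n × ℝ)) (v v' : Coord n × ℝ)
        (w : Coord n) : A (v + v') w = A v w + A v' w := by simp
    exact h0 _ _ _ _
  have e' := DFunLike.congr_fun h' z
  refine (congrArg₂ (· + ·) e' e).trans ?_
  exact add_add_add_comm _ _ _ _

theorem localConnection_smul (p : ProjectiveStructure n M) {σ : Π x : M, Tractor n M x} {x : M}
    {g : M → ℝ} (hσ : MDifferentiableAt (𝓡 n) ((𝓡 n).prod 𝓘(ℝ, Coord n × ℝ))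
      (fun y => TotalSpace.mk' (Coord n × ℝ) y (σ y)) x)
    (hg : MDifferentiableAt (𝓡 n) 𝓘(ℝ, ℝ) g x) :
    localConnection p (g • σ) x = g x • localConnection p σ x +
      (mvfderiv (𝓡 n) g x).smulRight (σ x) := by
  rw [mdifferentiableAt_section] at hσ
  have h : (fun y => (trivializationAt (Coord n × ℝ) (Tractor n M) x ⟨y, (g • σ) y⟩).2)
      =ᶠ[𝓝 x] g • (fun y => (trivializationAt (Coord n × ℝ) (Tractor n M) x ⟨y, σ y⟩).2) := by
    filter_upwards [eventually_mem_baseSet (n := n) x] with y hy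
    exact ((trivializationAt (Coord n × ℝ) (Tractor n M) x).linear ℝ hy).2 _ _
  have h' := (mvfderiv_congr h).trans (mvfderiv_smul hg hσ)
  rw [trivializationAt_self] at h'
  ext1 z
  have e : connectionForm (thomas p.rep x) (chartAt (Coord n) x x) ((g • σ) x) z =
      g x • connectionForm (thomas p.rep x) (chartAt (Coord n) x x) (σ x) z := by
    have h0 (A : (Coord n × ℝ) →L[ℝ] Coord n →L[ℝ] (Coord n × ℝ)) (t : ℝ) (v : Coord n × ℝ)
        (w : Coord n) : A (t • v) w = t • A v w := by simp
    exact h0 _ _ _ _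
  have e' := DFunLike.congr_fun h' z
  refine (congrArg₂ (· + ·) e' e).trans ?_
  have h0 (a b c : Coord n × ℝ) (t : ℝ) : (t • a + b) + t • c = t • (a + c) + b := by
    rw [smul_add]; abel
  exact h0 _ _ _ _

/-- The normal tractor connection of a projective structure:
`∇_a (ν^b, ρ) = (∇_a ν^b + ρ δ_a^b, ∇_a ρ - P_{ab} ν^b)` in the splitting given by any volume
preserving connection of the class, here the one that preserves the volume of the chart. -/
noncomputable def tractorConnection (p : ProjectiveStructure n M) :
    CovariantDerivative (𝓡 n) (Coord n × ℝ) (Tractor n M) where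
  toFun V x := localConnection p V x
  isCovariantDerivativeOnUniv :=
    ⟨fun hσ hσ' _ => localConnection_add p hσ hσ', fun hσ hg _ => localConnection_smul p hσ hg⟩

end Connection

section Algebra

variable {V : Type*} [AddCommGroup V] [Module ℝ V] [TopologicalSpace V]

/-- Stable (generic) 3-forms: the orbit under the general linear group is open. -/
def IsStable (Φ : V [⋀^Fin 3]→L[ℝ] ℝ) : Prop :=
  IsOpen (Set.range fun g : V ≃L[ℝ] V => Φ.compContinuousLinearMap (g : V →L[ℝ] V))

/-- The 7-form `(1/6) (x ⌟ Φ) ∧ (y ⌟ Φ) ∧ Φ`, evaluated on seven vectors `v`. -/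
noncomputable def hTilde (Φ : V [⋀^Fin 3]→L[ℝ] ℝ) (x y : V) (v : Fin 7 → V) : ℝ :=
  (1 / 6) * ((1 / (2 * 2 * 6)) * ∑ σ : Equiv.Perm (Fin 7), ((Equiv.Perm.sign σ : ℤ) : ℝ) *
    (Φ ![x, v (σ 0), v (σ 1)] * Φ ![y, v (σ 2), v (σ 3)] * Φ ![v (σ 4), v (σ 5), v (σ 6)]))

/-- `B` is the symmetric form `H` determined by a 3-form `Φ` on a 7-dimensional space: `Φ`
determines the volume form `ε` with `ε^9 = det H̃`, where `H̃(x, y) = (1/6) (x ⌟ Φ) ∧ (y ⌟ Φ) ∧ Φ`,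
and then `H̃ = H ⊗ ε`. -/
def IsInducedMetric (Φ : V [⋀^Fin 3]→L[ℝ] ℝ) (B : LinearMap.BilinForm ℝ V) : Prop :=
  ∃ ε : V [⋀^Fin 7]→ₗ[ℝ] ℝ, ε ≠ 0 ∧
    (∀ b : Module.Basis (Fin 7) ℝ V,
      ε b ^ 9 = Matrix.det (Matrix.of fun i j => hTilde Φ (b i) (b j) b)) ∧
    ∀ x y v, hTilde Φ x y v = B x y * ε v

/-- Stable 3-forms with positive definite induced metric. -/
def IsDefiniteStable (Φ : V [⋀^Fin 3]→L[ℝ] ℝ) : Prop :=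
  IsStable Φ ∧ ∃ B : LinearMap.BilinForm ℝ V, IsInducedMetric Φ B ∧
    sigPos B.toQuadraticMap = 7 ∧ sigNeg B.toQuadraticMap = 0

/-- Stable 3-forms whose induced metric has signature `(3, 4)`. -/
def IsSplitStable (Φ : V [⋀^Fin 3]→L[ℝ] ℝ) : Prop :=
  IsStable Φ ∧ ∃ B : LinearMap.BilinForm ℝ V, IsInducedMetric Φ B ∧
    sigPos B.toQuadraticMap = 3 ∧ sigNeg B.toQuadraticMap = 4

end Algebra

section CrossProduct

variable {V : Type*} [AddCommGroup V] [Module ℝ V]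

/-- Cross products on `V`: skew bilinear products for which there is a nondegenerate symmetric
form with `(u × v) · u = 0` and `(u × v) · (u × v) = (u · u) (v · v) - (u · v)²`. -/
def IsCrossProduct (c : V →ₗ[ℝ] V →ₗ[ℝ] V) : Prop :=
  ∃ B : LinearMap.BilinForm ℝ V, B.IsSymm ∧ B.Nondegenerate ∧
    (∀ u v, c u v = -c v u) ∧ (∀ u v, B (c u v) u = 0) ∧
    ∀ u v, B (c u v) (c u v) = B u u * B v v - B u v ^ 2

/-- The inner product of a cross product in dimension 7: `x · y = -(1/6) tr (x × (y × ·))`. -/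
noncomputable def dotOfCross (c : V →ₗ[ℝ] V →ₗ[ℝ] V) (x y : V) : ℝ :=
  -(1 / 6) * LinearMap.trace ℝ V (c x ∘ₗ c y)

open scoped Quaternion in
/-- The Cayley-Dickson product `(a, b)(c, d) = (a c + s d b̄, ā d + c b)` on pairs of quaternions:
the octonions for `s = -1`, the split octonions for `s = 1`. -/
noncomputable def cdMul (s : ℝ) (x y : ℍ[ℝ] × ℍ[ℝ]) : ℍ[ℝ] × ℍ[ℝ] :=
  (x.1 * y.1 + s • (y.2 * star x.2), star x.1 * y.2 + y.1 * x.2)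

open scoped Quaternion in
/-- The imaginary (split) octonions. -/
def imOct : Submodule ℝ (ℍ[ℝ] × ℍ[ℝ]) where
  carrier := {x | x.1.re = 0}
  add_mem' := by
    intro a b ha hb
    simp_all
  zero_mem' := by simp
  smul_mem' := by
    intro t a ha
    simp_all

/-- `c` is isomorphic to the product `x × y = (1/2) (x y - y x)` on the imaginary part of the
Cayley-Dickson algebra with parameter `s`. -/
def IsOctonionic (s : ℝ) (c : V →ₗ[ℝ] V →ₗ[ℝ] V) : Prop :=
  ∃ φ : V ≃ₗ[ℝ] imOct, ∀ u v,
    (φ (c u v)).1 = (1 / 2 : ℝ) • (cdMul s (φ u).1 (φ v).1 - cdMul s (φ v).1 (φ u).1)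

/-- Definite cross products: isomorphic to that of the imaginary octonions. -/
def IsDefiniteCross (c : V →ₗ[ℝ] V →ₗ[ℝ] V) : Prop := IsOctonionic (-1) c

/-- Split cross products: isomorphic to that of the imaginary split octonions. -/
def IsSplitCross (c : V →ₗ[ℝ] V →ₗ[ℝ] V) : Prop := IsOctonionic 1 c

variable [TopologicalSpace V]

/-- `c` is obtained from `Φ` by raising an index with the induced metric `H`:
`H(w, u × v) = Φ(w, u, v)`. -/
def IsRaising (Φ : V [⋀^Fin 3]→L[ℝ] ℝ) (c : V →ₗ[ℝ] V →ₗ[ℝ] V) : Prop :=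
  ∃ B : LinearMap.BilinForm ℝ V, IsInducedMetric Φ B ∧ B.Nondegenerate ∧
    ∀ w u v, B w (c u v) = Φ ![w, u, v]

/-- `Φ` is obtained from `c` by lowering an index: `Φ(w, u, v) = w · (u × v)`. -/
def IsLowering (c : V →ₗ[ℝ] V →ₗ[ℝ] V) (Φ : V [⋀^Fin 3]→L[ℝ] ℝ) : Prop :=
  ∀ w u v, Φ ![w, u, v] = dotOfCross c w (c u v)

end CrossProduct

section Fields
open Bundle

variable {n : ℕ} {M : Type*} [TopologicalSpace M] [ChartedSpace (Coord n) M]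
  [IsManifold (𝓡 n) ∞ M]

/-- The section `U` of the tractor bundle is smooth at `x`. -/
def SmoothSectionAt (U : Π x : M, Tractor n M x) (x : M) : Prop :=
  ContMDiffAt (𝓡 n) ((𝓡 n).prod 𝓘(ℝ, Coord n × ℝ)) ∞
    (fun y => TotalSpace.mk' (Coord n × ℝ) y (U y)) x

/-- The section `U` of the tractor bundle is differentiable at `x`. -/
def DiffSectionAt (U : Π x : M, Tractor n M x) (x : M) : Prop :=
  MDifferentiableAt (𝓡 n) ((𝓡 n).prod 𝓘(ℝ, Coord n × ℝ))
    (fun y => TotalSpace.mk' (Coord n × ℝ) y (U y)) x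

/-- Smooth fields of tractor 3-forms. -/
def IsSmoothForm (Φ : Π x : M, Tractor n M x [⋀^Fin 3]→L[ℝ] ℝ) : Prop :=
  ∀ (U V W : Π x : M, Tractor n M x) (x : M),
    SmoothSectionAt U x → SmoothSectionAt V x → SmoothSectionAt W x →
    ContMDiffAt (𝓡 n) 𝓘(ℝ, ℝ) ∞ (fun y => Φ y ![U y, V y, W y]) x

/-- `∇Φ = 0` for the tractor connection: `d(Φ(U, V, W))(z) = Φ(∇_z U, V, W) + Φ(U, ∇_z V, W) +
Φ(U, V, ∇_z W)`. -/
def IsParallelForm (p : ProjectiveStructure n M)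
    (Φ : Π x : M, Tractor n M x [⋀^Fin 3]→L[ℝ] ℝ) : Prop :=
  ∀ (U V W : Π x : M, Tractor n M x) (x : M),
    DiffSectionAt U x → DiffSectionAt V x → DiffSectionAt W x →
    ∀ z : TangentSpace (𝓡 n) x,
      mvfderiv (𝓡 n) (fun y => Φ y ![U y, V y, W y]) x z =
        Φ x ![tractorConnection p U x z, V x, W x] +
        Φ x ![U x, tractorConnection p V x z, W x] +
        Φ x ![U x, V x, tractorConnection p W x z]

/-- Smooth fields of bilinear products on the tractor bundle. -/
def IsSmoothProduct (c : Π x : M, Tractor n M x →ₗ[ℝ] Tractor n M x →ₗ[ℝ] Tractor n M x) :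
    Prop :=
  ∀ (U V : Π x : M, Tractor n M x) (x : M), SmoothSectionAt U x → SmoothSectionAt V x →
    SmoothSectionAt (fun y => c y (U y) (V y)) x

/-- The product is parallel: `∇_z (U × V) = ∇_z U × V + U × ∇_z V`. -/
def IsParallelProduct (p : ProjectiveStructure n M)
    (c : Π x : M, Tractor n M x →ₗ[ℝ] Tractor n M x →ₗ[ℝ] Tractor n M x) : Prop :=
  ∀ (U V : Π x : M, Tractor n M x) (x : M), DiffSectionAt U x → DiffSectionAt V x →
    ∀ z : TangentSpace (𝓡 n) x,
      tractorConnection p (fun y => c y (U y) (V y)) x z =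
        c x (tractorConnection p U x z) (V x) + c x (U x) (tractorConnection p V x z)

/-- Parallel generic tractor 3-forms. -/
structure IsParallelGenericForm (p : ProjectiveStructure n M)
    (Φ : Π x : M, Tractor n M x [⋀^Fin 3]→L[ℝ] ℝ) : Prop where
  smooth : IsSmoothForm Φ
  parallel : IsParallelForm p Φ
  stable : ∀ x, IsStable (Φ x)

/-- Parallel cross products on the tractor bundle. -/
structure IsParallelCrossProduct (p : ProjectiveStructure n M)
    (c : Π x : M, Tractor n M x →ₗ[ℝ] Tractor n M x →ₗ[ℝ] Tractor n M x) : Prop where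
  smooth : IsSmoothProduct c
  parallel : IsParallelProduct p c
  crossProduct : ∀ x, IsCrossProduct (c x)

end Fields

end ProjTractor

/-! The algebra takes place in one 7-dimensional space V, and both constructions are natural enough
to pass through the connection.

Pointwise, the link is a compatible triple `IsG2Triple`: a 3-form Φ, its induced metric B, and a
cross product c for B with Φ(w, u, v) = B(w, c(u, v)). From a cross product,
`IsCrossFor.exists_octBasis` rebuilds the imaginary octonions or split octonions inside V by
Cayley-Dickson doubling. In the resulting basis everything is a finite table, and table computations
show that B is the trace form of c, that B is the metric induced by Φ, and that gl(V) acts onto the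
tangent space Λ³V* of the orbit, so that Φ is stable.

From a stable form, no list of GL(V)-orbits is needed. The determinant of H̃ is a relative
invariant: if it vanished at Φ it would vanish on an open orbit, hence identically by analyticity,
while it equals 1 at the octonionic form. So ε and H exist and H is nondegenerate. The symmetry of
H̃, and the norm identity of the raised product after the ninth roots are cleared, are polynomial
identities in Φ. They hold on the open orbit of the octonionic form, hence everywhere
(`eq_of_forall_isG2Triple`). Uniqueness and mutual inverseness follow because B is determined by Φ
alone and also by c alone; the types match because only two models exist and their metrics have
different signatures.

For parallelism, write the connection as d + θ at the centre of a trivialization. A tensor is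
parallel when the derivative of its local expression there is the infinitesimal action of θ. The map
from Φ to the product is smooth and GL(V)-equivariant, so its derivative intertwines these actions
(`IsG2Triple.fderiv_raiseAt`). Conversely Φ(u, v, w) = -(1/6) tr(c(u) ∘ c(v × w)), and the trace
kills commutators with θ (`traceDot_commutator`). No other property of the tractor connection
enters. -/

namespace ProjTractor

/-! ### Structure constants of the imaginary (split) octonions -/

/-- `e_i × e_j` is a multiple of `e_k` for `k = octIdx i j`. -/
def octIdx : Fin 7 → Fin 7 → Fin 7 :=
  ![![0, 2, 1, 4, 3, 6, 5], ![2, 0, 0, 5, 6, 3, 4], ![1, 0, 0, 6, 5, 4, 3], ![4, 5, 6, 0, 0, 1, 2],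
    ![3, 6, 5, 0, 0, 2, 1], ![6, 3, 4, 1, 2, 0, 0], ![5, 4, 3, 2, 1, 0, 0]]

/-- The signs of the products `e_i × e_j` of the imaginary split octonions. -/
def octSign : Fin 7 → Fin 7 → ℤ :=
  ![![0, 1, -1, -1, 1, -1, 1], ![-1, 0, 1, -1, 1, 1, -1], ![1, -1, 0, -1, -1, 1, 1],
    ![1, 1, 1, 0, 1, 1, 1], ![-1, -1, 1, -1, 0, 1, -1], ![1, -1, -1, -1, -1, 0, 1],
    ![-1, 1, -1, -1, 1, -1, 0]]

/-- The coefficients of the products `e_i × e_j` in the algebra with parameter `s`. -/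
def octCoef (s : ℤ) (i j : Fin 7) : ℤ := octSign i j * if 3 ≤ i ∧ 3 ≤ j then s else 1

/-- The squares of the lengths of the basis vectors `e_i`. -/
def octNorm (s : ℤ) (i : Fin 7) : ℤ := if 3 ≤ i then -s else 1

/-- The components of the 3-form `(x, y, z) ↦ x · (y × z)`. -/
def octForm (s : ℤ) (i j k : Fin 7) : ℤ :=
  if octIdx j k = i then octNorm s i * octCoef s j k else 0

/-- Endomorphisms whose action on the octonionic 3-form gives multiples of the elementary forms. -/
def octLift (s : ℤ) (a b c l i : Fin 7) : ℤ :=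
  let L (x y : Fin 7) : ℤ :=
    (if x = a then octForm s y b c * (octNorm s b * octNorm s c) else 0) +
    (if x = b then octForm s y c a * (octNorm s c * octNorm s a) else 0) +
    (if x = c then octForm s y a b * (octNorm s a * octNorm s b) else 0)
  octNorm s l * (L l i + 2 * L i l) -
    if l = i then octForm s a b c * (octNorm s a * octNorm s b * octNorm s c) else 0

/-- An explicit right inverse, up to the factor 6, of the action of gl(7) on the octonionic 3-form.
Contracting an elementary form with that 3-form gives a 7 × 7 array; the coefficients 1, 2, -1 of
the array, its transpose and the identity balance the trace, trace-free symmetric and skew parts, on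
which the action scales differently. Everything is integral, so it is a finite check. -/
theorem octLift_action : ∀ s ∈ [(-1 : ℤ), 1], ∀ a b c : Fin 7, a < b → b < c →
    ∀ i j k : Fin 7, i < j → j < k →
    ∑ l, (octLift s a b c l i * octForm s l j k + octLift s a b c l j * octForm s i l k +
      octLift s a b c l k * octForm s i j l) = if a = i ∧ b = j ∧ c = k then 6 else 0 := by
  decide +kernel

theorem octForm_trace : ∀ s ∈ [(-1 : ℤ), 1], ∀ i j : Fin 7,
    ∑ k, (if octIdx i (octIdx j k) = k then octCoef s i (octIdx j k) * octCoef s j k else 0) =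
      if i = j then - 6 * octNorm s i else 0 := by
  decide +kernel

/-- The alternating sum of `F` over the rearrangements of `w`. -/
def signedSum {α : Type} : (n : ℕ) → (Fin n → α) → ((Fin n → α) → ℤ) → ℤ
  | 0, w, F => F w
  | n + 1, w, F => ∑ p : Fin (n + 1), (if p = 0 then 1 else -1) *
      signedSum n (fun x => w (Equiv.swap 0 p x.succ)) fun r => F (Fin.cons (w p) r)

/-- A permutation of n + 1 letters is the choice of the image p of 0, followed by a permutation of
the others after exchanging 0 and p; the exchange costs a sign unless p = 0. -/
theorem signedSum_eq {α : Type} : ∀ (n : ℕ) (w : Fin n → α) (F : (Fin n → α) → ℤ),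
    signedSum n w F = ∑ σ : Equiv.Perm (Fin n), (Equiv.Perm.sign σ : ℤ) * F (w ∘ σ)
  | 0, w, F => by simp [signedSum]
  | n + 1, w, F => by
    rw [signedSum, ← Equiv.sum_comp (Equiv.Perm.decomposeFin (n := n)).symm, Fintype.sum_prod_type]
    refine Finset.sum_congr rfl fun p _ => ?_
    rw [signedSum_eq n, Finset.mul_sum]
    refine Finset.sum_congr rfl fun σ _ => ?_
    rw [Equiv.Perm.decomposeFin.symm_sign, ← mul_assoc]
    congr 1
    · split_ifs <;> simp
    · congr 1
      funext x
      refine Fin.cases ?_ (fun y => ?_) x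
      · simp
      · simp

/-- The case distinction lets an evaluation skip the inner sum whenever the outer factor vanishes,
which is what makes the sum over all 5040 permutations computable. -/
theorem signedSum_const_mul {α : Type} (n : ℕ) (w : Fin n → α) (c : ℤ) (F : (Fin n → α) → ℤ) :
    signedSum n w (fun r => c * F r) = if c = 0 then 0 else c * signedSum n w F := by
  split_ifs with h
  · simp [signedSum_eq, h]
  · simp [signedSum_eq, Finset.mul_sum, mul_left_comm]

theorem octForm_signedSum : ∀ s ∈ [(-1 : ℤ), 1], ∀ i j : Fin 7,
    signedSum 7 id (fun r => octForm s i (r 0) (r 1) * (octForm s j (r 2) (r 3) *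
      octForm s (r 4) (r 5) (r 6))) = if i = j then 144 * octNorm s i else 0 := by
  -- The three factors use the disjoint slots 2 + 2 + 3. Peeling off two slots at a time turns the
  -- completed factor into a constant of the remaining sum.
  have e (s : ℤ) (i j : Fin 7) : signedSum 7 id (fun r => octForm s i (r 0) (r 1) *
      (octForm s j (r 2) (r 3) * octForm s (r 4) (r 5) (r 6))) =
      ∑ p : Fin 7, (if p = 0 then 1 else -1) * ∑ q : Fin 6, (if q = 0 then 1 else -1) *
        signedSum 5 (fun x : Fin 5 => (Equiv.swap 0 p (Equiv.swap 0 q x.succ).succ))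
        (fun r => octForm s i p (Equiv.swap 0 p q.succ) *
          (octForm s j (r 0) (r 1) * octForm s (r 2) (r 3) (r 4))) := rfl
  have e' (s : ℤ) (j : Fin 7) (w : Fin 5 → Fin 7) : signedSum 5 w (fun r =>
      (octForm s j (r 0) (r 1) * octForm s (r 2) (r 3) (r 4))) =
      ∑ p : Fin 5, (if p = 0 then 1 else -1) * ∑ q : Fin 4, (if q = 0 then 1 else -1) *
        signedSum 3 (fun x : Fin 3 => w (Equiv.swap 0 p (Equiv.swap 0 q x.succ).succ))
        (fun r => octForm s j (w p) (w (Equiv.swap 0 p q.succ)) * octForm s (r 0) (r 1) (r 2)) := rfl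
  simp only [e, e', signedSum_const_mul]
  decide +kernel

/-! ### 3-forms on V and the 7-form-valued bilinear form H̃ -/

section ThreeForm
variable {V : Type*} [AddCommGroup V] [Module ℝ V] [TopologicalSpace V]
  (Φ : V [⋀^Fin 3]→L[ℝ] ℝ)

theorem form_add_fst (x x' y z : V) : Φ ![x + x', y, z] = Φ ![x, y, z] + Φ ![x', y, z] := by
  have h := Φ.map_update_add ![0, y, z] 0 x x'
  have e (w : V) : Function.update ![0, y, z] 0 w = ![w, y, z] := by
    ext i; fin_cases i <;> rfl
  rwa [e, e, e] at h

theorem form_add_snd (x x' y z : V) : Φ ![y, x + x', z] = Φ ![y, x, z] + Φ ![y, x', z] := by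
  have h := Φ.map_update_add ![y, 0, z] 1 x x'
  have e (w : V) : Function.update ![y, 0, z] 1 w = ![y, w, z] := by
    ext i; fin_cases i <;> rfl
  rwa [e, e, e] at h

theorem form_add_thd (x x' y z : V) : Φ ![y, z, x + x'] = Φ ![y, z, x] + Φ ![y, z, x'] := by
  have h := Φ.map_update_add ![y, z, 0] 2 x x'
  have e (w : V) : Function.update ![y, z, 0] 2 w = ![y, z, w] := by
    ext i; fin_cases i <;> rfl
  rwa [e, e, e] at h

theorem form_smul_fst (t : ℝ) (x y z : V) : Φ ![t • x, y, z] = t * Φ ![x, y, z] := by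
  have h := Φ.map_update_smul ![0, y, z] 0 t x
  have e (w : V) : Function.update ![0, y, z] 0 w = ![w, y, z] := by
    ext i; fin_cases i <;> rfl
  rwa [e, e] at h

theorem form_smul_snd (t : ℝ) (x y z : V) : Φ ![y, t • x, z] = t * Φ ![y, x, z] := by
  have h := Φ.map_update_smul ![y, 0, z] 1 t x
  have e (w : V) : Function.update ![y, 0, z] 1 w = ![y, w, z] := by
    ext i; fin_cases i <;> rfl
  rwa [e, e] at h

theorem form_smul_thd (t : ℝ) (x y z : V) : Φ ![y, z, t • x] = t * Φ ![y, z, x] := by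
  have h := Φ.map_update_smul ![y, z, 0] 2 t x
  have e (w : V) : Function.update ![y, z, 0] 2 w = ![y, z, w] := by
    ext i; fin_cases i <;> rfl
  rwa [e, e] at h

theorem form_eq_zero_fst_snd (x y : V) : Φ ![x, x, y] = 0 :=
  Φ.map_eq_zero_of_eq _ (i := 0) (j := 1) rfl (by decide)

theorem form_eq_zero_snd_thd (x y : V) : Φ ![y, x, x] = 0 :=
  Φ.map_eq_zero_of_eq _ (i := 1) (j := 2) rfl (by decide)

theorem form_swap_fst (x y z : V) : Φ ![x, y, z] = -Φ ![y, x, z] := by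
  have h := form_eq_zero_fst_snd Φ (x + y) z
  rw [form_add_fst, form_add_snd, form_add_snd, form_eq_zero_fst_snd, form_eq_zero_fst_snd] at h
  linarith

theorem form_swap_snd (x y z : V) : Φ ![x, y, z] = -Φ ![x, z, y] := by
  have h := form_eq_zero_snd_thd Φ (y + z) x
  rw [form_add_snd, form_add_thd, form_add_thd, form_eq_zero_snd_thd, form_eq_zero_snd_thd] at h
  linarith

/-- A 3-form as a trilinear map. -/
def formTrilin : V →ₗ[ℝ] V →ₗ[ℝ] V →ₗ[ℝ] ℝ where
  toFun x := LinearMap.mk₂ ℝ (fun y z => Φ ![x, y, z])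
    (fun y y' z => form_add_snd Φ y y' x z) (fun t y z => form_smul_snd Φ t y x z)
    (fun y z z' => form_add_thd Φ z z' x y) (fun t y z => form_smul_thd Φ t z x y)
  map_add' x x' := by ext y z; exact form_add_fst Φ x x' y z
  map_smul' t x := by ext y z; exact form_smul_fst Φ t x y z

theorem formTrilin_apply (x y z : V) : formTrilin Φ x y z = Φ ![x, y, z] := rfl

/-- Sorting the indices of a basis triple changes both forms by the same sign. -/
theorem form_ext_of_lt {Φ Ψ : V [⋀^Fin 3]→L[ℝ] ℝ} (b : Module.Basis (Fin 7) ℝ V)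
    (h : ∀ i j k, i < j → j < k → Φ ![b i, b j, b k] = Ψ ![b i, b j, b k]) : Φ = Ψ := by
  apply ContinuousAlternatingMap.toAlternatingMap_injective
  refine b.ext_alternating fun v hv => ?_
  have hm : StrictMono (v ∘ Tuple.sort v) :=
    (Tuple.monotone_sort v).strictMono_of_injective (hv.comp (Tuple.sort v).injective)
  have e : (fun i => b (v i)) = ![b ((v ∘ Tuple.sort v) 0), b ((v ∘ Tuple.sort v) 1),
      b ((v ∘ Tuple.sort v) 2)] ∘ (Tuple.sort v).symm := by
    have e' : ![b ((v ∘ Tuple.sort v) 0), b ((v ∘ Tuple.sort v) 1), b ((v ∘ Tuple.sort v) 2)] =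
        fun i => b (v (Tuple.sort v i)) := by
      ext i; fin_cases i <;> rfl
    rw [e']; ext; simp
  rw [e, AlternatingMap.map_perm Φ.toAlternatingMap, AlternatingMap.map_perm Ψ.toAlternatingMap]
  exact congrArg _ (h _ _ _ (hm Fin.zero_lt_one) (hm (by decide : (1 : Fin 3) < 2)))

/-- The 7-form `(1/6) (x ⌟ Φ) ∧ (y ⌟ Φ) ∧ Φ` before antisymmetrization. -/
def hMulti (x y : V) : MultilinearMap ℝ (fun _ : Fin 7 => V) ℝ where
  toFun v := formTrilin Φ x (v 0) (v 1) * formTrilin Φ y (v 2) (v 3) *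
    formTrilin Φ (v 4) (v 5) (v 6)
  map_update_add' {inst} v i a b := by
    obtain rfl : inst = instDecidableEqFin 7 := Subsingleton.elim _ _
    fin_cases i <;> simp <;> ring
  map_update_smul' {inst} v i a b := by
    obtain rfl : inst = instDecidableEqFin 7 := Subsingleton.elim _ _
    fin_cases i <;> simp <;> ring

/-- The 7-form `(1/6) (x ⌟ Φ) ∧ (y ⌟ Φ) ∧ Φ`. -/
noncomputable def hAlt (x y : V) : V [⋀^Fin 7]→ₗ[ℝ] ℝ :=
  ((1 / 6) * (1 / (2 * 2 * 6)) : ℝ) • MultilinearMap.alternatization (hMulti Φ x y)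

theorem hMulti_comp_perm (x y : V) (v : Fin 7 → V) (σ : Equiv.Perm (Fin 7)) :
    (MultilinearMap.domDomCongr σ (hMulti Φ x y)) v = Φ ![x, v (σ 0), v (σ 1)] *
      Φ ![y, v (σ 2), v (σ 3)] * Φ ![v (σ 4), v (σ 5), v (σ 6)] := rfl

theorem alternatization_hMulti (x y : V) (v : Fin 7 → V) :
    MultilinearMap.alternatization (hMulti Φ x y) v = ∑ σ : Equiv.Perm (Fin 7),
      ((Equiv.Perm.sign σ : ℤ) : ℝ) * (Φ ![x, v (σ 0), v (σ 1)] *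
      Φ ![y, v (σ 2), v (σ 3)] * Φ ![v (σ 4), v (σ 5), v (σ 6)]) := by
  rw [MultilinearMap.alternatization_apply]
  refine Finset.sum_congr rfl fun σ _ => ?_
  rw [Units.smul_def, zsmul_eq_mul, hMulti_comp_perm]

theorem hAlt_apply (x y : V) (v : Fin 7 → V) : hAlt Φ x y v = hTilde Φ x y v := by
  rw [hAlt, AlternatingMap.smul_apply, alternatization_hMulti, smul_eq_mul]
  unfold hTilde
  rw [mul_assoc]

/-- The space of 7-forms on V is a line spanned by the determinant of b. -/
theorem hTilde_eq_det_mul (b : Module.Basis (Fin 7) ℝ V) (x y : V) (v : Fin 7 → V) :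
    hTilde Φ x y v = b.det v * hTilde Φ x y b := by
  have key (f : V [⋀^Fin 7]→ₗ[ℝ] ℝ) : f v = b.det v * f b := by
    have h := DFunLike.congr_fun (AlternatingMap.eq_smul_basis_det b f) v
    rw [h, AlternatingMap.smul_apply, smul_eq_mul, mul_comm]
  have h := key (hAlt Φ x y)
  rwa [hAlt_apply, hAlt_apply] at h

/-- The symmetric bilinear form `(1/6) (x ⌟ Φ) ∧ (y ⌟ Φ) ∧ Φ` evaluated on a fixed tuple. -/
noncomputable def hForm (v : Fin 7 → V) : LinearMap.BilinForm ℝ V :=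
  LinearMap.mk₂ ℝ (fun x y => hTilde Φ x y v)
    (fun x x' y => by
      simp only [hTilde, form_add_fst, add_mul, mul_add, Finset.sum_add_distrib])
    (fun t x y => by
      simp only [hTilde, form_smul_fst, smul_eq_mul, Finset.mul_sum]
      exact Finset.sum_congr rfl fun _ _ => by ring)
    (fun x x' y => by
      simp only [hTilde, form_add_fst, add_mul, mul_add, Finset.sum_add_distrib])
    (fun t x y => by
      simp only [hTilde, form_smul_fst, smul_eq_mul, Finset.mul_sum]
      exact Finset.sum_congr rfl fun _ _ => by ring)

/-- The matrix of `hForm` in a basis. -/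
noncomputable def hMatrix (b : Fin 7 → V) : Matrix (Fin 7) (Fin 7) ℝ :=
  Matrix.of fun i j => hTilde Φ (b i) (b j) b

theorem hMatrix_eq_toMatrix (b : Module.Basis (Fin 7) ℝ V) :
    hMatrix Φ b = LinearMap.BilinForm.toMatrix b (hForm Φ b) := by
  ext i j
  rw [LinearMap.BilinForm.toMatrix_apply]
  rfl

/-- The exponent is 7 + 2: each entry scales by det as a 7-form, giving the seventh power in a 7 × 7
determinant, and the change of basis of the bilinear form gives det twice. This is why ε is a ninth
root. -/
theorem det_hMatrix (b b' : Module.Basis (Fin 7) ℝ V) :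
    (hMatrix Φ b').det = b.det b' ^ 9 * (hMatrix Φ b).det := by
  have h : hMatrix Φ b' = b.det b' • LinearMap.BilinForm.toMatrix b' (hForm Φ b) := by
    ext i j
    rw [Matrix.smul_apply, LinearMap.BilinForm.toMatrix_apply]
    exact hTilde_eq_det_mul Φ b _ _ b'
  rw [h, Matrix.det_smul, hMatrix_eq_toMatrix,
    ← LinearMap.BilinForm.toMatrix_mul_basis_toMatrix b b' (hForm Φ b), Matrix.det_mul, Matrix.det_mul,
    Matrix.det_transpose, Module.Basis.det_apply]
  simp only [Fintype.card_fin]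
  ring

/-- The induced metric can be computed in a single basis. -/
theorem isInducedMetric_iff (b : Module.Basis (Fin 7) ℝ V) (B : LinearMap.BilinForm ℝ V) :
    IsInducedMetric Φ B ↔ ∃ t : ℝ, t ≠ 0 ∧ t ^ 9 = (hMatrix Φ b).det ∧
      ∀ x y, hTilde Φ x y b = B x y * t := by
  constructor
  · rintro ⟨ε, h0, h1, h2⟩
    refine ⟨ε b, fun h => h0 ?_, h1 b, fun x y => h2 x y b⟩
    rw [AlternatingMap.eq_smul_basis_det b ε, h, zero_smul]
  · rintro ⟨t, h0, h1, h2⟩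
    refine ⟨t • b.det, fun h => h0 ?_, fun b' => ?_, fun x y v => ?_⟩
    · have h' := congrArg (fun f => f b) h
      rwa [AlternatingMap.smul_apply, b.det_self, smul_eq_mul, mul_one] at h'
    · change _ = (hMatrix Φ b').det
      rw [det_hMatrix Φ b b', ← h1, AlternatingMap.smul_apply, smul_eq_mul]
      ring
    · rw [hTilde_eq_det_mul Φ b, h2, AlternatingMap.smul_apply, smul_eq_mul]
      ring

/-- The ninth power is injective on the reals, so ε, and then B, is determined. -/
theorem IsInducedMetric.unique {Φ : V [⋀^Fin 3]→L[ℝ] ℝ} (b : Module.Basis (Fin 7) ℝ V)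
    {B B' : LinearMap.BilinForm ℝ V} (h : IsInducedMetric Φ B) (h' : IsInducedMetric Φ B') :
    B = B' := by
  obtain ⟨t, h0, h1, h2⟩ := (isInducedMetric_iff Φ b B).1 h
  obtain ⟨t', h0', h1', h2'⟩ := (isInducedMetric_iff Φ b B').1 h'
  have e : t = t' := (Odd.strictMono_pow (by decide : Odd 9)).injective (h1.trans h1'.symm)
  subst e
  ext x y
  exact mul_right_cancel₀ h0 ((h2 x y).symm.trans (h2' x y))

end ThreeForm

/-! ### Imaginary (split) octonions in coordinates -/

section OctBasis

/-- The product of the imaginary (split) octonions in coordinates. -/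
noncomputable def octCoord (s : ℤ) (x y : Fin 7 → ℝ) (k : Fin 7) : ℝ :=
  ∑ i, ∑ j, x i * y j * if octIdx i j = k then (octCoef s i j : ℝ) else 0

/-- Written out so that identities for the product become polynomial identities in the coordinates.
-/
theorem octCoord_eq (s : ℤ) (x y : Fin 7 → ℝ) : octCoord s x y =
    ![(x 1 * y 2 - x 2 * y 1) + s * ((x 3 * y 4 - x 4 * y 3) + (x 5 * y 6 - x 6 * y 5)),
    -(x 0 * y 2 - x 2 * y 0) + s * ((x 3 * y 5 - x 5 * y 3) - (x 4 * y 6 - x 6 * y 4)),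
    (x 0 * y 1 - x 1 * y 0) + s * ((x 3 * y 6 - x 6 * y 3) + (x 4 * y 5 - x 5 * y 4)),
    (x 0 * y 4 - x 4 * y 0) + (x 1 * y 5 - x 5 * y 1) + (x 2 * y 6 - x 6 * y 2),
    -(x 0 * y 3 - x 3 * y 0) - (x 1 * y 6 - x 6 * y 1) + (x 2 * y 5 - x 5 * y 2),
    (x 0 * y 6 - x 6 * y 0) - (x 1 * y 3 - x 3 * y 1) - (x 2 * y 4 - x 4 * y 2),
    -(x 0 * y 5 - x 5 * y 0) + (x 1 * y 4 - x 4 * y 1) - (x 2 * y 3 - x 3 * y 2)] := by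
  funext k
  fin_cases k <;> simp [octCoord, Fin.sum_univ_seven, octIdx, octCoef, octSign] <;> ring

theorem octCoord_single (s : ℤ) (i j : Fin 7) : octCoord s (Pi.single i 1) (Pi.single j 1) =
    (octCoef s i j : ℝ) • Pi.single (octIdx i j) 1 := by
  funext k
  simp only [octCoord, Pi.smul_apply, smul_eq_mul, Pi.single_apply]
  rw [Finset.sum_eq_single i (by intro x _ hx; simp [hx]) (by simp),
    Finset.sum_eq_single j (by intro x _ hx; simp [hx]) (by simp)]
  simp [eq_comm]

open scoped Quaternion in
/-- Coordinates on the imaginary (split) octonions. -/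
noncomputable def imOctEquiv : imOct ≃ₗ[ℝ] (Fin 7 → ℝ) where
  toFun x := ![x.1.1.imI, x.1.1.imJ, x.1.1.imK, x.1.2.re, x.1.2.imI, x.1.2.imJ, x.1.2.imK]
  map_add' x y := by ext i; fin_cases i <;> simp
  map_smul' t x := by ext i; fin_cases i <;> simp
  invFun x := ⟨(⟨0, x 0, x 1, x 2⟩, ⟨x 3, x 4, x 5, x 6⟩), rfl⟩
  left_inv x := by
    have h : x.1.1.re = 0 := x.2
    ext <;> simp [h]
  right_inv x := by ext i; fin_cases i <;> simp

theorem imOct_product (s : ℤ) (x y z : imOct) :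
    z.1 = (1 / 2 : ℝ) • (cdMul (s : ℝ) x.1 y.1 - cdMul (s : ℝ) y.1 x.1) ↔
      imOctEquiv z = octCoord s (imOctEquiv x) (imOctEquiv y) := by
  have hx : x.1.1.re = 0 := x.2
  have hy : y.1.1.re = 0 := y.2
  have hz : z.1.1.re = 0 := z.2
  rw [octCoord_eq]
  constructor
  · intro h
    ext i
    fin_cases i <;> simp [imOctEquiv, h, cdMul, hx, hy] <;> ring
  · intro h
    have h' := fun i => congrFun h i
    have h0 := h' 0
    have h1 := h' 1
    have h2 := h' 2
    have h3 := h' 3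
    have h4 := h' 4
    have h5 := h' 5
    have h6 := h' 6
    simp [imOctEquiv] at h0 h1 h2 h3 h4 h5 h6
    ext
    · simp [cdMul, hx, hy, hz]; ring
    · simp [cdMul, hx, hy, h0]; ring
    · simp [cdMul, hx, hy, h1]; ring
    · simp [cdMul, hx, hy, h2]; ring
    · simp [cdMul, hx, hy, h3]; ring
    · simp [cdMul, hx, hy, h4]; ring
    · simp [cdMul, hx, hy, h5]; ring
    · simp [cdMul, hx, hy, h6]; ring

variable {V : Type*} [AddCommGroup V] [Module ℝ V]

/-- The product `c` has the structure constants of the imaginary (split) octonions. -/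
def IsOctBasis (s : ℤ) (c : V →ₗ[ℝ] V →ₗ[ℝ] V) (b : Module.Basis (Fin 7) ℝ V) : Prop :=
  ∀ i j, c (b i) (b j) = (octCoef s i j : ℝ) • b (octIdx i j)

theorem IsOctBasis.equivFun_apply {s : ℤ} {c : V →ₗ[ℝ] V →ₗ[ℝ] V} {b : Module.Basis (Fin 7) ℝ V}
    (h : IsOctBasis s c b) (u v : V) :
    b.equivFun (c u v) = octCoord s (b.equivFun u) (b.equivFun v) := by
  funext k
  rw [← LinearMap.sum_repr_mul_repr_mul b b (B := c) u v]
  simp only [octCoord, Finsupp.sum_fintype, h _ _, map_sum, map_smul, zero_smul, smul_zero,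
    implies_true, Finset.sum_apply, Pi.smul_apply, smul_eq_mul, Module.Basis.repr_self,
    Module.Basis.equivFun_apply, Finset.sum_const_zero, Finsupp.single_apply]
  refine Finset.sum_congr rfl fun i _ => Finset.sum_congr rfl fun j _ => ?_
  split_ifs <;> ring

theorem isOctonionic_iff (s : ℤ) (c : V →ₗ[ℝ] V →ₗ[ℝ] V) :
    IsOctonionic (s : ℝ) c ↔ ∃ b, IsOctBasis s c b := by
  constructor
  · rintro ⟨φ, hφ⟩
    refine ⟨Module.Basis.ofEquivFun (φ.trans imOctEquiv), fun i j => ?_⟩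
    apply (φ.trans imOctEquiv).injective
    have h := (imOct_product s _ _ _).1 (hφ ((φ.trans imOctEquiv).symm (Pi.single i 1))
      ((φ.trans imOctEquiv).symm (Pi.single j 1)))
    simp only [Module.Basis.coe_ofEquivFun]
    rw [map_smul, LinearEquiv.apply_symm_apply, ← octCoord_single]
    refine h.trans ?_
    congr 1
    · exact (φ.trans imOctEquiv).apply_symm_apply _
    · exact (φ.trans imOctEquiv).apply_symm_apply _
  · rintro ⟨b, hb⟩
    refine ⟨b.equivFun.trans imOctEquiv.symm, fun u v => ?_⟩
    rw [imOct_product]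
    simpa using hb.equivFun_apply u v

end OctBasis

/-! ### Metric, product and 3-form in an octonionic basis -/

section Diagonal
variable {V : Type*} [AddCommGroup V] [Module ℝ V]

/-- The basis `b` is orthogonal for `B`, with the lengths of the imaginary (split) octonions. -/
def IsOctOrtho (s : ℤ) (B : LinearMap.BilinForm ℝ V) (b : Module.Basis (Fin 7) ℝ V) : Prop :=
  ∀ i j, B (b i) (b j) = if i = j then (octNorm s i : ℝ) else 0

variable {s : ℤ} {B : LinearMap.BilinForm ℝ V} {b : Module.Basis (Fin 7) ℝ V}
  {c : V →ₗ[ℝ] V →ₗ[ℝ] V}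

theorem IsOctOrtho.apply_eq (h : IsOctOrtho s B b) (u v : V) :
    B u v = ∑ i, (octNorm s i : ℝ) * (b.equivFun u i * b.equivFun v i) := by
  rw [← LinearMap.sum_repr_mul_repr_mul b b (B := B) u v, Finsupp.sum_fintype _ _ (by simp)]
  refine Finset.sum_congr rfl fun i _ => ?_
  rw [Finsupp.sum_fintype _ _ (by simp)]
  simp only [h _ _, smul_eq_mul, mul_ite, mul_zero, Finset.sum_ite_eq, Finset.mem_univ, if_true,
    Module.Basis.equivFun_apply]
  ring

theorem IsOctOrtho.unique {B' : LinearMap.BilinForm ℝ V} (h : IsOctOrtho s B b)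
    (h' : IsOctOrtho s B' b) : B = B' := by
  ext u v
  rw [h.apply_eq, h'.apply_eq]

theorem IsOctOrtho.isSymm (h : IsOctOrtho s B b) : B.IsSymm := by
  refine ⟨fun u v => ?_⟩
  simp only [h.apply_eq]
  exact Finset.sum_congr rfl fun i _ => by ring

theorem octNorm_mul_self (hs : s ∈ [(-1 : ℤ), 1]) (i : Fin 7) :
    (octNorm s i : ℝ) * octNorm s i = 1 := by
  have h : ∀ s ∈ [(-1 : ℤ), 1], ∀ i, octNorm s i * octNorm s i = 1 := by decide
  exact_mod_cast h s hs i

theorem octNorm_ne_zero (hs : s ∈ [(-1 : ℤ), 1]) (i : Fin 7) : (octNorm s i : ℝ) ≠ 0 :=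
  left_ne_zero_of_mul_eq_one (octNorm_mul_self hs i)

theorem IsOctOrtho.nondegenerate (hs : s ∈ [(-1 : ℤ), 1]) (h : IsOctOrtho s B b) :
    B.Nondegenerate := by
  have key (u : V) (hu : ∀ v, B u v = 0) : u = 0 := by
    apply b.equivFun.injective
    funext i
    have h1 := hu (b i)
    rw [h.apply_eq, Finset.sum_eq_single i] at h1
    · simpa [octNorm_ne_zero hs i] using h1
    · intro j _ hj
      simp [hj.symm]
    · simp
  refine ⟨key, fun u hu => key u fun v => ?_⟩
  rw [← h.isSymm.eq v u]
  exact hu v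

theorem IsOctOrtho.equivalent (h : IsOctOrtho s B b) :
    QuadraticMap.Equivalent B.toQuadraticMap
      (QuadraticMap.weightedSumSquares ℝ fun i => (octNorm s i : ℝ)) := by
  refine ⟨⟨b.equivFun, fun v => ?_⟩⟩
  rw [QuadraticMap.weightedSumSquares_apply, LinearMap.BilinMap.toQuadraticMap_apply, h.apply_eq]
  rfl

theorem IsOctOrtho.sig_neg_one (h : IsOctOrtho (-1) B b) :
    sigPos B.toQuadraticMap = 7 ∧ sigNeg B.toQuadraticMap = 0 := by
  have e (i : Fin 7) : octNorm (-1) i = 1 := by revert i; decide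
  rw [h.equivalent.sigPos_eq, h.equivalent.sigNeg_eq, QuadraticForm.sigPos_weightedSumSquares,
    QuadraticForm.sigNeg_weightedSumSquares]
  simp only [Int.cast_pos, Int.cast_lt_zero, e]
  norm_num [show ¬ (1 : ℤ) < 0 by decide]

theorem IsOctOrtho.sig_one (h : IsOctOrtho 1 B b) :
    sigPos B.toQuadraticMap = 3 ∧ sigNeg B.toQuadraticMap = 4 := by
  rw [h.equivalent.sigPos_eq, h.equivalent.sigNeg_eq, QuadraticForm.sigPos_weightedSumSquares,
    QuadraticForm.sigNeg_weightedSumSquares]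
  simp only [Int.cast_pos, Int.cast_lt_zero]
  rw [show {i : Fin 7 | 0 < octNorm 1 i} = ((Finset.univ.filter fun i => 0 < octNorm 1 i) :
    Finset (Fin 7)) by ext; simp, show {i : Fin 7 | octNorm 1 i < 0} =
    ((Finset.univ.filter fun i => octNorm 1 i < 0) : Finset (Fin 7)) by ext; simp,
    Set.ncard_coe_finset, Set.ncard_coe_finset]
  decide

theorem IsOctBasis.skew (h : IsOctBasis s c b) (u v : V) : c u v = -c v u := by
  apply b.equivFun.injective
  rw [map_neg, h.equivFun_apply, h.equivFun_apply, octCoord_eq, octCoord_eq]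
  ext i
  fin_cases i <;> simp <;> ring

theorem IsOctBasis.orthogonal (h : IsOctBasis s c b) (hB : IsOctOrtho s B b) (u v : V) :
    B (c u v) u = 0 := by
  rw [hB.apply_eq, h.equivFun_apply, octCoord_eq]
  simp only [Fin.sum_univ_seven, octNorm]
  simp
  ring

theorem IsOctBasis.norm_product (h : IsOctBasis s c b) (hB : IsOctOrtho s B b) (u v : V) :
    B (c u v) (c u v) = B u u * B v v - B u v ^ 2 := by
  simp only [hB.apply_eq, h.equivFun_apply, octCoord_eq]
  simp only [Fin.sum_univ_seven, octNorm]
  simp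
  ring

/-- The form `x · y = -(1/6) tr (x × (y × ·))` of a product. -/
noncomputable def dotForm (c : V →ₗ[ℝ] V →ₗ[ℝ] V) : LinearMap.BilinForm ℝ V :=
  LinearMap.mk₂ ℝ (dotOfCross c)
    (fun x x' y => by simp [dotOfCross, LinearMap.add_comp, mul_add])
    (fun t x y => by simp [dotOfCross, LinearMap.smul_comp]; ring)
    (fun x y y' => by simp [dotOfCross, LinearMap.comp_add, mul_add])
    (fun t x y => by simp [dotOfCross, LinearMap.comp_smul]; ring)

theorem dotForm_apply (x y : V) : dotForm c x y = dotOfCross c x y := rfl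

/-- The diagonal of the composite of two left multiplications can be read off the multiplication
table, so the trace is the integer sum `octForm_trace`. -/
theorem IsOctBasis.isOctOrtho_dotForm (hs : s ∈ [(-1 : ℤ), 1]) (h : IsOctBasis s c b) :
    IsOctOrtho s (dotForm c) b := by
  intro i j
  rw [dotForm_apply, dotOfCross, LinearMap.trace_eq_matrix_trace ℝ b, Matrix.trace]
  have e (k : Fin 7) : (LinearMap.toMatrix b b (c (b i) ∘ₗ c (b j))).diag k =
      ((if octIdx i (octIdx j k) = k then octCoef s i (octIdx j k) * octCoef s j k else 0 : ℤ) :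
        ℝ) := by
    rw [Matrix.diag_apply, LinearMap.toMatrix_apply, LinearMap.comp_apply, h, map_smul, h]
    simp only [map_smul, Module.Basis.repr_self, Finsupp.smul_apply, Finsupp.single_apply,
      smul_eq_mul]
    split_ifs <;> simp [mul_comm]
  simp only [e]
  rw [← Int.cast_sum, octForm_trace s hs]
  split_ifs <;> simp

theorem IsOctBasis.eq_dotForm (hs : s ∈ [(-1 : ℤ), 1]) (h : IsOctBasis s c b)
    (hB : IsOctOrtho s B b) : B = dotForm c :=
  hB.unique (h.isOctOrtho_dotForm hs)

variable [TopologicalSpace V] {Φ : V [⋀^Fin 3]→L[ℝ] ℝ}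

/-- The components of `Φ` in the basis `b` are those of the octonionic 3-form. -/
def IsOctForm (s : ℤ) (Φ : V [⋀^Fin 3]→L[ℝ] ℝ) (b : Module.Basis (Fin 7) ℝ V) : Prop :=
  ∀ i j k, Φ ![b i, b j, b k] = octForm s i j k

theorem IsOctBasis.isOctForm (h : IsOctBasis s c b) (hB : IsOctOrtho s B b)
    (hΦ : ∀ w u v, Φ ![w, u, v] = B w (c u v)) : IsOctForm s Φ b := by
  intro i j k
  rw [hΦ, h, map_smul, hB, octForm, smul_eq_mul]
  by_cases e : octIdx j k = i
  · simp [e, mul_comm]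
  · simp [e, Ne.symm e]

/-- The alternating sum is 144 times the metric, and 144 = 6 · (2 · 2 · 6) is the normalization of
H̃; hence ε(b) = 1. -/
theorem IsOctForm.hTilde_eq (hs : s ∈ [(-1 : ℤ), 1]) (h : IsOctForm s Φ b) (i j : Fin 7) :
    hTilde Φ (b i) (b j) b = if i = j then (octNorm s i : ℝ) else 0 := by
  have e := octForm_signedSum s hs i j
  rw [signedSum_eq] at e
  have e' := congrArg (Int.cast (R := ℝ)) e
  rw [Int.cast_sum] at e'
  unfold hTilde
  have e2 : (∑ σ : Equiv.Perm (Fin 7), ((Equiv.Perm.sign σ : ℤ) : ℝ) *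
      (Φ ![b i, b (σ 0), b (σ 1)] * Φ ![b j, b (σ 2), b (σ 3)] * Φ ![b (σ 4), b (σ 5), b (σ 6)])) =
      if i = j then (144 : ℝ) * octNorm s i else 0 := by
    refine Eq.trans (Finset.sum_congr rfl fun σ _ => ?_) (e'.trans ?_)
    · rw [h, h, h]
      simp only [Function.comp_apply, id_eq]
      push_cast
      ring
    · push_cast
      rfl
  rw [e2]
  split_ifs <;> ring

theorem IsOctForm.det_hMatrix (hs : s ∈ [(-1 : ℤ), 1]) (h : IsOctForm s Φ b) :
    (hMatrix Φ b).det = 1 := by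
  have e : hMatrix Φ b = Matrix.diagonal fun i => (octNorm s i : ℝ) := by
    ext i j
    rw [Matrix.diagonal_apply, ← h.hTilde_eq hs i j]
    rfl
  -- Exactly four basis vectors have length -s, so the signs cancel.
  have h : ∀ s ∈ [(-1 : ℤ), 1], ∏ i, octNorm s i = 1 := by decide
  rw [e, Matrix.det_diagonal]
  exact_mod_cast h s hs

theorem IsOctForm.isInducedMetric (hs : s ∈ [(-1 : ℤ), 1]) (h : IsOctForm s Φ b)
    (hB : IsOctOrtho s B b) : IsInducedMetric Φ B := by
  refine (isInducedMetric_iff Φ b B).2 ⟨1, one_ne_zero, ?_, fun x y => ?_⟩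
  · rw [h.det_hMatrix hs, one_pow]
  · have e : hForm Φ b = B := IsOctOrtho.unique (s := s) (b := b) (fun i j => h.hTilde_eq hs i j) hB
    rw [mul_one, ← e]
    rfl

end Diagonal

/-! ### Existence of the model forms -/

section Model
variable {V : Type*} [NormedAddCommGroup V] [NormedSpace ℝ V] [FiniteDimensional ℝ V]

/-- Skewness and u · (u × v) = 0 make the trilinear form vanish on any repeated argument; the norm
identity plays no role. -/
theorem exists_form_of_product {B : LinearMap.BilinForm ℝ V} {c : V →ₗ[ℝ] V →ₗ[ℝ] V}
    (hB : B.IsSymm) (hc : ∀ u v, c u v = -c v u) (h : ∀ u v, B (c u v) u = 0) :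
    ∃ Φ : V [⋀^Fin 3]→L[ℝ] ℝ, ∀ w u v, Φ ![w, u, v] = B w (c u v) := by
  have h01 (u v : V) : B u (c u v) = 0 := by
    rw [← h u v]
    exact (hB.eq u (c u v))
  have h12 (u : V) : c u u = 0 := by
    have h2 : (2 : ℝ) • c u u = 0 := by
      rw [two_smul, ← eq_neg_iff_add_eq_zero]
      exact hc u u
    simpa using h2
  have h02 (u v : V) : B u (c v u) = 0 := by
    rw [hc, map_neg, h01, neg_zero]
  let m : MultilinearMap ℝ (fun _ : Fin 3 => V) ℝ :=
    { toFun := fun v => B (v 0) (c (v 1) (v 2))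
      map_update_add' := fun {inst} v i x y => by
        obtain rfl : inst = instDecidableEqFin 3 := Subsingleton.elim _ _
        fin_cases i <;> simp
      map_update_smul' := fun {inst} v i x y => by
        obtain rfl : inst = instDecidableEqFin 3 := Subsingleton.elim _ _
        fin_cases i <;> simp }
  refine ⟨{ m with
    cont := ?_
    map_eq_zero_of_eq' := ?_ }, fun w u v => rfl⟩
  · have e : (fun v : Fin 3 → V => B (v 0) (c (v 1) (v 2))) = fun v =>
        LinearMap.toContinuousBilinearMap B (v 0)
          (LinearMap.toContinuousBilinearMap c (v 1) (v 2)) := by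
      ext; simp
    change Continuous fun v : Fin 3 → V => B (v 0) (c (v 1) (v 2))
    rw [e]
    fun_prop
  · intro v i j hij hne
    change B (v 0) (c (v 1) (v 2)) = 0
    fin_cases i <;> fin_cases j <;> simp at hij hne <;> simp [hij, h01, h02, h12]

theorem exists_octForm (s : ℤ) (b : Module.Basis (Fin 7) ℝ V) :
    ∃ (B : LinearMap.BilinForm ℝ V) (c : V →ₗ[ℝ] V →ₗ[ℝ] V) (Φ : V [⋀^Fin 3]→L[ℝ] ℝ),
      IsOctOrtho s B b ∧ IsOctBasis s c b ∧ ∀ w u v, Φ ![w, u, v] = B w (c u v) := by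
  let B : LinearMap.BilinForm ℝ V :=
    b.constr ℝ fun i => b.constr ℝ fun j => if i = j then (octNorm s i : ℝ) else 0
  let c : V →ₗ[ℝ] V →ₗ[ℝ] V :=
    b.constr ℝ fun i => b.constr ℝ fun j => (octCoef s i j : ℝ) • b (octIdx i j)
  have hB : IsOctOrtho s B b := fun i j => by simp [B, eq_comm]
  have hc : IsOctBasis s c b := fun i j => by simp [c]
  obtain ⟨Φ, hΦ⟩ := exists_form_of_product hB.isSymm hc.skew (hc.orthogonal hB)
  exact ⟨B, c, Φ, hB, hc, hΦ⟩

end Model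

/-! ### Classification of 7-dimensional cross products -/

section Classification
variable {V : Type*} [AddCommGroup V] [Module ℝ V]

/-- The product `c` is a cross product for the form `B`. -/
structure IsCrossFor (B : LinearMap.BilinForm ℝ V) (c : V →ₗ[ℝ] V →ₗ[ℝ] V) : Prop where
  symm : B.IsSymm
  nondegenerate : B.Nondegenerate
  skew : ∀ u v, c u v = -c v u
  orthogonal : ∀ u v, B (c u v) u = 0
  norm_product : ∀ u v, B (c u v) (c u v) = B u u * B v v - B u v ^ 2

namespace IsCrossFor
variable {B : LinearMap.BilinForm ℝ V} {c : V →ₗ[ℝ] V →ₗ[ℝ] V}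

theorem comm (h : IsCrossFor B c) (u v : V) : B u v = B v u := h.symm.eq u v

theorem ext (h : IsCrossFor B c) {u v : V} (huv : ∀ w, B u w = B v w) : u = v := by
  rw [← sub_eq_zero]
  exact h.nondegenerate.1 _ fun w => by simp [huv]

theorem orthogonal_right (h : IsCrossFor B c) (u v : V) : B (c u v) v = 0 := by
  rw [h.skew, map_neg, LinearMap.neg_apply, h.orthogonal, neg_zero]

/-- Polarizing (u × v) · v = 0 and (u × v) · u = 0 makes the trilinear form alternating. -/
theorem cyclic (h : IsCrossFor B c) (u v w : V) : B (c u v) w = B u (c v w) := by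
  have e := h.orthogonal_right u (v + w)
  have e' := h.orthogonal_right (u + w) v
  have e1 := h.orthogonal_right u v
  have e2 := h.orthogonal_right u w
  have e3 := h.orthogonal (u + w) v
  have e4 := h.orthogonal u v
  have e5 := h.orthogonal w v
  simp only [map_add, LinearMap.add_apply] at e e' e3
  have e6 : B u (c v w) = -B (c w v) u := by
    rw [h.comm, h.skew, map_neg, LinearMap.neg_apply]
  linarith

theorem norm_product_polar (h : IsCrossFor B c) (x z w : V) :
    B (c x z) (c x w) = B x x * B z w - B x z * B x w := by
  have e := h.norm_product x (z + w)
  have e1 := h.norm_product x z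
  have e2 := h.norm_product x w
  have e3 := h.comm (c x z) (c x w)
  have e4 := h.comm z w
  simp only [map_add, LinearMap.add_apply] at e
  linear_combination (1 / 2 : ℝ) * (e - e1 - e2 + e3 - B x x * e4)

/-- Tested against w, the left side is -(x × z) · (x × w) by cyclicity, and the polarized norm
identity evaluates it. Nondegeneracy removes w. Its polarization in x, the next lemma, replaces
associativity in all later products. -/
theorem double (h : IsCrossFor B c) (x z : V) : c x (c x z) = -(B x x • z) + B x z • x := by
  apply h.ext
  intro w
  have e := h.norm_product_polar x z w
  have e1 : B (c x (c x z)) w = -B (c x z) (c x w) := by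
    rw [h.skew, map_neg, LinearMap.neg_apply, h.cyclic]
  rw [e1, e]
  simp
  ring

theorem polar (h : IsCrossFor B c) (x y z : V) :
    c x (c y z) = -c y (c x z) - (2 * B x y) • z + B x z • y + B y z • x := by
  have e := h.double (x + y) z
  have e1 := h.double x z
  have e2 := h.double y z
  have e3 := h.comm x y
  simp only [map_add, LinearMap.add_apply, e1, e2, ← e3] at e
  rw [← sub_eq_zero] at e ⊢
  refine Eq.trans ?_ e
  module

theorem self_eq_zero (h : IsCrossFor B c) (x : V) : c x x = 0 := by
  have h2 : (2 : ℝ) • c x x = 0 := by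
    rw [two_smul, ← eq_neg_iff_add_eq_zero]
    exact h.skew x x
  simpa using h2

/-- If every vector orthogonal to the v_i were null, polarization would make their orthogonal
complement totally isotropic; by nondegeneracy it would be zero, and fewer than dim V vectors would
span V. A non-null vector is then rescaled by the root of its absolute length. -/
theorem exists_orthogonal_unit (h : IsCrossFor B c) {k : ℕ} (hk : k < Module.finrank ℝ V)
    (v : Fin k → V) (ε : Fin k → ℝ) (hε : ∀ i, ε i * ε i = 1)
    (hv : ∀ i j, B (v i) (v j) = if i = j then ε i else 0) :
    ∃ w, (∀ i, B (v i) w = 0) ∧ (B w w = 1 ∨ B w w = -1) := by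
  suffices H : ∃ w, (∀ i, B (v i) w = 0) ∧ B w w ≠ 0 by
    obtain ⟨w, hw, h0⟩ := H
    have hp : 0 < √|B w w| := Real.sqrt_pos.2 (abs_pos.2 h0)
    have hs : √|B w w| * √|B w w| = |B w w| := Real.mul_self_sqrt (abs_nonneg _)
    refine ⟨(√|B w w|)⁻¹ • w, fun i => by simp [hw i], ?_⟩
    have e : B ((√|B w w|)⁻¹ • w) ((√|B w w|)⁻¹ • w) = B w w / |B w w| := by
      simp only [map_smul, LinearMap.smul_apply, smul_eq_mul]
      rw [← mul_assoc, ← mul_inv, hs]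
      ring
    rw [e]
    rcases lt_or_gt_of_ne h0 with hneg | hpos
    · right; rw [abs_of_neg hneg, div_neg, div_self h0]
    · left; rw [abs_of_pos hpos, div_self h0]
  by_contra! hcon
  -- Subtract the orthogonal projection to the span; the factors ε i serve as inverse lengths
  -- because ε i = ±1.
  have hπ (x : V) : x - ∑ i, (ε i * B (v i) x) • v i = 0 := by
    have hperp (y : V) (j : Fin k) : B (v j) (y - ∑ i, (ε i * B (v i) y) • v i) = 0 := by
      simp only [map_sub, map_sum, map_smul, hv, smul_eq_mul, mul_ite, mul_zero,
        Finset.sum_ite_eq, Finset.mem_univ, if_true]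
      linear_combination (-(B (v j) y)) * hε j
    apply h.ext
    intro y
    rw [map_zero, LinearMap.zero_apply]
    set x' := x - ∑ i, (ε i * B (v i) x) • v i with hx'
    set y' := y - ∑ i, (ε i * B (v i) y) • v i with hy'
    have e : y = y' + ∑ i, (ε i * B (v i) y) • v i := by rw [hy']; abel
    have h1 := hcon x' (hperp x)
    have h2 := hcon y' (hperp y)
    have h3 := hcon (x' + y') fun i => by rw [map_add, hperp x, hperp y, add_zero]
    have h4 := h.comm x' y'
    simp only [map_add, LinearMap.add_apply, h1, h2] at h3
    have h5 (i : Fin k) : B x' (v i) = 0 := by rw [h.comm]; exact hperp x i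
    rw [e]
    simp only [map_add, map_sum, map_smul, h5, smul_zero, Finset.sum_const_zero]
    linarith
  have hspan : Submodule.span ℝ (Set.range v) = ⊤ := by
    rw [eq_top_iff]
    intro x _
    rw [sub_eq_zero.1 (hπ x)]
    exact Submodule.sum_mem _ fun i _ =>
      Submodule.smul_mem _ _ (Submodule.subset_span (Set.mem_range_self i))
  have := finrank_le_of_span_eq_top hspan
  simp at this
  omega

/-- Two orthogonal vectors of length -1 have a product of length (-1)(-1) = 1, so a negative
definite metric is impossible. -/
theorem exists_unit_pos (h : IsCrossFor B c) (hV : Module.finrank ℝ V = 7) : ∃ p, B p p = 1 := by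
  obtain ⟨p, -, hp⟩ := h.exists_orthogonal_unit (k := 0) (by omega) ![] ![] (by simp) (by simp)
  rcases hp with hp | hp
  · exact ⟨p, hp⟩
  obtain ⟨w, hw, hw'⟩ := h.exists_orthogonal_unit (k := 1) (by omega) ![p] ![-1] (by simp)
    (by simp [hp, Subsingleton.elim _ (0 : Fin 1)])
  have hpw : B p w = 0 := hw 0
  rcases hw' with hw' | hw'
  · exact ⟨w, hw'⟩
  · exact ⟨c p w, by rw [h.norm_product, hp, hw', hpw]; norm_num⟩

/-- If w ⊥ p is negative, so is p × w. A unit g orthogonal to p, w and p × w is either positive, or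
w × g is; and p · (w × g) = (p × w) · g = 0. -/
theorem exists_unit_pos_orthogonal (h : IsCrossFor B c) (hV : Module.finrank ℝ V = 7) {p : V}
    (hp : B p p = 1) : ∃ q, B q q = 1 ∧ B p q = 0 := by
  obtain ⟨w, hw, hw'⟩ := h.exists_orthogonal_unit (k := 1) (by omega) ![p] ![1] (by simp)
    (by simp [hp, Subsingleton.elim _ (0 : Fin 1)])
  have hpw : B p w = 0 := hw 0
  rcases hw' with hw' | hw'
  · exact ⟨w, hw', hpw⟩
  have hwp : B w p = 0 := by rw [h.comm, hpw]
  have e1 : B (c p w) (c p w) = -1 := by rw [h.norm_product, hp, hw', hpw]; norm_num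
  have e2 := h.orthogonal p w
  have e3 := h.orthogonal_right p w
  obtain ⟨g, hg, hg'⟩ := h.exists_orthogonal_unit (k := 3) (by omega) ![p, w, c p w] ![1, -1, -1]
    (by intro i; fin_cases i <;> simp)
    (by
      intro i j
      fin_cases i <;> fin_cases j <;>
        simp [hp, hw', hpw, hwp, e1, e2, e3, h.comm p (c p w), h.comm w (c p w)])
  have hg0 : B p g = 0 := hg 0
  have hg1 : B w g = 0 := hg 1
  have hg2 : B (c p w) g = 0 := hg 2
  rcases hg' with hg' | hg'
  · exact ⟨g, hg', hg0⟩
  · exact ⟨c w g, by rw [h.norm_product, hw', hg', hg1]; norm_num, by rw [← h.cyclic, hg2]⟩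

/-- Every cross product in dimension 7 is that of the imaginary octonions or split octonions. -/
theorem exists_octBasis (h : IsCrossFor B c) (hV : Module.finrank ℝ V = 7) :
    ∃ s ∈ [(-1 : ℤ), 1], ∃ b, IsOctBasis s c b ∧ IsOctOrtho s B b := by
  obtain ⟨e₁, h11⟩ := h.exists_unit_pos hV
  obtain ⟨e₂, h22, h12⟩ := h.exists_unit_pos_orthogonal hV h11
  have h21 : B e₂ e₁ = 0 := by rw [h.comm, h12]
  -- The vectors e₁, e₂, e₃ span a copy of the imaginary quaternions. Starting from two positive
  -- vectors makes this subalgebra definite even in the split case.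
  obtain ⟨e₃, c12⟩ : ∃ e₃, c e₁ e₂ = e₃ := ⟨_, rfl⟩
  have h33 : B e₃ e₃ = 1 := by rw [← c12, h.norm_product, h11, h22, h12]; norm_num
  have h31 : B e₃ e₁ = 0 := by rw [← c12, h.orthogonal]
  have h32 : B e₃ e₂ = 0 := by rw [← c12, h.orthogonal_right]
  have h13 : B e₁ e₃ = 0 := by rw [h.comm, h31]
  have h23 : B e₂ e₃ = 0 := by rw [h.comm, h32]
  have c21 : c e₂ e₁ = -e₃ := by rw [h.skew, c12]
  have c13 : c e₁ e₃ = -e₂ := by rw [← c12, h.double, h11, h12]; simp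
  have c31 : c e₃ e₁ = e₂ := by rw [h.skew, c13, neg_neg]
  have c23 : c e₂ e₃ = e₁ := by rw [← neg_neg e₃, ← c21, map_neg, h.double, h22, h21]; simp
  have c32 : c e₃ e₂ = -e₁ := by rw [h.skew, c23]
  obtain ⟨l, hl, hll⟩ := h.exists_orthogonal_unit (k := 3) (by omega) ![e₁, e₂, e₃] ![1, 1, 1]
    (by intro i; fin_cases i <;> simp)
    (by intro i j; fin_cases i <;> fin_cases j <;> simp [h11, h12, h13, h21, h22, h23, h31, h32, h33])
  have hl1 : B e₁ l = 0 := hl 0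
  have hl2 : B e₂ l = 0 := hl 1
  have hl3 : B e₃ l = 0 := hl 2
  -- The only remaining freedom is the sign of the doubling vector l, which decides between
  -- octonions and split octonions.
  obtain ⟨s, hs, hls⟩ : ∃ s ∈ [(-1 : ℤ), 1], B l l = -(s : ℝ) := by
    rcases hll with e | e
    · exact ⟨-1, by simp, by rw [e]; simp⟩
    · exact ⟨1, by simp, by rw [e]; simp⟩
  have lB (x : V) (hx : B x l = 0) : B l x = 0 := by rw [h.comm, hx]
  -- The identities k0 to k4 are the Cayley-Dickson multiplication rules for x and l × x with x
  -- orthogonal to l; m1 and m2 give the metric on the doubled half.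
  have k0 (x : V) (hx : B x l = 0) : c l (c l x) = (s : ℝ) • x := by
    rw [h.double, hls, lB x hx]; simp
  have k1 (x : V) (hx : B x l = 0) (hx1 : B x x = 1) : c x (c l x) = l := by
    rw [h.skew l x, map_neg, h.double, hx, hx1]; simp
  have k2 (x y : V) (hx : B x l = 0) (hy : B y l = 0) (hxy : B x y = 0) :
      c x (c l y) = -c l (c x y) := by
    rw [h.polar, hx, hxy, lB y hy]; simp
  have k3 (x y : V) (hx : B x l = 0) (hy : B y l = 0) (hxy : B x y = 0) (hz : B l (c x y) = 0) :
      c (c l x) (c l y) = (s : ℝ) • c x y := by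
    have hz' : B (c y x) l = 0 := by
      rw [h.comm, h.skew, map_neg, hz, neg_zero]
    have hyx : B y x = 0 := by rw [h.comm, hxy]
    rw [h.polar, h.orthogonal, h.cyclic, hz, lB y hy, h.skew (c l x) y, k2 y x hy hx hyx, neg_neg,
      k0 _ hz', h.skew y x]
    simp
  have k4 (x : V) (hx : B x l = 0) : c (c l x) l = -((s : ℝ) • x) := by
    rw [h.skew, k0 x hx]
  have m1 (x y : V) (hz : B l (c x y) = 0) : B (c l x) y = 0 := by rw [h.cyclic, hz]
  have m2 (x y : V) (hx : B x l = 0) : B (c l x) (c l y) = -(s : ℝ) * B x y := by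
    rw [h.norm_product_polar, hls, lB x hx]; ring
  have L12 : B l e₃ = 0 := lB _ hl3
  have L23 : B l e₁ = 0 := lB _ hl1
  have L31 : B l e₂ = 0 := lB _ hl2
  let v : Fin 7 → V := ![e₁, e₂, e₃, l, c l e₁, c l e₂, c l e₃]
  have n11 : B (c l e₁) e₁ = 0 := h.orthogonal_right _ _
  have n12 : B (c l e₁) e₂ = 0 := m1 _ _ (by rw [c12, L12])
  have n13 : B (c l e₁) e₃ = 0 := m1 _ _ (by rw [c13, map_neg, L31, neg_zero])
  have n21 : B (c l e₂) e₁ = 0 := m1 _ _ (by rw [c21, map_neg, L12, neg_zero])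
  have n22 : B (c l e₂) e₂ = 0 := h.orthogonal_right _ _
  have n23 : B (c l e₂) e₃ = 0 := m1 _ _ (by rw [c23, L23])
  have n31 : B (c l e₃) e₁ = 0 := m1 _ _ (by rw [c31, L31])
  have n32 : B (c l e₃) e₂ = 0 := m1 _ _ (by rw [c32, map_neg, L23, neg_zero])
  have n33 : B (c l e₃) e₃ = 0 := h.orthogonal_right _ _
  have hv (i j : Fin 7) : B (v i) (v j) = if i = j then (octNorm s i : ℝ) else 0 := by
    have hle : ∀ i j : Fin 7, i ≤ j → B (v i) (v j) = if i = j then (octNorm s i : ℝ) else 0 := by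
      intro i j hij
      rw [h.comm]
      fin_cases i <;> fin_cases j <;> first
        | exact absurd hij (by decide)
        | simp [v, octNorm, h11, h22, h33, h21, h31, h32, L12, L23, L31, hls, n11, n12, n13, n21,
            n22, n23, n31, n32, n33, h.orthogonal, m2 _ _ hl1, m2 _ _ hl2, m2 _ _ hl3]
    rcases le_total i j with hij | hij
    · exact hle i j hij
    · rw [h.comm, hle j i hij]
      by_cases e : i = j
      · simp [e]
      · simp [e, Ne.symm e]
  have hli : LinearIndependent ℝ v := by
    refine LinearMap.linearIndependent_of_isOrthoᵢ (B := B) ?_ ?_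
    · intro i j hij
      exact (hv i j).trans (if_neg hij)
    · intro i
      rw [hv i i, if_pos rfl]
      exact octNorm_ne_zero hs i
  let b : Module.Basis (Fin 7) ℝ V := basisOfLinearIndependentOfCardEqFinrank hli (by simp [hV])
  have hb (i : Fin 7) : b i = v i := by simp [b]
  refine ⟨s, hs, b, fun i j => ?_, fun i j => by rw [hb, hb, hv]⟩
  rw [hb, hb, hb]
  have hle : ∀ i j : Fin 7, i ≤ j → c (v i) (v j) = (octCoef s i j : ℝ) • v (octIdx i j) := by
    intro i j hij
    fin_cases i <;> fin_cases j <;> first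
      | exact absurd hij (by decide)
      | simp [v, octCoef, octSign, octIdx, h.self_eq_zero, c12, c13, c23, k0 _ hl1, k0 _ hl2,
          k0 _ hl3, k1 _ hl1 h11, k1 _ hl2 h22, k1 _ hl3 h33, k2 _ _ hl1 hl2 h12,
          k2 _ _ hl1 hl3 h13, k2 _ _ hl2 hl1 h21, k2 _ _ hl2 hl3 h23, k2 _ _ hl3 hl1 h31,
          k2 _ _ hl3 hl2 h32, k3 _ _ hl1 hl2 h12, k3 _ _ hl1 hl3 h13, k3 _ _ hl2 hl3 h23,
          L12, L23, L31, c21, c31, c32, h.skew _ l]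
  rcases le_total i j with hij | hij
  · exact hle i j hij
  -- Below the diagonal the table is filled in by skewness, which the structure constants share.
  · rw [h.skew, hle j i hij, ← neg_smul]
    have e : ∀ s ∈ [(-1 : ℤ), 1], ∀ i j, -octCoef s j i = octCoef s i j ∧
        octIdx j i = octIdx i j := by decide
    rw [← (e s hs i j).1, ← (e s hs i j).2]
    simp

/-- Hence a cross product has only one compatible metric, and the trace formula recovers it. -/
theorem eq_dotForm (h : IsCrossFor B c) (hV : Module.finrank ℝ V = 7) : B = dotForm c := by
  obtain ⟨s, hs, b, hb, hB⟩ := h.exists_octBasis hV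
  exact hb.eq_dotForm hs hB

end IsCrossFor

theorem isCrossProduct_iff {c : V →ₗ[ℝ] V →ₗ[ℝ] V} :
    IsCrossProduct c ↔ ∃ B, IsCrossFor B c :=
  ⟨fun ⟨B, h1, h2, h3, h4, h5⟩ => ⟨B, h1, h2, h3, h4, h5⟩,
    fun ⟨B, h1, h2, h3, h4, h5⟩ => ⟨B, h1, h2, h3, h4, h5⟩⟩

end Classification

/-! ### The octonionic 3-forms have open orbits -/

section Stability
variable {V : Type*} [NormedAddCommGroup V] [NormedSpace ℝ V]
  {Φ : V [⋀^Fin 3]→L[ℝ] ℝ} {b : Module.Basis (Fin 7) ℝ V} {s : ℤ}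

theorem fderivComp_apply (Φ : V [⋀^Fin 3]→L[ℝ] ℝ) (A : V →L[ℝ] V) (x y z : V) :
    Φ.fderivCompContinuousLinearMap (.id ℝ V) A ![x, y, z] =
      Φ ![A x, y, z] + Φ ![x, A y, z] + Φ ![x, y, A z] := by
  rw [ContinuousAlternatingMap.fderivCompContinuousLinearMap_apply, Fin.sum_univ_three]
  congr 1
  · congr 1
    · congr 1; ext i; fin_cases i <;> rfl
    · congr 1; ext i; fin_cases i <;> rfl
  · congr 1; ext i; fin_cases i <;> rfl

theorem comp_apply_three (Φ : V [⋀^Fin 3]→L[ℝ] ℝ) (A : V →L[ℝ] V) (x y z : V) :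
    Φ.compContinuousLinearMap A ![x, y, z] = Φ ![A x, A y, A z] := by
  rw [ContinuousAlternatingMap.compContinuousLinearMap_apply]
  congr 1; ext i; fin_cases i <;> rfl

theorem IsOctForm.comp (h : IsOctForm s Φ b) (g : V ≃L[ℝ] V) :
    IsOctForm s (Φ.compContinuousLinearMap (g : V →L[ℝ] V)) (b.map g.symm.toLinearEquiv) := by
  intro i j k
  rw [comp_apply_three, ← h i j k]
  simp

/-- The derivative of the orbit map at the identity is the action of gl(V) on Φ. -/
theorem hasStrictFDerivAt_form_comp (Φ : V [⋀^Fin 3]→L[ℝ] ℝ) :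
    HasStrictFDerivAt (fun g : V →L[ℝ] V => Φ.compContinuousLinearMap g)
      (Φ.fderivCompContinuousLinearMap (.id ℝ V)) (.id ℝ V) := by
  have h1 := ContinuousAlternatingMap.hasStrictFDerivAt_compContinuousLinearMap
    (Φ, ContinuousLinearMap.id ℝ V)
  have h2 := h1.comp (ContinuousLinearMap.id ℝ V)
    ((hasStrictFDerivAt_const Φ (ContinuousLinearMap.id ℝ V)).prodMk (hasStrictFDerivAt_id _))
  convert! h2 using 1
  ext A v
  simp

variable [FiniteDimensional ℝ V]

theorem IsOctForm.surjective (hs : s ∈ [(-1 : ℤ), 1]) (h : IsOctForm s Φ b) :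
    Function.Surjective (Φ.fderivCompContinuousLinearMap (.id ℝ V)) := by
  intro η
  -- Decompose η into elementary forms, lift each by `octLift`, and divide by the 6 of
  -- `octLift_action`.
  let κ (l i : Fin 7) : ℝ := ∑ p : Fin 7 × Fin 7 × Fin 7, if p.1 < p.2.1 ∧ p.2.1 < p.2.2 then
    η ![b p.1, b p.2.1, b p.2.2] / 6 * octLift s p.1 p.2.1 p.2.2 l i else 0
  let A : V →ₗ[ℝ] V := b.constr ℝ fun i => ∑ l, κ l i • b l
  have hA (i : Fin 7) : LinearMap.toContinuousLinearMap A (b i) = ∑ l, κ l i • b l := by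
    simp [A]
  refine ⟨LinearMap.toContinuousLinearMap A, form_ext_of_lt b fun i j k hij hjk => ?_⟩
  have e (x : Fin 7 → ℝ) (y z : V) : Φ ![∑ l, x l • b l, y, z] = ∑ l, x l * Φ ![b l, y, z] := by
    simp only [← formTrilin_apply, map_sum, map_smul, LinearMap.sum_apply, LinearMap.smul_apply,
      smul_eq_mul]
  have e' (x : Fin 7 → ℝ) (y z : V) : Φ ![y, ∑ l, x l • b l, z] = ∑ l, x l * Φ ![y, b l, z] := by
    simp only [← formTrilin_apply, map_sum, map_smul, LinearMap.sum_apply, LinearMap.smul_apply,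
      smul_eq_mul]
  have e'' (x : Fin 7 → ℝ) (y z : V) : Φ ![y, z, ∑ l, x l • b l] = ∑ l, x l * Φ ![y, z, b l] := by
    simp only [← formTrilin_apply, map_sum, map_smul, smul_eq_mul]
  rw [fderivComp_apply, hA, hA, hA, e, e', e'']
  simp only [h _ _ _, κ, Finset.sum_mul]
  rw [Finset.sum_comm, ← sub_eq_zero]
  conv_lhs => enter [1, 1, 2]; rw [Finset.sum_comm]
  conv_lhs => enter [1, 2]; rw [Finset.sum_comm]
  rw [← Finset.sum_add_distrib, ← Finset.sum_add_distrib, sub_eq_zero]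
  -- Each lifted elementary form contributes only to its own component.
  rw [Finset.sum_eq_single (i, j, k)]
  · simp only [hij, hjk, and_self, if_true]
    rw [← Finset.sum_add_distrib, ← Finset.sum_add_distrib]
    have := congrArg (Int.cast (R := ℝ)) (octLift_action s hs i j k hij hjk i j k hij hjk)
    push_cast at this
    simp only [and_self, if_true] at this
    calc _ = η ![b i, b j, b k] / 6 * ∑ l, ((octLift s i j k l i : ℝ) * octForm s l j k +
          octLift s i j k l j * octForm s i l k + octLift s i j k l k * octForm s i j l) := by
          rw [Finset.mul_sum]
          exact Finset.sum_congr rfl fun l _ => by ring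
      _ = _ := by rw [this]; ring
  · rintro ⟨p, q, r⟩ - hne
    by_cases hlt : p < q ∧ q < r
    · simp only [hlt, and_self, if_true]
      rw [← Finset.sum_add_distrib, ← Finset.sum_add_distrib]
      have := congrArg (Int.cast (R := ℝ)) (octLift_action s hs p q r hlt.1 hlt.2 i j k hij hjk)
      push_cast at this
      rw [if_neg (by simpa using hne)] at this
      calc _ = η ![b p, b q, b r] / 6 * ∑ l, ((octLift s p q r l i : ℝ) * octForm s l j k +
            octLift s p q r l j * octForm s i l k + octLift s p q r l k * octForm s i j l) := by
            rw [Finset.mul_sum]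
            exact Finset.sum_congr rfl fun l _ => by ring
        _ = _ := by rw [this]; ring
    · simp [hlt]
  · simp

/-- A surjective strict derivative makes the orbit map open at the identity, and all endomorphisms
near the identity are invertible. -/
theorem IsOctForm.range_mem_nhds (hs : s ∈ [(-1 : ℤ), 1]) (h : IsOctForm s Φ b) :
    (Set.range fun g : V ≃L[ℝ] V => Φ.compContinuousLinearMap (g : V →L[ℝ] V)) ∈ 𝓝 Φ := by
  have hd := hasStrictFDerivAt_form_comp Φ
  have hm := hd.map_nhds_eq_of_surj (LinearMap.range_eq_top.2 (h.surjective hs))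
  have e : Φ.compContinuousLinearMap (ContinuousLinearMap.id ℝ V) = Φ := by ext; rfl
  rw [e] at hm
  rw [← hm, Filter.mem_map]
  filter_upwards [(ContinuousLinearEquiv.refl ℝ V).nhds] with g hg
  obtain ⟨g', rfl⟩ := hg
  exact ⟨g', rfl⟩

/-- Every point of the orbit is again octonionic, in the pulled-back basis, so openness at the base
point gives openness everywhere. -/
theorem IsOctForm.isStable (hs : s ∈ [(-1 : ℤ), 1]) (h : IsOctForm s Φ b) : IsStable Φ := by
  rw [IsStable, isOpen_iff_mem_nhds]
  rintro _ ⟨g, rfl⟩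
  refine Filter.mem_of_superset ((h.comp g).range_mem_nhds hs) ?_
  rintro _ ⟨g', rfl⟩
  exact ⟨g'.trans g, rfl⟩

end Stability

/-! ### Smooth dependence of H̃ and its adjugate on the 3-form -/

section Continuation
variable {V : Type*} [NormedAddCommGroup V] [NormedSpace ℝ V]
  {E : Type*} [NormedAddCommGroup E] [NormedSpace ℝ E] {n : WithTop ℕ∞}

theorem contDiff_matrix_det {ι : Type*} [Fintype ι] [DecidableEq ι] {M : E → Matrix ι ι ℝ}
    (hM : ∀ i j, ContDiff ℝ n fun x => M x i j) : ContDiff ℝ n fun x => (M x).det := by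
  simp only [Matrix.det_apply]
  exact ContDiff.sum fun σ _ => ContDiff.const_smul _ (contDiff_prod fun i _ => hM _ _)

theorem contDiff_adjugate {ι : Type*} [Fintype ι] [DecidableEq ι] {M : E → Matrix ι ι ℝ}
    (hM : ∀ i j, ContDiff ℝ n fun x => M x i j) (i j : ι) :
    ContDiff ℝ n fun x => (M x).adjugate i j := by
  simp only [Matrix.adjugate_apply]
  refine contDiff_matrix_det fun k l => ?_
  by_cases hk : k = j
  · subst hk
    simpa using contDiff_const
  · simpa [Matrix.updateRow_ne hk] using hM k l

theorem contDiff_form_apply (v : Fin 3 → V) :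
    ContDiff ℝ n fun Φ : V [⋀^Fin 3]→L[ℝ] ℝ => Φ v :=
  (ContinuousAlternatingMap.apply ℝ V ℝ v).contDiff

theorem contDiff_hTilde (x y : V) (v : Fin 7 → V) :
    ContDiff ℝ n fun Φ : V [⋀^Fin 3]→L[ℝ] ℝ => hTilde Φ x y v := by
  unfold hTilde
  refine contDiff_const.mul (contDiff_const.mul (ContDiff.sum fun σ _ => contDiff_const.mul ?_))
  exact ((contDiff_form_apply _).mul (contDiff_form_apply _)).mul (contDiff_form_apply _)

theorem contDiff_det_hMatrix (b : Fin 7 → V) :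
    ContDiff ℝ n fun Φ : V [⋀^Fin 3]→L[ℝ] ℝ => (hMatrix Φ b).det :=
  contDiff_matrix_det fun i j => contDiff_hTilde (b i) (b j) b

end Continuation

/-! ### From stable 3-forms to cross products, by analytic continuation -/

section StableCross
variable {V : Type*} [NormedAddCommGroup V] [NormedSpace ℝ V]
  {Φ : V [⋀^Fin 3]→L[ℝ] ℝ} {B : LinearMap.BilinForm ℝ V} {c : V →ₗ[ℝ] V →ₗ[ℝ] V}

/-- The 3-form `Φ` has the induced metric `B` and the cross product `c`. -/
structure IsG2Triple (Φ : V [⋀^Fin 3]→L[ℝ] ℝ) (B : LinearMap.BilinForm ℝ V)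
    (c : V →ₗ[ℝ] V →ₗ[ℝ] V) : Prop where
  metric : IsInducedMetric Φ B
  cross : IsCrossFor B c
  form : ∀ w u v, Φ ![w, u, v] = B w (c u v)

theorem IsOctBasis.isG2Triple {s : ℤ} {b : Module.Basis (Fin 7) ℝ V} (hs : s ∈ [(-1 : ℤ), 1])
    (hc : IsOctBasis s c b) (hB : IsOctOrtho s B b) (hΦ : ∀ w u v, Φ ![w, u, v] = B w (c u v)) :
    IsG2Triple Φ B c :=
  ⟨(hc.isOctForm hB hΦ).isInducedMetric hs hB,
    ⟨hB.isSymm, hB.nondegenerate hs, hc.skew, hc.orthogonal hB, hc.norm_product hB⟩, hΦ⟩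

theorem hTilde_comp (g : V →L[ℝ] V) (x y : V) (v : Fin 7 → V) :
    hTilde (Φ.compContinuousLinearMap g) x y v = hTilde Φ (g x) (g y) fun i => g (v i) := by
  unfold hTilde
  simp only [comp_apply_three]

/-- The quadratic form of the adjugate of `hMatrix`, on the covector `Φ(·, u, v)`. -/
noncomputable def adjNorm (Φ : V [⋀^Fin 3]→L[ℝ] ℝ) (b : Module.Basis (Fin 7) ℝ V) (u v : V) : ℝ :=
  ∑ i, Φ ![b i, u, v] * ∑ j, (hMatrix Φ b).adjugate i j * Φ ![b j, u, v]

theorem contDiff_adjNorm {n : WithTop ℕ∞} (b : Module.Basis (Fin 7) ℝ V) (u v : V) :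
    ContDiff ℝ n fun Φ : V [⋀^Fin 3]→L[ℝ] ℝ => adjNorm Φ b u v :=
  ContDiff.sum fun i _ => (contDiff_form_apply _).mul (ContDiff.sum fun j _ =>
    (contDiff_adjugate (fun k l => contDiff_hTilde (b k) (b l) b) i j).mul (contDiff_form_apply _))

theorem apply_eq_sum_repr (b : Module.Basis (Fin 7) ℝ V) (f : V →ₗ[ℝ] ℝ) (z : V) :
    f z = ∑ i, f (b i) * b.repr z i := by
  conv_lhs => rw [← b.sum_repr z]
  rw [map_sum]
  exact Finset.sum_congr rfl fun i _ => by rw [map_smul, smul_eq_mul, mul_comm]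

/-- Since H̃ = tB, the covector tΦ(·, u, v) is H̃ applied to u × v; the adjugate inverts H̃ up to
det H̃ = t ^ 9 and, unlike the inverse, is polynomial in Φ. -/
theorem smul_adjugate_mulVec {b : Module.Basis (Fin 7) ℝ V} {t : ℝ}
    (hdet : t ^ 9 = (hMatrix Φ b).det) (hB : ∀ x y, hTilde Φ x y b = B x y * t)
    (hc : ∀ w u v, Φ ![w, u, v] = B w (c u v)) (u v : V) :
    t • (hMatrix Φ b).adjugate.mulVec (fun i => Φ ![b i, u, v]) =
      t ^ 9 • (b.repr (c u v) : Fin 7 → ℝ) := by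
  have e1 : t • (fun i => Φ ![b i, u, v]) = (hMatrix Φ b).mulVec (b.repr (c u v)) := by
    funext i
    rw [Pi.smul_apply, hc, apply_eq_sum_repr b, smul_eq_mul, Finset.mul_sum, Matrix.mulVec,
      dotProduct]
    refine Finset.sum_congr rfl fun j _ => ?_
    rw [hMatrix, Matrix.of_apply, hB]
    ring
  rw [← Matrix.mulVec_smul, e1, Matrix.mulVec_mulVec, Matrix.adjugate_mul, Matrix.smul_mulVec,
    Matrix.one_mulVec, hdet]

/-- The adjugate of H̃ = tB is t ^ 8 times the inverse of B, whose value on the covector B(·, u × v)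
is the squared length of u × v. -/
theorem adjNorm_eq {b : Module.Basis (Fin 7) ℝ V} {t : ℝ} (ht : t ≠ 0)
    (hdet : t ^ 9 = (hMatrix Φ b).det) (hB : ∀ x y, hTilde Φ x y b = B x y * t)
    (hc : ∀ w u v, Φ ![w, u, v] = B w (c u v)) (u v : V) :
    adjNorm Φ b u v = t ^ 8 * B (c u v) (c u v) := by
  have e3 : B (c u v) (c u v) = ∑ i, Φ ![b i, u, v] * b.repr (c u v) i := by
    simp only [hc]
    exact apply_eq_sum_repr b (B.flip (c u v)) _
  have e4 : t * adjNorm Φ b u v = t ^ 9 * B (c u v) (c u v) := by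
    rw [adjNorm, e3, Finset.mul_sum, Finset.mul_sum]
    refine Finset.sum_congr rfl fun i _ => ?_
    have := congrFun (smul_adjugate_mulVec hdet hB hc u v) i
    simp only [Pi.smul_apply, smul_eq_mul, Matrix.mulVec, dotProduct] at this
    linear_combination Φ ![b i, u, v] * this
  apply mul_left_cancel₀ ht
  rw [e4]
  ring

variable [FiniteDimensional ℝ V]

/-- Pulling back a compatible triple by an automorphism. -/
theorem IsOctBasis.exists_comp {s : ℤ} {b : Module.Basis (Fin 7) ℝ V} (hs : s ∈ [(-1 : ℤ), 1])
    (hc : IsOctBasis s c b) (hB : IsOctOrtho s B b) (hΦ : ∀ w u v, Φ ![w, u, v] = B w (c u v))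
    (g : V ≃L[ℝ] V) :
    ∃ B' c', IsG2Triple (Φ.compContinuousLinearMap (g : V →L[ℝ] V)) B' c' := by
  obtain ⟨B', c', Φ', hB', hc', hΦ'⟩ := exists_octForm s (b.map g.symm.toLinearEquiv)
  have e : Φ' = Φ.compContinuousLinearMap (g : V →L[ℝ] V) :=
    form_ext_of_lt (b.map g.symm.toLinearEquiv) fun i j k _ _ => by
      rw [hc'.isOctForm hB' hΦ', ((hc.isOctForm hB hΦ).comp g)]
  exact ⟨B', c', e ▸ hc'.isG2Triple hs hB' hΦ'⟩

/-- A polynomial identity in a 3-form that holds for the 3-forms of cross products holds for all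
3-forms. -/
theorem eq_of_forall_isG2Triple (hV : Module.finrank ℝ V = 7) {f g : V [⋀^Fin 3]→L[ℝ] ℝ → ℝ}
    (hf : ContDiff ℝ ω f) (hg : ContDiff ℝ ω g)
    (h : ∀ Φ B c, IsG2Triple Φ B c → f Φ = g Φ) : f = g := by
  have b : Module.Basis (Fin 7) ℝ V := Module.finBasisOfFinrankEq ℝ V hV
  -- One open set suffices for the identity theorem. The definite orbit is used, although the
  -- conclusion also covers forms in other orbits.
  obtain ⟨B, c, Φ, hB, hc, hΦ⟩ := exists_octForm (-1) b
  refine AnalyticOnNhd.eq_of_eventuallyEq (z₀ := Φ) (contDiff_omega_iff_analyticOnNhd.1 hf)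
    (contDiff_omega_iff_analyticOnNhd.1 hg) ?_
  filter_upwards [(hc.isOctForm hB hΦ).range_mem_nhds (by simp)] with Φ' hΦ'
  obtain ⟨k, rfl⟩ := hΦ'
  obtain ⟨B', c', h'⟩ := hc.exists_comp (by simp) hB hΦ k
  exact h _ B' c' h'

/-- A zero of the relative invariant det H̃ spreads over the open orbit and then, by analyticity,
over all 3-forms, contradicting the value 1 at the model. -/
theorem IsStable.det_hMatrix_ne_zero (h : IsStable Φ) (b : Module.Basis (Fin 7) ℝ V) :
    (hMatrix Φ b).det ≠ 0 := by
  intro h0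
  have hz : (fun Ψ : V [⋀^Fin 3]→L[ℝ] ℝ => (hMatrix Ψ b).det) = fun _ => 0 := by
    refine AnalyticOnNhd.eq_of_eventuallyEq (z₀ := Φ)
      (contDiff_omega_iff_analyticOnNhd.1 (contDiff_det_hMatrix b))
      (contDiff_omega_iff_analyticOnNhd.1 contDiff_const) ?_
    have hmem : Φ ∈ Set.range fun g : V ≃L[ℝ] V => Φ.compContinuousLinearMap (g : V →L[ℝ] V) :=
      ⟨ContinuousLinearEquiv.refl ℝ V, by ext; rfl⟩
    filter_upwards [h.mem_nhds hmem] with Ψ hΨ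
    obtain ⟨g, rfl⟩ := hΨ
    have e : hMatrix (Φ.compContinuousLinearMap (g : V →L[ℝ] V)) b =
        hMatrix Φ (b.map g.toLinearEquiv) := by
      ext i j
      exact hTilde_comp (g : V →L[ℝ] V) (b i) (b j) b
    rw [e, det_hMatrix Φ b, h0, mul_zero]
  obtain ⟨B, c, Ψ, hB, hc, hΨ⟩ := exists_octForm (-1) b
  have h1 := (hc.isOctForm hB hΨ).det_hMatrix (by simp)
  have h2 := congrFun hz Ψ
  exact one_ne_zero (h1.symm.trans h2)

theorem hTilde_comm (hV : Module.finrank ℝ V = 7) (b : Module.Basis (Fin 7) ℝ V) (x y : V) :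
    hTilde Φ x y b = hTilde Φ y x b := by
  refine congrFun (eq_of_forall_isG2Triple hV (f := fun Φ => hTilde Φ x y b)
    (g := fun Φ => hTilde Φ y x b) (contDiff_hTilde x y b) (contDiff_hTilde y x b) ?_) Φ
  intro Φ B c h
  obtain ⟨t, -, -, ht⟩ := (isInducedMetric_iff Φ b B).1 h.metric
  simp only [ht, h.cross.comm]

/-- The norm identity carries a factor t ^ 8, which is not polynomial in Φ. Its cube carries t ^ 24
= (t ^ 9) ^ 2 · (t ^ 2) ^ 3, where t ^ 9 = det H̃ and each t ^ 2 is absorbed by a quadratic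
expression in H̃ = tB. -/
theorem adjNorm_pow_three (hV : Module.finrank ℝ V = 7) (Φ : V [⋀^Fin 3]→L[ℝ] ℝ)
    (b : Module.Basis (Fin 7) ℝ V) (u v : V) :
    adjNorm Φ b u v ^ 3 = (hMatrix Φ b).det ^ 2 *
      (hTilde Φ u u b * hTilde Φ v v b - hTilde Φ u v b ^ 2) ^ 3 := by
  refine congrFun (eq_of_forall_isG2Triple hV (f := fun Φ => adjNorm Φ b u v ^ 3)
    (g := fun Φ => (hMatrix Φ b).det ^ 2 *
      (hTilde Φ u u b * hTilde Φ v v b - hTilde Φ u v b ^ 2) ^ 3)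
    ((contDiff_adjNorm b u v).pow 3) (((contDiff_det_hMatrix b).pow 2).mul
      ((((contDiff_hTilde u u b).mul (contDiff_hTilde v v b)).sub
        ((contDiff_hTilde u v b).pow 2)).pow 3)) ?_) Φ
  intro Φ B c h
  obtain ⟨t, h0, h1, h2⟩ := (isInducedMetric_iff Φ b B).1 h.metric
  simp only [adjNorm_eq h0 h1 h2 h.form, ← h1, h2, h.cross.norm_product]
  ring

/-- The real ninth root. -/
noncomputable def ninthRoot (d : ℝ) : ℝ := d * |d| ^ (-(8 / 9) : ℝ)

theorem ninthRoot_pow {d : ℝ} (hd : d ≠ 0) : ninthRoot d ^ 9 = d := by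
  have h : (|d| ^ (-(8 / 9) : ℝ)) ^ 9 = (d ^ 8)⁻¹ := by
    rw [← Real.rpow_natCast, ← Real.rpow_mul (abs_nonneg d),
      show (-(8 / 9) : ℝ) * ((9 : ℕ) : ℝ) = -((8 : ℕ) : ℝ) by norm_num,
      Real.rpow_neg (abs_nonneg d), Real.rpow_natCast, Even.pow_abs (by decide)]
  rw [ninthRoot, mul_pow, h]
  field_simp

theorem ninthRoot_ne_zero {d : ℝ} (hd : d ≠ 0) : ninthRoot d ≠ 0 := fun h => by
  have := ninthRoot_pow hd
  rw [h] at this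
  exact hd (by rw [← this]; norm_num)

theorem contDiffAt_ninthRoot {d : ℝ} (hd : d ≠ 0) :
    ContDiffAt ℝ ∞ ninthRoot d :=
  contDiffAt_id.mul ((contDiffAt_abs hd).rpow_const_of_ne (abs_ne_zero.2 hd))

/-- Stable 3-forms in dimension 7 are the 3-forms of cross products. -/
theorem exists_isG2Triple_of_det_ne_zero (hV : Module.finrank ℝ V = 7)
    (b : Module.Basis (Fin 7) ℝ V) (hd : (hMatrix Φ b).det ≠ 0) :
    ∃ B c, IsG2Triple Φ B c := by
  obtain ⟨t, h0, ht⟩ : ∃ t : ℝ, t ≠ 0 ∧ t ^ 9 = (hMatrix Φ b).det :=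
    ⟨_, ninthRoot_ne_zero hd, ninthRoot_pow hd⟩
  let B : LinearMap.BilinForm ℝ V := t⁻¹ • hForm Φ b
  have hB (x y : V) : hTilde Φ x y b = B x y * t := by
    change _ = (t⁻¹ * hTilde Φ x y b) * t
    field_simp
  have hsymm : B.IsSymm := ⟨fun x y => by
    change t⁻¹ * hTilde Φ x y b = t⁻¹ * hTilde Φ y x b
    rw [hTilde_comm hV]⟩
  have hnd : B.Nondegenerate := by
    rw [LinearMap.BilinForm.nondegenerate_iff_det_ne_zero b]
    have e : LinearMap.BilinForm.toMatrix b B = t⁻¹ • hMatrix Φ b := by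
      rw [hMatrix_eq_toMatrix, map_smul]
    rw [e, Matrix.det_smul]
    exact mul_ne_zero (pow_ne_zero _ (inv_ne_zero h0)) hd
  -- The product is defined by raising the last index of Φ; cyclic symmetry of Φ moves it to the
  -- first place.
  let c : V →ₗ[ℝ] V →ₗ[ℝ] V := (formTrilin Φ).compr₂ (B.toDual hnd).symm.toLinearMap
  have hc' (u v w : V) : B (c u v) w = Φ ![u, v, w] := by
    rw [← formTrilin_apply]
    exact LinearMap.BilinForm.apply_toDual_symm_apply (hB := hnd) (formTrilin Φ u v) w
  have hc (w u v : V) : Φ ![w, u, v] = B w (c u v) := by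
    rw [← hsymm.eq (c u v) w, hc', form_swap_fst, form_swap_snd, neg_neg]
  refine ⟨B, c, (isInducedMetric_iff Φ b B).2 ⟨t, h0, ht, hB⟩,
    ⟨hsymm, hnd, fun u v => ?_, fun u v => ?_, fun u v => ?_⟩, hc⟩
  · rw [← sub_eq_zero]
    refine hnd.1 _ fun w => ?_
    simp [hc', form_swap_fst Φ u v w]
  · rw [hc', form_swap_snd, form_eq_zero_fst_snd, neg_zero]
  -- The cubed identity is undone by cancelling t ^ 24 and by the injectivity of the real cube.
  · have h1 := adjNorm_pow_three hV Φ b u v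
    rw [adjNorm_eq h0 ht hB hc, ← ht, hB, hB, hB] at h1
    have h2 : (t ^ 8) ^ 3 * B (c u v) (c u v) ^ 3 =
        (t ^ 8) ^ 3 * (B u u * B v v - B u v ^ 2) ^ 3 := by
      linear_combination h1
    exact (Odd.strictMono_pow (by decide : Odd 3)).injective
      (mul_left_cancel₀ (pow_ne_zero 3 (pow_ne_zero 8 h0)) h2)

theorem IsStable.exists_isG2Triple (hV : Module.finrank ℝ V = 7) (h : IsStable Φ) :
    ∃ B c, IsG2Triple Φ B c :=
  let b := Module.finBasisOfFinrankEq ℝ V hV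
  exists_isG2Triple_of_det_ne_zero hV b (h.det_hMatrix_ne_zero b)

end StableCross

/-! ### The correspondence in a single fibre -/

section Pointwise
variable {V : Type*} [NormedAddCommGroup V] [NormedSpace ℝ V]
  {Φ : V [⋀^Fin 3]→L[ℝ] ℝ} {B : LinearMap.BilinForm ℝ V} {c : V →ₗ[ℝ] V →ₗ[ℝ] V}

theorem IsG2Triple.isRaising (h : IsG2Triple Φ B c) : IsRaising Φ c :=
  ⟨B, h.metric, h.cross.nondegenerate, fun w u v => (h.form w u v).symm⟩

theorem IsG2Triple.isCrossProduct (h : IsG2Triple Φ B c) : IsCrossProduct c :=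
  isCrossProduct_iff.2 ⟨B, h.cross⟩

theorem IsG2Triple.isLowering (hV : Module.finrank ℝ V = 7) (h : IsG2Triple Φ B c) :
    IsLowering c Φ := fun w u v => by
  rw [h.form, h.cross.eq_dotForm hV, dotForm_apply]

theorem IsRaising.unique (b : Module.Basis (Fin 7) ℝ V) {c' : V →ₗ[ℝ] V →ₗ[ℝ] V}
    (h : IsRaising Φ c) (h' : IsRaising Φ c') : c = c' := by
  obtain ⟨B, h1, h2, h3⟩ := h
  obtain ⟨B', h1', -, h3'⟩ := h'
  obtain rfl := h1.unique b h1'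
  ext u v
  rw [← sub_eq_zero]
  refine h2.2 _ fun w => ?_
  rw [map_sub, h3, h3', sub_self]

theorem IsLowering.unique {Φ' : V [⋀^Fin 3]→L[ℝ] ℝ} (h : IsLowering c Φ) (h' : IsLowering c Φ') :
    Φ = Φ' := by
  ext v
  have e : v = ![v 0, v 1, v 2] := by ext i; fin_cases i <;> rfl
  rw [e, h, h']

variable [FiniteDimensional ℝ V]

theorem IsG2Triple.isStable (hV : Module.finrank ℝ V = 7) (h : IsG2Triple Φ B c) :
    IsStable Φ := by
  obtain ⟨s, hs, b, hb, hB⟩ := h.cross.exists_octBasis hV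
  exact (hb.isOctForm hB h.form).isStable hs

theorem IsRaising.exists_isG2Triple (hV : Module.finrank ℝ V = 7) (hΦ : IsStable Φ)
    (h : IsRaising Φ c) : ∃ B, IsG2Triple Φ B c := by
  obtain ⟨B, c', h'⟩ := hΦ.exists_isG2Triple hV
  obtain rfl := h.unique (Module.finBasisOfFinrankEq ℝ V hV) h'.isRaising
  exact ⟨B, h'⟩

theorem IsStable.existsUnique_isRaising (hV : Module.finrank ℝ V = 7) (hΦ : IsStable Φ) :
    ∃! c, IsRaising Φ c := by
  obtain ⟨B, c, h⟩ := hΦ.exists_isG2Triple hV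
  exact ⟨c, h.isRaising, fun c' h' => h'.unique (Module.finBasisOfFinrankEq ℝ V hV) h.isRaising⟩

theorem IsCrossProduct.exists_isG2Triple (hV : Module.finrank ℝ V = 7) (hc : IsCrossProduct c) :
    ∃ Φ B, IsG2Triple Φ B c := by
  obtain ⟨B, h⟩ := isCrossProduct_iff.1 hc
  obtain ⟨s, hs, b, hb, hB⟩ := h.exists_octBasis hV
  obtain ⟨Φ, hΦ⟩ := exists_form_of_product h.symm h.skew h.orthogonal
  exact ⟨Φ, B, hb.isG2Triple hs hB hΦ⟩

theorem IsCrossProduct.existsUnique_isLowering (hV : Module.finrank ℝ V = 7)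
    (hc : IsCrossProduct c) : ∃! Φ, IsLowering c Φ := by
  obtain ⟨Φ, B, h⟩ := hc.exists_isG2Triple hV
  exact ⟨Φ, h.isLowering hV, fun Φ' h' => h'.unique (h.isLowering hV)⟩

theorem IsLowering.exists_isG2Triple (hV : Module.finrank ℝ V = 7) (hc : IsCrossProduct c)
    (h : IsLowering c Φ) : ∃ B, IsG2Triple Φ B c := by
  obtain ⟨Φ', B, h'⟩ := hc.exists_isG2Triple hV
  obtain rfl := h.unique (h'.isLowering hV)
  exact ⟨B, h'⟩

/-- Either relation completes Φ and c to a compatible triple, and a triple satisfies both. -/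
theorem isRaising_iff_isLowering (hV : Module.finrank ℝ V = 7) (hΦ : IsStable Φ)
    (hc : IsCrossProduct c) : IsRaising Φ c ↔ IsLowering c Φ := by
  constructor
  · intro h
    obtain ⟨B, h'⟩ := h.exists_isG2Triple hV hΦ
    exact h'.isLowering hV
  · intro h
    obtain ⟨B, h'⟩ := h.exists_isG2Triple hV hc
    exact h'.isRaising

/-- Each octonionic type of c forces the signature of its trace form, which is B. As c has one of
the two types and the signatures differ, the converse follows by exclusion. -/
theorem IsG2Triple.type_iff (hV : Module.finrank ℝ V = 7) (h : IsG2Triple Φ B c) :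
    (IsDefiniteStable Φ ↔ IsDefiniteCross c) ∧ (IsSplitStable Φ ↔ IsSplitCross c) := by
  have hst := h.isStable hV
  have hu (B' : LinearMap.BilinForm ℝ V) (h' : IsInducedMetric Φ B') : B' = B :=
    h'.unique (Module.finBasisOfFinrankEq ℝ V hV) h.metric
  have hD : IsDefiniteStable Φ ↔ sigPos B.toQuadraticMap = 7 ∧ sigNeg B.toQuadraticMap = 0 :=
    ⟨fun ⟨_, B', h1, h2⟩ => hu B' h1 ▸ h2, fun h2 => ⟨hst, B, h.metric, h2⟩⟩
  have hS : IsSplitStable Φ ↔ sigPos B.toQuadraticMap = 3 ∧ sigNeg B.toQuadraticMap = 4 :=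
    ⟨fun ⟨_, B', h1, h2⟩ => hu B' h1 ▸ h2, fun h2 => ⟨hst, B, h.metric, h2⟩⟩
  have hB := h.cross.eq_dotForm hV
  have hD' : IsDefiniteCross c → sigPos B.toQuadraticMap = 7 ∧ sigNeg B.toQuadraticMap = 0 := by
    intro hc
    obtain ⟨b, hb⟩ := (isOctonionic_iff (-1) c).1 (by simpa [IsDefiniteCross] using hc)
    rw [hB]
    exact (hb.isOctOrtho_dotForm (by simp)).sig_neg_one
  have hS' : IsSplitCross c → sigPos B.toQuadraticMap = 3 ∧ sigNeg B.toQuadraticMap = 4 := by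
    intro hc
    obtain ⟨b, hb⟩ := (isOctonionic_iff 1 c).1 (by simpa [IsSplitCross] using hc)
    rw [hB]
    exact (hb.isOctOrtho_dotForm (by simp)).sig_one
  have hor : IsDefiniteCross c ∨ IsSplitCross c := by
    obtain ⟨s, hs, b, hb, -⟩ := h.cross.exists_octBasis hV
    have ho := (isOctonionic_iff s c).2 ⟨b, hb⟩
    rcases List.mem_pair.1 hs with rfl | rfl
    · exact Or.inl (by simpa [IsDefiniteCross] using ho)
    · exact Or.inr (by simpa [IsSplitCross] using ho)
  rw [hD, hS]
  refine ⟨⟨fun h7 => hor.resolve_right fun h3 => ?_, hD'⟩,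
    ⟨fun h3 => hor.resolve_left fun h7 => ?_, hS'⟩⟩
  · have := (hS' h3).1
    omega
  · have := (hD' h7).1
    omega

end Pointwise

/-! ### Raising an index as a smooth equivariant map -/

section Raise
variable {V : Type*} [NormedAddCommGroup V] [NormedSpace ℝ V]
  {Φ : V [⋀^Fin 3]→L[ℝ] ℝ} {B : LinearMap.BilinForm ℝ V} {c : V →ₗ[ℝ] V →ₗ[ℝ] V}

theorem ninthRoot_pow_nine {t : ℝ} (ht : t ≠ 0) : ninthRoot (t ^ 9) = t :=
  (Odd.strictMono_pow (by decide : Odd 9)).injective (ninthRoot_pow (pow_ne_zero 9 ht))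

/-- The product `u × v` of a generic 3-form, in terms of the adjugate of `hMatrix`. -/
noncomputable def raiseAt (b : Module.Basis (Fin 7) ℝ V) (u v : V) (Φ : V [⋀^Fin 3]→L[ℝ] ℝ) : V :=
  ∑ i, (ninthRoot (hMatrix Φ b).det * (∑ j, (hMatrix Φ b).adjugate i j * Φ ![b j, u, v]) /
    (hMatrix Φ b).det) • b i

theorem IsG2Triple.det_ne_zero (h : IsG2Triple Φ B c) (b : Module.Basis (Fin 7) ℝ V) :
    (hMatrix Φ b).det ≠ 0 := by
  obtain ⟨t, h0, h1, -⟩ := (isInducedMetric_iff Φ b B).1 h.metric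
  exact h1 ▸ pow_ne_zero 9 h0

theorem IsG2Triple.raiseAt_eq (h : IsG2Triple Φ B c) (b : Module.Basis (Fin 7) ℝ V) (u v : V) :
    raiseAt b u v Φ = c u v := by
  obtain ⟨t, h0, h1, h2⟩ := (isInducedMetric_iff Φ b B).1 h.metric
  have hd := h.det_ne_zero b
  have e := smul_adjugate_mulVec h1 h2 h.form u v
  conv_rhs => rw [← b.sum_repr (c u v)]
  refine Finset.sum_congr rfl fun i _ => ?_
  have ei := congrFun e i
  simp only [Pi.smul_apply, smul_eq_mul, Matrix.mulVec, dotProduct] at ei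
  rw [← h1, ninthRoot_pow_nine h0, ei, h1, mul_div_cancel_left₀ _ hd]

theorem contDiffAt_raiseAt (b : Module.Basis (Fin 7) ℝ V) (u v : V)
    (hd : (hMatrix Φ b).det ≠ 0) : ContDiffAt ℝ ∞ (raiseAt b u v) Φ := by
  refine ContDiffAt.sum fun i _ => ContDiffAt.smul ?_ contDiffAt_const
  refine ContDiffAt.div (ContDiffAt.mul ?_ ?_) (contDiff_det_hMatrix b).contDiffAt hd
  · exact (contDiffAt_ninthRoot hd).comp Φ (contDiff_det_hMatrix b).contDiffAt
  · exact (ContDiff.sum fun j _ => (contDiff_adjugate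
      (fun k l => contDiff_hTilde (b k) (b l) b) i j).mul (contDiff_form_apply _)).contDiffAt

/-- Naturality: Φ and B pull back by g, while the product becomes g⁻¹(gu × gv). -/
theorem IsG2Triple.comp (h : IsG2Triple Φ B c) (b : Module.Basis (Fin 7) ℝ V) (g : V ≃L[ℝ] V) :
    IsG2Triple (Φ.compContinuousLinearMap (g : V →L[ℝ] V))
      (B.compl₁₂ g.toLinearEquiv.toLinearMap g.toLinearEquiv.toLinearMap)
      ((c.compl₁₂ g.toLinearEquiv.toLinearMap g.toLinearEquiv.toLinearMap).compr₂
        g.symm.toLinearEquiv.toLinearMap) := by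
  obtain ⟨t, h0, h1, h2⟩ := (isInducedMetric_iff Φ (b.map g.toLinearEquiv) B).1 h.metric
  have hX (x y : V) : hTilde (Φ.compContinuousLinearMap (g : V →L[ℝ] V)) x y b =
      hTilde Φ (g x) (g y) (b.map g.toLinearEquiv) := by
    rw [hTilde_comp]
    rfl
  refine ⟨(isInducedMetric_iff _ b _).2 ⟨t, h0, ?_, fun x y => ?_⟩,
    ⟨⟨fun x y => h.cross.symm.eq (g x) (g y)⟩, ?_, fun x y => ?_, fun x y => ?_, fun x y => ?_⟩,
    fun w u v => ?_⟩
  · rw [h1]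
    congr 1
    ext i j
    exact (hX _ _).symm
  · rw [hX, h2]
    rfl
  · refine ⟨fun x hx => ?_, fun x hx => ?_⟩
    · refine (map_eq_zero_iff g g.injective).1 (h.cross.nondegenerate.1 _ fun y => ?_)
      simpa using hx (g.symm y)
    · refine (map_eq_zero_iff g g.injective).1 (h.cross.nondegenerate.2 _ fun y => ?_)
      simpa using hx (g.symm y)
  · simp [h.cross.skew (g x) (g y)]
  · simpa using h.cross.orthogonal (g x) (g y)
  · simpa using h.cross.norm_product (g x) (g y)
  · rw [comp_apply_three]
    simpa using h.form (g w) (g u) (g v)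

variable [FiniteDimensional ℝ V]

/-- The infinitesimal form of the equivariance of `raiseAt`. -/
theorem IsG2Triple.fderiv_raiseAt (h : IsG2Triple Φ B c) (b : Module.Basis (Fin 7) ℝ V) (u v : V)
    (A : V →L[ℝ] V) :
    fderiv ℝ (raiseAt b u v) Φ (Φ.fderivCompContinuousLinearMap (.id ℝ V) A) =
      c (A u) v + c u (A v) - A (c u v) := by
  -- The line γ(t) = 1 + tA consists of invertible maps for small t, so no exponential is needed.
  obtain ⟨γ, hγ, hγ0⟩ : ∃ γ : ℝ → V →L[ℝ] V, HasDerivAt γ A 0 ∧ γ 0 = .id ℝ V := by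
    refine ⟨fun t => .id ℝ V + t • A, ?_, by simp⟩
    simpa using ((hasDerivAt_id (0 : ℝ)).smul_const A).const_add (ContinuousLinearMap.id ℝ V)
  have hid : Φ.compContinuousLinearMap (.id ℝ V) = Φ := by ext; rfl
  have h1 : HasDerivAt (fun t => Φ.compContinuousLinearMap (γ t))
      (Φ.fderivCompContinuousLinearMap (.id ℝ V) A) 0 := by
    have hf : HasFDerivAt (fun g : V →L[ℝ] V => Φ.compContinuousLinearMap g)
        (Φ.fderivCompContinuousLinearMap (.id ℝ V)) (γ 0) := by
      rw [hγ0]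
      exact (hasStrictFDerivAt_form_comp Φ).hasFDerivAt
    exact hf.comp_hasDerivAt (0 : ℝ) hγ
  have h2 : HasDerivAt (fun t => raiseAt b u v (Φ.compContinuousLinearMap (γ t)))
      (fderiv ℝ (raiseAt b u v) Φ (Φ.fderivCompContinuousLinearMap (.id ℝ V) A)) 0 := by
    have hf : HasFDerivAt (raiseAt b u v) (fderiv ℝ (raiseAt b u v) Φ)
        (Φ.compContinuousLinearMap (γ 0)) := by
      rw [hγ0, hid]
      exact ((contDiffAt_raiseAt b u v (h.det_ne_zero b)).differentiableAt (by simp)).hasFDerivAt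
    exact hf.comp_hasDerivAt (0 : ℝ) h1
  have h3 := hγ.clm_apply h2
  have hA (w : V) : HasDerivAt (fun t => γ t w) (A w) 0 := by
    simpa using hγ.clm_apply (hasDerivAt_const (0 : ℝ) w)
  let c' : V →L[ℝ] V →L[ℝ] V := c.toContinuousBilinearMap
  have h4 : HasDerivAt (fun t => c' (γ t u) (γ t v)) (c' (A u) v + c' u (A v)) 0 := by
    have := (c'.hasFDerivAt.comp_hasDerivAt (0 : ℝ) (hA u)).clm_apply (hA v)
    simpa [hγ0] using this
  -- Equivariance along the curve: γ(u ×' v) = γu × γv, where ×' is the product of γ*Φ. Comparing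
  -- the derivatives of the two sides at 0 gives the claim.
  have h5 : (fun t => c' (γ t u) (γ t v)) =ᶠ[𝓝 0]
      fun t => γ t (raiseAt b u v (Φ.compContinuousLinearMap (γ t))) := by
    have hn : Set.range ((↑) : (V ≃L[ℝ] V) → V →L[ℝ] V) ∈ 𝓝 (γ 0) := by
      rw [hγ0]
      exact (ContinuousLinearEquiv.refl ℝ V).nhds
    filter_upwards [hγ.continuousAt.eventually_mem hn] with t ht
    obtain ⟨g, hg⟩ := ht
    rw [← hg, (h.comp b g).raiseAt_eq]
    change c (g u) (g v) = g (g.symm (c (g u) (g v)))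
    simp
  have h6 := h3.unique (h4.congr_of_eventuallyEq h5.symm)
  rw [hγ0, hid, h.raiseAt_eq] at h6
  rw [eq_sub_iff_add_eq, add_comm]
  exact h6

end Raise

/-! ### Testing smoothness on components -/

section Coordinates
variable {E G : Type*} [NormedAddCommGroup E] [NormedSpace ℝ E] [NormedAddCommGroup G]
  [NormedSpace ℝ G] [FiniteDimensional ℝ G]
  {H : Type*} [NormedAddCommGroup H] [NormedSpace ℝ H] {X : Type*} [TopologicalSpace X]
  {I : ModelWithCorners ℝ H X} {M : Type*} [TopologicalSpace M] [ChartedSpace X M]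
  {ι : Type*} [Fintype ι]

/-- Smoothness may be tested after a family of linear maps that separates points. -/
theorem contMDiffAt_of_separating {n : WithTop ℕ∞} {f : M → E} {x : M} (L : ι → E →L[ℝ] G)
    (hL : ∀ e, (∀ i, L i e = 0) → e = 0)
    (h : ∀ i, ContMDiffAt I 𝓘(ℝ, G) n (fun y => L i (f y)) x) : ContMDiffAt I 𝓘(ℝ, E) n f x := by
  -- A left inverse defined on the finite-dimensional space of component values is continuous and
  -- recovers f from its components.
  obtain ⟨g, hg⟩ := (LinearMap.pi fun i => (L i : E →ₗ[ℝ] G)).exists_leftInverse_of_injective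
    (LinearMap.ker_eq_bot'.2 fun e he => hL e fun i => congrFun he i)
  have e : f = fun y => LinearMap.toContinuousLinearMap g fun i => L i (f y) :=
    funext fun y => (LinearMap.congr_fun hg (f y)).symm
  rw [e]
  exact (LinearMap.toContinuousLinearMap g).contMDiff.contMDiffAt.comp x
    (contMDiffAt_pi_space.2 h)

end Coordinates

/-! ### Derivatives of vector-valued functions on M -/

section Derivative
variable {n : ℕ} {M : Type*} [TopologicalSpace M] [ChartedSpace (Coord n) M]
  {E F G : Type*} [NormedAddCommGroup E] [NormedSpace ℝ E] [NormedAddCommGroup F]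
  [NormedSpace ℝ F] [NormedAddCommGroup G] [NormedSpace ℝ G] {x : M}

theorem mvfderiv_comp_vector {φ : E → F} {f : M → E} (hφ : DifferentiableAt ℝ φ (f x))
    (hf : MDifferentiableAt (𝓡 n) 𝓘(ℝ, E) f x) (z : TangentSpace (𝓡 n) x) :
    mvfderiv (𝓡 n) (fun y => φ (f y)) x z = fderiv ℝ φ (f x) (mvfderiv (𝓡 n) f x z) := by
  have h := (hφ.hasFDerivAt.hasMFDerivAt.comp x hf.hasMFDerivAt).mfderiv
  exact DFunLike.congr_fun h z

theorem mvfderiv_clm (L : E →L[ℝ] F) {f : M → E}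
    (hf : MDifferentiableAt (𝓡 n) 𝓘(ℝ, E) f x) (z : TangentSpace (𝓡 n) x) :
    mvfderiv (𝓡 n) (fun y => L (f y)) x z = L (mvfderiv (𝓡 n) f x z) := by
  rw [mvfderiv_comp_vector L.differentiableAt hf, L.fderiv]

theorem contMDiffAt_bilin (B : E →L[ℝ] F →L[ℝ] G) {f : M → E} {g : M → F}
    (hf : ContMDiffAt (𝓡 n) 𝓘(ℝ, E) ∞ f x) (hg : ContMDiffAt (𝓡 n) 𝓘(ℝ, F) ∞ g x) :
    ContMDiffAt (𝓡 n) 𝓘(ℝ, G) ∞ (fun y => B (f y) (g y)) x :=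
  (B.contMDiff.contMDiffAt.comp x hf).clm_apply hg

theorem mvfderiv_bilin (B : E →L[ℝ] F →L[ℝ] G) {f : M → E} {g : M → F}
    (hf : MDifferentiableAt (𝓡 n) 𝓘(ℝ, E) f x) (hg : MDifferentiableAt (𝓡 n) 𝓘(ℝ, F) g x)
    (z : TangentSpace (𝓡 n) x) :
    mvfderiv (𝓡 n) (fun y => B (f y) (g y)) x z =
      B (mvfderiv (𝓡 n) f x z) (g x) + B (f x) (mvfderiv (𝓡 n) g x z) := by
  have h1 : HasFDerivAt (fun p : E × F => B p.1 p.2) (B.deriv₂ (f x, g x)) (f x, g x) :=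
    B.isBoundedBilinearMap.hasFDerivAt (f x, g x)
  have hfg : HasMFDerivAt (𝓡 n) 𝓘(ℝ, E × F) (fun y => (f y, g y)) x
      ((mvfderiv (𝓡 n) f x).prod (mvfderiv (𝓡 n) g x)) :=
    ⟨hf.hasMFDerivAt.1.prodMk hg.hasMFDerivAt.1, hf.hasMFDerivAt.2.prodMk hg.hasMFDerivAt.2⟩
  have h := (HasMFDerivAt.comp (f := fun y => (f y, g y)) x h1.hasMFDerivAt hfg).mfderiv
  refine (DFunLike.congr_fun h z).trans ?_
  exact add_comm _ _

theorem mvfderiv_eq_of_eventuallyEq {f g : M → E} (h : f =ᶠ[𝓝 x] g) :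
    mvfderiv (𝓡 n) f x = mvfderiv (𝓡 n) g x := by
  ext1 z
  exact DFunLike.congr_fun (h.mfderiv_eq (I := 𝓡 n) (I' := 𝓘(ℝ, E))) z

end Derivative

/-! ### Local expressions in the trivialization at a point -/

section Local
open Bundle
variable {n : ℕ} {M : Type*} [TopologicalSpace M] [ChartedSpace (Coord n) M]
  [IsManifold (𝓡 n) ∞ M]

/-- The local expression at `x` of a section of the tractor bundle. -/
noncomputable def localSection (x : M) (U : Π x : M, Tractor n M x) (y : M) : Coord n × ℝ :=
  (trivializationAt (Coord n × ℝ) (Tractor n M) x ⟨y, U y⟩).2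

/-- The section with constant local expression at `x`. -/
noncomputable def constSection (x : M) (u : Coord n × ℝ) (y : M) : Tractor n M y :=
  (trivializationAt (Coord n × ℝ) (Tractor n M) x).symmL ℝ y u

/-- The local expression at `x` of a tractor 3-form. -/
noncomputable def localForm (x : M) (Φ : Π x : M, Tractor n M x [⋀^Fin 3]→L[ℝ] ℝ) (y : M) :
    (Coord n × ℝ) [⋀^Fin 3]→L[ℝ] ℝ :=
  (Φ y).compContinuousLinearMap
    ((trivializationAt (Coord n × ℝ) (Tractor n M) x).symmL ℝ y)

/-- The local expression at `x` of a product on the tractor bundle. -/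
noncomputable def localProduct (x : M)
    (c : Π x : M, Tractor n M x →ₗ[ℝ] Tractor n M x →ₗ[ℝ] Tractor n M x) (y : M) :
    (Coord n × ℝ) →ₗ[ℝ] (Coord n × ℝ) →ₗ[ℝ] (Coord n × ℝ) :=
  ((c y).compl₁₂ ((trivializationAt (Coord n × ℝ) (Tractor n M) x).symmL ℝ y).toLinearMap
    ((trivializationAt (Coord n × ℝ) (Tractor n M) x).symmL ℝ y).toLinearMap).compr₂
    ((trivializationAt (Coord n × ℝ) (Tractor n M) x).linearMapAt ℝ y)

/-- `localProduct` as a continuous bilinear map. -/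
noncomputable def localProductL (x : M)
    (c : Π x : M, Tractor n M x →ₗ[ℝ] Tractor n M x →ₗ[ℝ] Tractor n M x) (y : M) :
    (Coord n × ℝ) →L[ℝ] (Coord n × ℝ) →L[ℝ] (Coord n × ℝ) :=
  (localProduct x c y).toContinuousBilinearMap

/-- The connection form at `x` in the direction `z`. -/
noncomputable def tractorForm (p : ProjectiveStructure n M) (x : M) (z : TangentSpace (𝓡 n) x) :
    (Coord n × ℝ) →L[ℝ] (Coord n × ℝ) :=
  (connectionForm (thomas p.rep x) (chartAt (Coord n) x x)).flip z

theorem tractorConnection_apply (p : ProjectiveStructure n M) (U : Π x : M, Tractor n M x) (x : M)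
    (z : TangentSpace (𝓡 n) x) : tractorConnection p U x z =
      mvfderiv (𝓡 n) (localSection x U) x z + tractorForm p x z (U x) := rfl

theorem localSection_self (x : M) (U : Π x : M, Tractor n M x) : localSection x U x = U x :=
  trivializationAt_self x (U x)

theorem localSection_constSection_of_mem {x y : M}
    (hy : y ∈ (trivializationAt (Coord n × ℝ) (Tractor n M) x).baseSet) (u : Coord n × ℝ) :
    localSection x (constSection x u) y = u := by
  rw [localSection, constSection, Trivialization.symmL_apply _ hy]
  exact congrArg Prod.snd
    ((trivializationAt (Coord n × ℝ) (Tractor n M) x).apply_mk_symm hy u)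

/-- The trivialization at x is the identity on the fibre over x, so at the centre local expressions
agree with the objects themselves. -/
theorem constSection_self (x : M) (u : Coord n × ℝ) : constSection x u x = u := by
  exact (trivializationAt_self x _).symm.trans
    (localSection_constSection_of_mem (FiberBundle.mem_baseSet_trivializationAt' x) u)

theorem localSection_constSection (x : M) (u : Coord n × ℝ) :
    localSection x (constSection x u) =ᶠ[𝓝 x] fun _ => u := by
  filter_upwards [eventually_mem_baseSet (n := n) x] with y hy
  exact localSection_constSection_of_mem hy u

theorem constSection_localSection (x : M) (U : Π x : M, Tractor n M x) :
    ∀ᶠ y in 𝓝 x, constSection x (localSection x U y) y = U y := by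
  filter_upwards [eventually_mem_baseSet (n := n) x] with y hy
  exact (Trivialization.symmL_apply _ hy _).trans
    ((trivializationAt (Coord n × ℝ) (Tractor n M) x).symm_apply_apply_mk hy (U y))

theorem smoothSectionAt_iff {U : Π x : M, Tractor n M x} {x : M} : SmoothSectionAt U x ↔
    ContMDiffAt (𝓡 n) 𝓘(ℝ, Coord n × ℝ) ∞ (localSection x U) x :=
  Bundle.contMDiffAt_section _

theorem diffSectionAt_iff {U : Π x : M, Tractor n M x} {x : M} : DiffSectionAt U x ↔
    MDifferentiableAt (𝓡 n) 𝓘(ℝ, Coord n × ℝ) (localSection x U) x :=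
  mdifferentiableAt_section _ _

theorem smoothSectionAt_constSection (x : M) (u : Coord n × ℝ) :
    SmoothSectionAt (constSection x u) x :=
  smoothSectionAt_iff.2 (contMDiffAt_const.congr_of_eventuallyEq (localSection_constSection x u))

theorem SmoothSectionAt.diffSectionAt {U : Π x : M, Tractor n M x} {x : M}
    (h : SmoothSectionAt U x) : DiffSectionAt U x :=
  ContMDiffAt.mdifferentiableAt h (by simp)

theorem tractorConnection_constSection (p : ProjectiveStructure n M) (x : M) (u : Coord n × ℝ)
    (z : TangentSpace (𝓡 n) x) :
    tractorConnection p (constSection x u) x z = tractorForm p x z u := by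
  rw [tractorConnection_apply, mvfderiv_eq_of_eventuallyEq (localSection_constSection x u),
    mvfderiv_const, constSection_self]
  exact zero_add _

theorem localForm_apply (x : M) (Φ : Π x : M, Tractor n M x [⋀^Fin 3]→L[ℝ] ℝ) (y : M)
    (u v w : Coord n × ℝ) : localForm x Φ y ![u, v, w] =
      Φ y ![constSection x u y, constSection x v y, constSection x w y] := by
  rw [localForm, ContinuousAlternatingMap.compContinuousLinearMap_apply]
  congr 1; ext1 i; fin_cases i <;> rfl

theorem localForm_self (x : M) (Φ : Π x : M, Tractor n M x [⋀^Fin 3]→L[ℝ] ℝ) :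
    localForm x Φ x = Φ x := by
  ext v
  have e : v = ![v 0, v 1, v 2] := by ext1 i; fin_cases i <;> rfl
  rw [e, localForm_apply, constSection_self, constSection_self, constSection_self]
  rfl

theorem localProduct_apply (x : M)
    (c : Π x : M, Tractor n M x →ₗ[ℝ] Tractor n M x →ₗ[ℝ] Tractor n M x) {y : M}
    (hy : y ∈ (trivializationAt (Coord n × ℝ) (Tractor n M) x).baseSet) (u v : Coord n × ℝ) :
    localProduct x c y u v =
      localSection x (fun y => c y (constSection x u y) (constSection x v y)) y := by
  have h := congrFun ((trivializationAt (Coord n × ℝ) (Tractor n M)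
    x).coe_linearMapAt_of_mem (R := ℝ) hy)
  exact h _

theorem localProduct_self (x : M)
    (c : Π x : M, Tractor n M x →ₗ[ℝ] Tractor n M x →ₗ[ℝ] Tractor n M x) (u v : Coord n × ℝ) :
    localProduct x c x u v = c x u v := by
  rw [localProduct_apply x c (FiberBundle.mem_baseSet_trivializationAt' x), localSection_self,
    constSection_self, constSection_self]

theorem localSection_product (x : M)
    (c : Π x : M, Tractor n M x →ₗ[ℝ] Tractor n M x →ₗ[ℝ] Tractor n M x)
    (U V : Π x : M, Tractor n M x) :
    localSection x (fun y => c y (U y) (V y)) =ᶠ[𝓝 x]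
      fun y => localProductL x c y (localSection x U y) (localSection x V y) := by
  filter_upwards [eventually_mem_baseSet (n := n) x, constSection_localSection x U,
    constSection_localSection x V] with y hy hU hV
  refine Eq.trans ?_ (localProduct_apply x c hy _ _).symm
  simp only [localSection] at hU hV ⊢
  rw [hU, hV]

end Local

/-! ### Leibniz rules for families of bilinear maps -/

section Bilinear
variable {n : ℕ} {M : Type*} [TopologicalSpace M] [ChartedSpace (Coord n) M]
  {E : Type*} [NormedAddCommGroup E] [NormedSpace ℝ E] {x : M} {C : M → E →L[ℝ] E →L[ℝ] E}

theorem mdifferentiableAt_of_contMDiffAt {f : M → E}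
    (h : ContMDiffAt (𝓡 n) 𝓘(ℝ, E) ∞ f x) :
    MDifferentiableAt (𝓡 n) 𝓘(ℝ, E) f x :=
  h.mdifferentiableAt (by simp)

theorem mvfderiv_clm_apply {G : Type*} [NormedAddCommGroup G] [NormedSpace ℝ G]
    {T : M → E →L[ℝ] G} {f : M → E} (hT : MDifferentiableAt (𝓡 n) 𝓘(ℝ, E →L[ℝ] G) T x)
    (hf : MDifferentiableAt (𝓡 n) 𝓘(ℝ, E) f x) (z : TangentSpace (𝓡 n) x) :
    mvfderiv (𝓡 n) (fun y => T y (f y)) x z =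
      mvfderiv (𝓡 n) T x z (f x) + T x (mvfderiv (𝓡 n) f x z) :=
  mvfderiv_bilin (.id ℝ (E →L[ℝ] G)) hT hf z

theorem mvfderiv_clm₂ {f g : M → E}
    (hC : MDifferentiableAt (𝓡 n) 𝓘(ℝ, E →L[ℝ] E →L[ℝ] E) C x)
    (hf : MDifferentiableAt (𝓡 n) 𝓘(ℝ, E) f x) (hg : MDifferentiableAt (𝓡 n) 𝓘(ℝ, E) g x)
    (z : TangentSpace (𝓡 n) x) :
    mvfderiv (𝓡 n) (fun y => C y (f y) (g y)) x z = mvfderiv (𝓡 n) C x z (f x) (g x) +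
      C x (mvfderiv (𝓡 n) f x z) (g x) + C x (f x) (mvfderiv (𝓡 n) g x z) := by
  rw [mvfderiv_clm_apply (hC.clm_apply hf) hg, mvfderiv_clm_apply hC hf,
    add_apply]

theorem mvfderiv_apply₂ (hC : MDifferentiableAt (𝓡 n) 𝓘(ℝ, E →L[ℝ] E →L[ℝ] E) C x)
    (u v : E) (z : TangentSpace (𝓡 n) x) :
    mvfderiv (𝓡 n) (fun y => C y u v) x z = mvfderiv (𝓡 n) C x z u v := by
  rw [mvfderiv_clm₂ hC mdifferentiableAt_const mdifferentiableAt_const, mvfderiv_const,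
    mvfderiv_const, zero_apply, map_zero, zero_apply, map_zero, add_zero, add_zero]

theorem contMDiffAt_clm₂ [FiniteDimensional ℝ E]
    (h : ∀ u v, ContMDiffAt (𝓡 n) 𝓘(ℝ, E) ∞ (fun y => C y u v) x) :
    ContMDiffAt (𝓡 n) 𝓘(ℝ, E →L[ℝ] E →L[ℝ] E) ∞ C x := by
  let b := Module.finBasis ℝ E
  refine contMDiffAt_of_separating (ι := Fin (Module.finrank ℝ E) × Fin (Module.finrank ℝ E))
    (fun i => (ContinuousLinearMap.apply ℝ E (b i.2)).comp
      (ContinuousLinearMap.apply ℝ (E →L[ℝ] E) (b i.1))) (fun e he => ?_)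
    fun i => h (b i.1) (b i.2)
  have h0 (i) : e (b i) = 0 :=
    ContinuousLinearMap.coe_injective (b.ext fun j => he (i, j))
  exact ContinuousLinearMap.coe_injective (b.ext h0)

theorem leibniz_bilin (C : E →L[ℝ] E →L[ℝ] E) (A : E →L[ℝ] E) {C' : E → E → E}
    (hC : ∀ u v, C u v = C' u v) (u v u' v' : E) :
    C (A u) v + C u (A v) - A (C u v) + C u' v + C u v' + A (C' u v) =
      C' (u' + A u) v + C' u (v' + A v) := by
  simp only [← hC, map_add, add_apply]
  abel

/-- The variation of the operator C(u) has two parts: C of the covariant derivative of u, and a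
commutator with the connection form A. -/
theorem leibniz_bilin_operator (C : E →L[ℝ] E →L[ℝ] E) (A : E →L[ℝ] E) (u v u' : E) :
    C (A u) v + C u (A v) - A (C u v) + C u' v =
      (C (u' + A u) + ((C u).comp A - A.comp (C u))) v := by
  simp only [map_add, add_apply, sub_apply, ContinuousLinearMap.comp_apply]
  abel

end Bilinear

/-! ### Parallel products in local form -/

section Parallel
open Bundle
variable {n : ℕ} {M : Type*} [TopologicalSpace M] [ChartedSpace (Coord n) M]
  [IsManifold (𝓡 n) ∞ M] {p : ProjectiveStructure n M}
  {Φ : Π x : M, Tractor n M x [⋀^Fin 3]→L[ℝ] ℝ}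
  {c : Π x : M, Tractor n M x →ₗ[ℝ] Tractor n M x →ₗ[ℝ] Tractor n M x}

theorem localProductL_self (x : M) (u v : Coord n × ℝ) : localProductL x c x u v = c x u v :=
  localProduct_self x c u v

theorem localProduct_eventuallyEq (x : M) (u v : Coord n × ℝ) :
    localSection x (fun y => c y (constSection x u y) (constSection x v y)) =ᶠ[𝓝 x]
      fun y => localProductL x c y u v := by
  filter_upwards [eventually_mem_baseSet (n := n) x] with y hy
  exact (localProduct_apply x c hy u v).symm

theorem IsSmoothProduct.contMDiffAt_localProductL (h : IsSmoothProduct c) (x : M) :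
    ContMDiffAt (𝓡 n) 𝓘(ℝ, (Coord n × ℝ) →L[ℝ] (Coord n × ℝ) →L[ℝ] (Coord n × ℝ)) ∞
      (localProductL x c) x :=
  contMDiffAt_clm₂ fun u v => (smoothSectionAt_iff.1 (h _ _ x (smoothSectionAt_constSection x u)
    (smoothSectionAt_constSection x v))).congr_of_eventuallyEq (localProduct_eventuallyEq x u v).symm

theorem isSmoothProduct_of_contMDiffAt
    (h : ∀ x u v, ContMDiffAt (𝓡 n) 𝓘(ℝ, Coord n × ℝ) ∞ (fun y => localProductL x c y u v) x) :
    IsSmoothProduct c := by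
  intro U V x hU hV
  rw [smoothSectionAt_iff] at hU hV ⊢
  exact (((contMDiffAt_clm₂ (h x)).clm_apply hU).clm_apply hV).congr_of_eventuallyEq
    (localSection_product x c U V)

theorem IsSmoothProduct.mdifferentiableAt_localProductL (h : IsSmoothProduct c) (x : M) :
    MDifferentiableAt (𝓡 n) 𝓘(ℝ, (Coord n × ℝ) →L[ℝ] (Coord n × ℝ) →L[ℝ] (Coord n × ℝ))
      (localProductL x c) x :=
  mdifferentiableAt_of_contMDiffAt (h.contMDiffAt_localProductL x)

/-- A smooth product is parallel if and only if the derivatives of its local expressions are given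
by the action of the connection form. -/
theorem IsSmoothProduct.isParallelProduct_iff (h : IsSmoothProduct c) :
    IsParallelProduct p c ↔ ∀ (x : M) (z : TangentSpace (𝓡 n) x) (u v : Coord n × ℝ),
      mvfderiv (𝓡 n) (localProductL x c) x z u v =
        localProductL x c x (tractorForm p x z u) v + localProductL x c x u (tractorForm p x z v) -
          tractorForm p x z (localProductL x c x u v) := by
  constructor
  -- Constant local sections have covariant derivative θu at the centre, so they test the
  -- zeroth-order condition.
  · intro hp x z u v
    have h1 := hp _ _ x (smoothSectionAt_constSection x u).diffSectionAt
      (smoothSectionAt_constSection x v).diffSectionAt z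
    rw [tractorConnection_constSection, tractorConnection_constSection, constSection_self,
      constSection_self, tractorConnection_apply,
      mvfderiv_eq_of_eventuallyEq (localProduct_eventuallyEq x u v), constSection_self,
      constSection_self, mvfderiv_apply₂ (h.mdifferentiableAt_localProductL x)] at h1
    rw [localProductL_self, localProductL_self, localProductL_self]
    exact eq_sub_of_add_eq h1
  · intro hp U V x hU hV z
    have h1 := mvfderiv_clm₂ (h.mdifferentiableAt_localProductL x) (diffSectionAt_iff.1 hU)
      (diffSectionAt_iff.1 hV) z
    rw [hp, localSection_self, localSection_self] at h1
    rw [tractorConnection_apply, tractorConnection_apply, tractorConnection_apply,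
      mvfderiv_eq_of_eventuallyEq (localSection_product x c U V), h1]
    exact leibniz_bilin (localProductL x c x) (tractorForm p x z) (localProductL_self x)
      (U x) (V x) _ _

end Parallel

/-! ### Raising preserves smoothness and parallelism -/

section Raising
open Bundle
variable {M : Type*} [TopologicalSpace M] [ChartedSpace (Coord 6) M]
  [IsManifold (𝓡 6) ∞ M] {p : ProjectiveStructure 6 M}
  {Φ : Π x : M, Tractor 6 M x [⋀^Fin 3]→L[ℝ] ℝ}
  {c : Π x : M, Tractor 6 M x →ₗ[ℝ] Tractor 6 M x →ₗ[ℝ] Tractor 6 M x}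

theorem finrank_tractor : Module.finrank ℝ (Coord 6 × ℝ) = 7 := by simp

/-- Compatibility of a 3-form and a product in local expressions. -/
theorem exists_isG2Triple_local {x y : M}
    (hy : y ∈ (trivializationAt (Coord 6 × ℝ) (Tractor 6 M) x).baseSet)
    (h : ∃ B, IsG2Triple (V := Coord 6 × ℝ) (Φ y) B (c y)) :
    ∃ B, IsG2Triple (localForm x Φ y) B (localProduct x c y) := by
  obtain ⟨B, h⟩ := h
  let t := trivializationAt (Coord 6 × ℝ) (Tractor 6 M) x
  let Φ' : (Coord 6 × ℝ) [⋀^Fin 3]→L[ℝ] ℝ := Φ y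
  let c' : (Coord 6 × ℝ) →ₗ[ℝ] (Coord 6 × ℝ) →ₗ[ℝ] (Coord 6 × ℝ) := c y
  -- Local expressions are pullbacks by this identification of the model space with the fibre, so
  -- naturality of triples applies.
  let g : (Coord 6 × ℝ) ≃L[ℝ] (Coord 6 × ℝ) := (t.continuousLinearEquivAt ℝ y hy).symm
  have h' := h.comp (Module.finBasisOfFinrankEq ℝ _ finrank_tractor) g
  have e1 : localForm x Φ y =
      Φ'.compContinuousLinearMap (g : (Coord 6 × ℝ) →L[ℝ] (Coord 6 × ℝ)) := by
    rw [localForm, ← Trivialization.symm_continuousLinearEquivAt_eq' _ hy]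
    rfl
  have e2 : localProduct x c y =
      (c'.compl₁₂ g.toLinearEquiv.toLinearMap g.toLinearEquiv.toLinearMap).compr₂
        g.symm.toLinearEquiv.toLinearMap := by
    have e3 : t.linearMapAt ℝ y = (t.continuousLinearEquivAt ℝ y hy).toLinearEquiv.toLinearMap :=
      LinearMap.ext fun v => congrFun (t.coe_linearMapAt_of_mem (R := ℝ) hy) v
    rw [localProduct, ← Trivialization.symm_continuousLinearEquivAt_eq' _ hy, e3]
    rfl
  refine ⟨B.compl₁₂ g.toLinearEquiv.toLinearMap g.toLinearEquiv.toLinearMap, ?_⟩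
  rw [e1, e2]
  exact h'

theorem contMDiffAt_localForm (h : IsSmoothForm Φ) (x : M) :
    ContMDiffAt (𝓡 6) 𝓘(ℝ, (Coord 6 × ℝ) [⋀^Fin 3]→L[ℝ] ℝ) ∞ (localForm x Φ) x := by
  let b := Module.finBasisOfFinrankEq ℝ (Coord 6 × ℝ) finrank_tractor
  refine contMDiffAt_of_separating (ι := Fin 7 × Fin 7 × Fin 7)
    (fun i => ContinuousAlternatingMap.apply ℝ (Coord 6 × ℝ) ℝ ![b i.1, b i.2.1, b i.2.2])
    (fun e he => form_ext_of_lt b fun i j k _ _ => he (i, j, k)) fun i => ?_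
  have := h _ _ _ x (smoothSectionAt_constSection x (b i.1))
    (smoothSectionAt_constSection x (b i.2.1)) (smoothSectionAt_constSection x (b i.2.2))
  simp only [← localForm_apply] at this
  exact this

/-- Parallelism tested on constant local sections: dΦ at the centre is the action of the connection
form on Φ. -/
theorem mvfderiv_localForm (h : IsSmoothForm Φ) (hp : IsParallelForm p Φ) (x : M)
    (z : TangentSpace (𝓡 6) x) :
    mvfderiv (𝓡 6) (localForm x Φ) x z =
      ContinuousAlternatingMap.fderivCompContinuousLinearMap (localForm x Φ x)
        (.id ℝ (Coord 6 × ℝ)) (tractorForm p x z) := by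
  refine form_ext_of_lt (Module.finBasisOfFinrankEq ℝ (Coord 6 × ℝ) finrank_tractor)
    fun i j k _ _ => ?_
  generalize Module.finBasisOfFinrankEq ℝ (Coord 6 × ℝ) finrank_tractor = b
  have h1 := hp _ _ _ x (smoothSectionAt_constSection x (b i)).diffSectionAt
    (smoothSectionAt_constSection x (b j)).diffSectionAt
    (smoothSectionAt_constSection x (b k)).diffSectionAt z
  simp only [← localForm_apply, tractorConnection_constSection, constSection_self] at h1
  have h2 := mvfderiv_clm (ContinuousAlternatingMap.apply ℝ (Coord 6 × ℝ) ℝ ![b i, b j, b k])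
    (mdifferentiableAt_of_contMDiffAt (contMDiffAt_localForm h x)) z
  rw [fderivComp_apply, localForm_self]
  exact h2.symm.trans h1

theorem localProductL_eventuallyEq_raiseAt
    (h : ∀ y, ∃ B, IsG2Triple (V := Coord 6 × ℝ) (Φ y) B (c y))
    (b : Module.Basis (Fin 7) ℝ (Coord 6 × ℝ)) (x : M) (u v : Coord 6 × ℝ) :
    (fun y => localProductL x c y u v) =ᶠ[𝓝 x] fun y => raiseAt b u v (localForm x Φ y) := by
  filter_upwards [eventually_mem_baseSet (n := 6) x] with y hy
  obtain ⟨B, hB⟩ := exists_isG2Triple_local hy (h y)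
  exact (hB.raiseAt_eq b u v).symm

/-- Locally the product is `raiseAt` composed with the local form, hence smooth. By the chain rule
its derivative is that of `raiseAt` in the direction θ · Φ, which infinitesimal equivariance turns
into the action of θ on the product. -/
theorem IsParallelGenericForm.isParallelCrossProduct (hΦ : IsParallelGenericForm p Φ)
    (h : ∀ x, IsRaising (Φ x) (c x)) : IsParallelCrossProduct p c := by
  have h' (y : M) : ∃ B, IsG2Triple (V := Coord 6 × ℝ) (Φ y) B (c y) :=
    IsRaising.exists_isG2Triple (V := Coord 6 × ℝ) finrank_tractor (hΦ.stable y) (h y)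
  let b := Module.finBasisOfFinrankEq ℝ (Coord 6 × ℝ) finrank_tractor
  have hx (x : M) : ∃ B, IsG2Triple (localForm x Φ x) B (localProduct x c x) :=
    exists_isG2Triple_local (FiberBundle.mem_baseSet_trivializationAt' x) (h' x)
  have hd (x : M) (u v : Coord 6 × ℝ) : ContDiffAt ℝ ∞ (raiseAt b u v) (localForm x Φ x) := by
    obtain ⟨B, hB⟩ := hx x
    exact contDiffAt_raiseAt b u v (hB.det_ne_zero b)
  have hs : IsSmoothProduct c := isSmoothProduct_of_contMDiffAt fun x u v =>
    ((hd x u v).contMDiffAt.comp x (contMDiffAt_localForm hΦ.smooth x)).congr_of_eventuallyEq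
      (localProductL_eventuallyEq_raiseAt h' b x u v)
  refine ⟨hs, hs.isParallelProduct_iff.2 fun x z u v => ?_, fun x => ?_⟩
  · obtain ⟨B, hB⟩ := hx x
    rw [← mvfderiv_apply₂ (hs.mdifferentiableAt_localProductL x),
      mvfderiv_eq_of_eventuallyEq (localProductL_eventuallyEq_raiseAt h' b x u v),
      mvfderiv_comp_vector ((hd x u v).differentiableAt (by simp))
        (mdifferentiableAt_of_contMDiffAt (contMDiffAt_localForm hΦ.smooth x)),
      mvfderiv_localForm hΦ.smooth hΦ.parallel, hB.fderiv_raiseAt]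
    rfl
  · obtain ⟨B, hB⟩ := h' x
    exact hB.isCrossProduct

end Raising

/-! ### The trace form on endomorphisms -/

section TraceForm
variable {E : Type*} [NormedAddCommGroup E] [NormedSpace ℝ E] [FiniteDimensional ℝ E]

/-- The bilinear form `-(1/6) tr (S T)`. -/
noncomputable def traceDot : (E →L[ℝ] E) →L[ℝ] (E →L[ℝ] E) →L[ℝ] ℝ :=
  LinearMap.toContinuousBilinearMap <| LinearMap.mk₂ ℝ
    (fun S T : E →L[ℝ] E => -(1 / 6) * LinearMap.trace ℝ E (S.toLinearMap ∘ₗ T.toLinearMap))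
    (fun S S' T => by simp [LinearMap.add_comp, mul_add])
    (fun r S T => by simp [LinearMap.smul_comp, mul_left_comm])
    (fun S T T' => by simp [LinearMap.comp_add, mul_add])
    (fun r S T => by simp [LinearMap.comp_smul, mul_left_comm])

theorem traceDot_apply (S T : E →L[ℝ] E) :
    traceDot S T = -(1 / 6) * LinearMap.trace ℝ E (S.toLinearMap ∘ₗ T.toLinearMap) := rfl

/-- Invariance under conjugation in infinitesimal form: of the four traces, two agree by
associativity and two by cyclicity. -/
theorem traceDot_commutator (A S T : E →L[ℝ] E) :
    traceDot (S.comp A - A.comp S) T + traceDot S (T.comp A - A.comp T) = 0 := by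
  have h : LinearMap.trace ℝ E ((S.toLinearMap ∘ₗ T.toLinearMap) ∘ₗ A.toLinearMap) =
      LinearMap.trace ℝ E (A.toLinearMap ∘ₗ (S.toLinearMap ∘ₗ T.toLinearMap)) :=
    LinearMap.trace_comp_comm' _ _
  have e1 : traceDot (S.comp A) T = traceDot S (A.comp T) := rfl
  have e2 : traceDot S (T.comp A) = traceDot (A.comp S) T :=
    congrArg (fun r : ℝ => -(1 / 6) * r) h
  rw [map_sub, map_sub, sub_apply, e1, e2]
  ring

theorem dotOfCross_eq_traceDot {c : E →ₗ[ℝ] E →ₗ[ℝ] E} {C : E →L[ℝ] E →L[ℝ] E}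
    (hC : ∀ u v, C u v = c u v) (u v : E) : dotOfCross c u v = traceDot (C u) (C v) := by
  have e (u : E) : (C u).toLinearMap = c u := LinearMap.ext (hC u)
  rw [traceDot_apply, e, e, dotOfCross]

theorem traceDot_leibniz (C : E →L[ℝ] E →L[ℝ] E) {a u u' v v' w w₁ w₂ : E} (hu : u' = u)
    (hv : v' = v) (hw : w = w₁ + w₂) : traceDot (C a) (C v') + traceDot (C u') (C w) =
      traceDot (C a) (C v) + traceDot (C u) (C w₁) + traceDot (C u) (C w₂) := by
  rw [hu, hv, hw, map_add, map_add, add_assoc]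

/-- If S and T vary by S' and T' up to commutators with the same A, the commutators drop out. With A
= θ this says that the trace form is parallel. -/
theorem mvfderiv_traceDot {n : ℕ} {M : Type*} [TopologicalSpace M] [ChartedSpace (Coord n) M]
    {S T : M → E →L[ℝ] E} {x : M} (hS : MDifferentiableAt (𝓡 n) 𝓘(ℝ, E →L[ℝ] E) S x)
    (hT : MDifferentiableAt (𝓡 n) 𝓘(ℝ, E →L[ℝ] E) T x) {A S' T' : E →L[ℝ] E}
    {z : TangentSpace (𝓡 n) x}
    (hS' : mvfderiv (𝓡 n) S x z = S' + ((S x).comp A - A.comp (S x)))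
    (hT' : mvfderiv (𝓡 n) T x z = T' + ((T x).comp A - A.comp (T x))) :
    mvfderiv (𝓡 n) (fun y => traceDot (S y) (T y)) x z =
      traceDot S' (T x) + traceDot (S x) T' := by
  rw [mvfderiv_bilin traceDot hS hT, hS', hT', map_add, map_add, add_apply]
  linear_combination traceDot_commutator A (S x) (T x)

end TraceForm

/-! ### Derivatives along sections for lowering -/

section Lowering
open Bundle
variable {n : ℕ} {M : Type*} [TopologicalSpace M] [ChartedSpace (Coord n) M]
  [IsManifold (𝓡 n) ∞ M] {p : ProjectiveStructure n M}
  {c : Π x : M, Tractor n M x →ₗ[ℝ] Tractor n M x →ₗ[ℝ] Tractor n M x}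

theorem localForm_localSection (x : M) (Φ : Π x : M, Tractor n M x [⋀^Fin 3]→L[ℝ] ℝ)
    (U V W : Π x : M, Tractor n M x) :
    (fun y => Φ y ![U y, V y, W y]) =ᶠ[𝓝 x] fun y =>
      localForm x Φ y ![localSection x U y, localSection x V y, localSection x W y] := by
  filter_upwards [constSection_localSection x U, constSection_localSection x V,
    constSection_localSection x W] with y hU hV hW
  rw [localForm_apply, hU, hV, hW]

theorem mvfderiv_localProductL_section (h : IsSmoothProduct c) (hp : IsParallelProduct p c)
    {U : Π x : M, Tractor n M x} {x : M} (hU : DiffSectionAt U x) (z : TangentSpace (𝓡 n) x) :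
    mvfderiv (𝓡 n) (fun y => localProductL x c y (localSection x U y)) x z =
      localProductL x c x (tractorConnection p U x z) +
        ((localProductL x c x (localSection x U x)).comp (tractorForm p x z) -
          (tractorForm p x z).comp (localProductL x c x (localSection x U x))) := by
  have e : tractorConnection p U x z = mvfderiv (𝓡 n) (localSection x U) x z +
      tractorForm p x z (localSection x U x) :=
    congrArg (fun u => mvfderiv (𝓡 n) (localSection x U) x z + tractorForm p x z u)
      (localSection_self x U).symm
  refine (mvfderiv_clm_apply (h.mdifferentiableAt_localProductL x)
    (diffSectionAt_iff.1 hU) z).trans ?_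
  refine ContinuousLinearMap.ext fun v => ?_
  rw [add_apply, h.isParallelProduct_iff.1 hp, e]
  exact leibniz_bilin_operator (localProductL x c x) (tractorForm p x z) _ v _

end Lowering

/-! ### Lowering preserves smoothness and parallelism -/

section LoweringSeven
open Bundle
variable {M : Type*} [TopologicalSpace M] [ChartedSpace (Coord 6) M]
  [IsManifold (𝓡 6) ∞ M] {p : ProjectiveStructure 6 M}
  {Φ : Π x : M, Tractor 6 M x [⋀^Fin 3]→L[ℝ] ℝ}
  {c : Π x : M, Tractor 6 M x →ₗ[ℝ] Tractor 6 M x →ₗ[ℝ] Tractor 6 M x}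

/-- Expresses Φ through the product alone, near x rather than only at x, so that both sides can be
differentiated. -/
theorem form_eventuallyEq_traceDot
    (h : ∀ y, ∃ B, IsG2Triple (V := Coord 6 × ℝ) (Φ y) B (c y)) (x : M)
    (U V W : Π x : M, Tractor 6 M x) :
    (fun y => Φ y ![U y, V y, W y]) =ᶠ[𝓝 x] fun y =>
      traceDot (localProductL x c y (localSection x U y))
        (localProductL x c y (localSection x (fun y => c y (V y) (W y)) y)) := by
  filter_upwards [eventually_mem_baseSet (n := 6) x, localForm_localSection x Φ U V W,
    localSection_product x c V W] with y hy h1 h2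
  obtain ⟨B, hB⟩ := exists_isG2Triple_local hy (h y)
  rw [h1, h2]
  exact hB.isLowering finrank_tractor _ _ _

theorem isLowering_traceDot {x : M} (h : IsLowering (c x) (Φ x)) (u v w : Tractor 6 M x) :
    Φ x ![u, v, w] =
      traceDot (localProductL x c x u) (localProductL x c x (c x v w)) := by
  exact (h u v w).trans (dotOfCross_eq_traceDot (E := Coord 6 × ℝ) (localProductL_self x) _ _)

/-- Differentiating the trace of c(U) ∘ c(V × W) leaves the terms with ∇U and ∇(V × W), and the
Leibniz rule for the product splits the latter. -/
theorem IsParallelCrossProduct.isParallelGenericForm (hc : IsParallelCrossProduct p c)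
    (h : ∀ x, IsLowering (c x) (Φ x)) : IsParallelGenericForm p Φ := by
  have h' (y : M) : ∃ B, IsG2Triple (V := Coord 6 × ℝ) (Φ y) B (c y) :=
    IsLowering.exists_isG2Triple (V := Coord 6 × ℝ) finrank_tractor (hc.crossProduct y) (h y)
  have hC := hc.smooth.contMDiffAt_localProductL
  refine ⟨fun U V W x hU hV hW => ?_, fun U V W x hU hV hW z => ?_, fun x => ?_⟩
  · refine ContMDiffAt.congr_of_eventuallyEq ?_ (form_eventuallyEq_traceDot h' x U V W)
    exact contMDiffAt_bilin traceDot ((hC x).clm_apply (smoothSectionAt_iff.1 hU))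
      ((hC x).clm_apply (smoothSectionAt_iff.1 (hc.smooth V W x hV hW)))
  · have hd := hc.smooth.mdifferentiableAt_localProductL x
    have hX : DiffSectionAt (fun y => c y (V y) (W y)) x := diffSectionAt_iff.2
      (((hd.clm_apply (diffSectionAt_iff.1 hV)).clm_apply
        (diffSectionAt_iff.1 hW)).congr_of_eventuallyEq (localSection_product x c V W))
    have key := mvfderiv_traceDot (hd.clm_apply (diffSectionAt_iff.1 hU))
      (hd.clm_apply (diffSectionAt_iff.1 hX))
      -- The same formula is used for U and for the differentiable section V × W.
      (mvfderiv_localProductL_section hc.smooth hc.parallel hU z)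
      (mvfderiv_localProductL_section hc.smooth hc.parallel hX z)
    refine (DFunLike.congr_fun (mvfderiv_eq_of_eventuallyEq
      (form_eventuallyEq_traceDot h' x U V W)) z).trans (key.trans ?_)
    refine Eq.trans ?_ (congrArg₂ (· + ·) (congrArg₂ (· + ·) (isLowering_traceDot (h x) _ _ _)
      (isLowering_traceDot (h x) _ _ _)) (isLowering_traceDot (h x) _ _ _)).symm
    exact traceDot_leibniz (localProductL x c x) (localSection_self x U) (localSection_self x _)
      (hc.parallel V W x hV hW z)
  · obtain ⟨B, hB⟩ := h' x
    exact hB.isStable finrank_tractor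

end LoweringSeven

end ProjTractor

theorem proposition5p4 {M : Type*} [TopologicalSpace M] [T2Space M] [SecondCountableTopology M]
    [ChartedSpace (ProjTractor.Coord 6) M] [IsManifold (𝓡 6) ∞ M]
    (p : ProjTractor.ProjectiveStructure 6 M) :
    -- a parallel generic 3-form determines a unique product, which is a parallel cross product
    (∀ Φ : (x : M) → ProjTractor.Tractor 6 M x [⋀^Fin 3]→L[ℝ] ℝ,
      ProjTractor.IsParallelGenericForm p Φ →
      ∃! c : (x : M) → ProjTractor.Tractor 6 M x →ₗ[ℝ] ProjTractor.Tractor 6 M x →ₗ[ℝ]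
          ProjTractor.Tractor 6 M x,
        (∀ x, ProjTractor.IsRaising (Φ x) (c x))) ∧
    (∀ (Φ : (x : M) → ProjTractor.Tractor 6 M x [⋀^Fin 3]→L[ℝ] ℝ)
      (c : (x : M) → ProjTractor.Tractor 6 M x →ₗ[ℝ] ProjTractor.Tractor 6 M x →ₗ[ℝ]
          ProjTractor.Tractor 6 M x),
      ProjTractor.IsParallelGenericForm p Φ → (∀ x, ProjTractor.IsRaising (Φ x) (c x)) →
      ProjTractor.IsParallelCrossProduct p c) ∧
    -- a parallel cross product determines a unique 3-form, which is parallel and generic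
    (∀ c : (x : M) → ProjTractor.Tractor 6 M x →ₗ[ℝ] ProjTractor.Tractor 6 M x →ₗ[ℝ]
          ProjTractor.Tractor 6 M x,
      ProjTractor.IsParallelCrossProduct p c →
      ∃! Φ : (x : M) → ProjTractor.Tractor 6 M x [⋀^Fin 3]→L[ℝ] ℝ,
        (∀ x, ProjTractor.IsLowering (c x) (Φ x))) ∧
    (∀ (c : (x : M) → ProjTractor.Tractor 6 M x →ₗ[ℝ] ProjTractor.Tractor 6 M x →ₗ[ℝ]
          ProjTractor.Tractor 6 M x)
      (Φ : (x : M) → ProjTractor.Tractor 6 M x [⋀^Fin 3]→L[ℝ] ℝ),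
      ProjTractor.IsParallelCrossProduct p c → (∀ x, ProjTractor.IsLowering (c x) (Φ x)) →
      ProjTractor.IsParallelGenericForm p Φ) ∧
    -- the two constructions are mutually inverse
    (∀ (Φ : (x : M) → ProjTractor.Tractor 6 M x [⋀^Fin 3]→L[ℝ] ℝ)
      (c : (x : M) → ProjTractor.Tractor 6 M x →ₗ[ℝ] ProjTractor.Tractor 6 M x →ₗ[ℝ]
          ProjTractor.Tractor 6 M x),
      ProjTractor.IsParallelGenericForm p Φ → ProjTractor.IsParallelCrossProduct p c →
      ((∀ x, ProjTractor.IsRaising (Φ x) (c x)) ↔ ∀ x, ProjTractor.IsLowering (c x) (Φ x))) ∧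
    -- and they preserve the definite or split type
    (∀ (Φ : (x : M) → ProjTractor.Tractor 6 M x [⋀^Fin 3]→L[ℝ] ℝ)
      (c : (x : M) → ProjTractor.Tractor 6 M x →ₗ[ℝ] ProjTractor.Tractor 6 M x →ₗ[ℝ]
          ProjTractor.Tractor 6 M x),
      ProjTractor.IsParallelGenericForm p Φ → (∀ x, ProjTractor.IsRaising (Φ x) (c x)) →
      ∀ x,
        (ProjTractor.IsDefiniteStable (Φ x) ↔ ProjTractor.IsDefiniteCross (c x)) ∧
        (ProjTractor.IsSplitStable (Φ x) ↔ ProjTractor.IsSplitCross (c x))) := by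
  -- Each fibre is by definition this model space, whose norm the pointwise results use.
  have hV : Module.finrank ℝ (ProjTractor.Coord 6 × ℝ) = 7 := ProjTractor.finrank_tractor
  refine ⟨fun Φ hΦ => ?_, fun Φ c hΦ h => hΦ.isParallelCrossProduct h, fun c hc => ?_,
    fun c Φ hc h => hc.isParallelGenericForm h, fun Φ c hΦ hc => forall_congr' fun x =>
      ProjTractor.isRaising_iff_isLowering (V := ProjTractor.Coord 6 × ℝ) hV (hΦ.stable x)
        (hc.crossProduct x), fun Φ c hΦ h x => ?_⟩
  · have hx (x : M) : ∃! c : ProjTractor.Tractor 6 M x →ₗ[ℝ] ProjTractor.Tractor 6 M x →ₗ[ℝ]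
        ProjTractor.Tractor 6 M x, ProjTractor.IsRaising (Φ x) c :=
      ProjTractor.IsStable.existsUnique_isRaising (V := ProjTractor.Coord 6 × ℝ) hV (hΦ.stable x)
    -- Existence and uniqueness hold fibre by fibre among all products; smoothness is part of the
    -- separate parallelism statement.
    choose c h1 h2 using hx
    exact ⟨c, h1, fun c' h' => funext fun x => h2 x _ (h' x)⟩
  · have hx (x : M) : ∃! Φ : ProjTractor.Tractor 6 M x [⋀^Fin 3]→L[ℝ] ℝ,
        ProjTractor.IsLowering (c x) Φ :=
      ProjTractor.IsCrossProduct.existsUnique_isLowering (V := ProjTractor.Coord 6 × ℝ) hV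
        (hc.crossProduct x)
    choose Φ h1 h2 using hx
    exact ⟨Φ, h1, fun Φ' h' => funext fun x => h2 x _ (h' x)⟩
  · obtain ⟨B, hB⟩ := ProjTractor.IsRaising.exists_isG2Triple (V := ProjTractor.Coord 6 × ℝ) hV
      (hΦ.stable x) (h x)
    exact hB.type_iff hV
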